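/- **Setting.** Let $E$ be a separable real Hilbert space and $S(t)$, $t\ge 0$, a strongly continuous semigroup of contractions on $E$ with generator $-A$. Let $U^1,U^2$ be nonempty compact metric spaces, $D^1,D^2$ finite sets, $K\subset E$ nonempty, closed and convex, and $\lambda>0$. Let $f:E\times U^1\times D^1\times U^2\times D^2\to E$, $k:E\times U^1\times D^1\times U^2\times D^2\to\mathbb R$, $c^i:D^i\times D^i\to\mathbb R$ and $l:K\to\mathbb R$ satisfy: (A1) $f$ is bounded, continuous, and Lipschitz in $x\in E$ uniformly in the other variables. (A2) $k,c^i,l$ are nonnegative and continuous; $k$ is bounded and Lipschitz in $x$ uniformly in the other variables; $l(\xi_0+\xi_1)<l(\xi_0)+l(\xi_1)$ whenever $\xi_0,\xi_1,\xi_0+\xi_1\in K$; $l(\xi)\to\infty$ as $|\xi|\to\infty$ in $K$; and $\inf_{d\ne d'}c^i(d,d')>0$. **Controls and state.** $\mathcal U^i$ is the set of measurable $u^i:[0,\infty)\to U^i$. A switching control $d^i(\cdot)\in\mathcal D^i$ is given by times $0=\theta^i_0\le\theta^i_1\le\dots$ in $[0,\infty]$ with $\theta^i_j\to\infty$ and modes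 $d^i_j\in D^i$ with $d^i_{j-1}\ne d^i_j$ if $\theta^i_j<\infty$; its value on $[\theta^i_{j-1},\theta^i_j)$ is $d^i_{j-1}$, and it starts in the mode $d^i_0$. An impulse control $\xi(\cdot)\in\mathcal K$ is given by times $\tau_0\le\tau_1\le\dots$ in $[0,\infty]$ with $\tau_j\to\infty$ and vectors $\xi_j\in K$. Put $\mathcal C^1=\mathcal U^1\times\mathcal D^1$ and $\mathcal C^2=\mathcal U^2\times\mathcal D^2\times\mathcal K$, and let $\mathcal C^{i,d^i}\subset\mathcal C^i$ consist of the controls starting in the mode $d^i$. For $x\in E$ let $y_x$ be the mild solution $$y_x(t)=S(t)x+\int_0^tS(t-s)f(y_x(s),u^1(s),d^1(s),u^2(s),d^2(s))\,ds+\sum_{\tau_j\le t}S(t-\tau_j)\xi_j ,\quad t\ge 0 .$$ The cost is (with $e^{-\lambda\infty}=0$) $$J_x=\int_0^\infty e^{-\lambda t}k(y_x(t),u^1(t),d^1(t),u^2(t),d^2(t))\,dt-\sum_{j\ge1}e^{-\lambda\theta^1_j}c^1(d^1_{j-1},d^1_j)+\sum_{j\ge1}e^{-\lambda\theta^2_j}c^2(d^2_{j-1},d^2_j)+\sum_{j\ge0}e^{-\lambda\tau_j}l(\xi_j),$$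 with values in $[-\infty,\infty]$, where $J_x=-\infty$ if the total switching cost of player 1 is infinite. **Values.** A map between $\mathcal C^1$ and $\mathcal C^2$ (in either direction) is nonanticipating if, for every $t\ge0$, it sends controls that agree on $[0,t]$ to controls that agree on $[0,t]$; here agreement means equality a.e. on $[0,t]$ of the continuous controls, the same initial modes, and the same switches and impulses at times $\le t$. Let $\Gamma^{d^1}$ be the set of nonanticipating $\alpha:\mathcal C^2\to\mathcal C^1$ whose outputs start in the mode $d^1$, and $\Delta^{d^2}$ the set of nonanticipating $\beta:\mathcal C^1\to\mathcal C^2$ whose outputs start in the mode $d^2$. Put $$V_+^{d^1,d^2}(x)=\sup_{\alpha\in\Gamma^{d^1}}\inf_{q\in\mathcal C^{2,d^2}}J_x[\alpha(q),q],\qquad V_-^{d^1,d^2}(x)=\inf_{\beta\in\Delta^{d^2}}\sup_{p\in\mathcal C^{1,d^1}}J_x[p,\beta(p)].$$ **Inequalities.** For $x,p\in E$ let $$H_-^{d^1,d^2}(x,p)=\max_{u^2}\min_{u^1}[\langle-p,f\rangle-k],\qquad H_+^{d^1,d^2}(x,p)=\min_{u^1}\max_{u^2}[\langle-p,f\rangle-k],$$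 with $f,k$ evaluated at $(x,u^1,d^1,u^2,d^2)$, and for $V=(V^{d^1,d^2})$ let $$M_-^{d^1,d^2}[V](x)=\min_{\bar d^2\ne d^2}[V^{d^1,\bar d^2}(x)+c^2(d^2,\bar d^2)],\quad M_+^{d^1,d^2}[V](x)=\max_{\bar d^1\ne d^1}[V^{\bar d^1,d^2}(x)-c^1(d^1,\bar d^1)],\quad N[V^{d^1,d^2}](x)=\inf_{\xi\in K}[V^{d^1,d^2}(x+\xi)+l(\xi)],$$ where $\min\emptyset=+\infty$ and $\max\emptyset=-\infty$. For $\Phi:E\to\mathbb R$ let $D_A^+\Phi(x)$ and $D_A^-\Phi(x)$ be the $\limsup$ and $\liminf$, as $\delta\downarrow0$ and $y\to x$, of $\frac1\delta[\Phi(y)-\Phi(S(\delta)y)]$. With $H=H_+$ for the upper SQVI (HJI$+$) and $H=H_-$ for the lower SQVI (HJI$-$), these are the pairs of systems, for all $(d^1,d^2)$ (superscripts omitted), $$\min\{\max(\lambda V+\langle Ax,DV\rangle+H(x,DV),\,V-M_-[V],\,V-N[V]),\,V-M_+[V]\}=0,\tag{1}$$ $$\max\{\min(\lambda V+\langle Ax,DV\rangle+H(x,DV),\,V-M_+[V]),\,V-M_-[V],\,V-N[V]\}=0.\tag{2}$$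 A continuous real-valued $V$ is an approximate viscosity subsolution of (1) [of (2)] if for every $R>0$ there is $C_R>0$ such that, for all $(d^1,d^2)$, all $\Phi=\phi+\psi$ with $\phi\in C^1(E)$ and $\psi$ Lipschitz with Lipschitz constant $L(\psi)$, and every local maximum $\hat x$ of $V^{d^1,d^2}-\Phi$ with $\|\hat x\|\le R$, the left side of (1) [of (2)] at $\hat x$ is $\le0$ when its differential term is replaced by $$\lambda V^{d^1,d^2}(\hat x)+D_A^-\Phi(\hat x)+H^{d^1,d^2}(\hat x,D\phi(\hat x))-C_RL(\psi).$$ It is an approximate viscosity supersolution if the same holds with local minima, with $\ge0$, and with the replacement $\lambda V^{d^1,d^2}(\hat x)+D_A^+\Phi(\hat x)+H^{d^1,d^2}(\hat x,D\phi(\hat x))+C_RL(\psi)$. An approximate viscosity solution of (HJI$\pm$) is an approximate sub- and supersolution of both (1) and (2). **Theorem.** $V_-$ is finite and is an approximate viscosity solution of (HJI$+$). $V_+$ is finite and is an approximate viscosity solution of (HJI$-$). (In particular, both are continuous.) -/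

import Mathlib

open Set Filter Topology MeasureTheory
open scoped ENNReal NNReal

noncomputable section

/-- A strongly continuous semigroup of contractions `S t`, `t ≥ 0`, on `E` (values at `t < 0` play
no role). Its generator is written `-A`. -/
structure ContractionSemigroup (E : Type*) [NormedAddCommGroup E] [NormedSpace ℝ E] where
  /-- The operators of the semigroup. -/
  S : ℝ → E →L[ℝ] E
  zero : S 0 = ContinuousLinearMap.id ℝ E
  add : ∀ s t : ℝ, 0 ≤ s → 0 ≤ t → S (s + t) = (S s).comp (S t)
  contraction : ∀ t : ℝ, 0 ≤ t → ‖S t‖ ≤ 1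
  strongCont : ∀ x : E, ContinuousOn (fun t => S t x) (Ici 0)

/-! ### Controls -/

/-- Continuous controls: measurable maps from the time axis to `U`. Only the values on `[0, ∞)`
are ever used. -/
abbrev ContControl (U : Type*) [MeasurableSpace U] := {u : ℝ → U // Measurable u}

/-- Switching controls `∑_{j ≥ 1} d_{j-1} χ_{[θ_{j-1}, θ_j)}`, given by their switching times
`θ_j = time j` in `[0, ∞]` and modes `d_j = mode j`. Times may coincide, so that several switches
can be made at one instant, also at time `0`. -/
structure SwitchingControl (D : Type*) where
  time : ℕ → ℝ≥0∞
  mode : ℕ → D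
  time_zero : time 0 = 0
  time_mono : Monotone time
  time_tendsto : Tendsto time atTop (𝓝 ⊤)
  mode_ne : ∀ j, time (j + 1) < ⊤ → mode j ≠ mode (j + 1)

/-- Impulse controls `∑_{j ≥ 0} ξ_j χ_{[τ_j, ∞]}`, given by the impulse times `τ_j = time j` in
`[0, ∞]` and the impulse vectors `ξ_j = vec j` in `K`. -/
structure ImpulseControl {E : Type*} (K : Set E) where
  time : ℕ → ℝ≥0∞
  vec : ℕ → K
  time_mono : Monotone time
  time_tendsto : Tendsto time atTop (𝓝 ⊤)

namespace SwitchingControl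

variable {D : Type*}

/-- The value at time `s` of the piecewise constant function described by `d`: it is `d_j` for
`θ_j ≤ s < θ_{j+1}` (see `val_eq`). -/
def val (d : SwitchingControl D) (s : ℝ) : D :=
  d.mode (sSup {j | d.time j ≤ ENNReal.ofReal s})

theorem val_eq (d : SwitchingControl D) {s : ℝ} {j : ℕ} (h1 : d.time j ≤ ENNReal.ofReal s)
    (h2 : ENNReal.ofReal s < d.time (j + 1)) : d.val s = d.mode j := by
  have h : IsGreatest {i | d.time i ≤ ENNReal.ofReal s} j := by
    refine ⟨h1, fun i hi => ?_⟩
    by_contra hij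
    exact absurd (h2.trans_le (d.time_mono (by omega : j + 1 ≤ i))) (not_lt.mpr hi)
  rw [val, h.csSup_eq]

/-- Two switching controls agree on `[0, t]`: they start in the same mode (the case `j = 0`) and
make the same switches up to and including time `t`. -/
def AgreeUpTo (t : ℝ) (d d' : SwitchingControl D) : Prop :=
  ∀ j, d.time j ≤ ENNReal.ofReal t ∨ d'.time j ≤ ENNReal.ofReal t →
    d.time j = d'.time j ∧ d.mode j = d'.mode j

end SwitchingControl

/-- Two impulse controls agree on `[0, t]`: the impulses up to and including time `t` coincide. -/
def ImpulseControl.AgreeUpTo {E : Type*} {K : Set E} (t : ℝ) (ξ ξ' : ImpulseControl K) : Prop :=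
  ∀ j, ξ.time j ≤ ENNReal.ofReal t ∨ ξ'.time j ≤ ENNReal.ofReal t →
    ξ.time j = ξ'.time j ∧ ξ.vec j = ξ'.vec j

/-- Two continuous controls agree almost everywhere on `[0, t]`. -/
def ContControl.AgreeUpTo {U : Type*} [MeasurableSpace U] (t : ℝ) (u u' : ContControl U) : Prop :=
  ∀ᵐ s ∂(volume.restrict (Icc (0 : ℝ) t)), u.1 s = u'.1 s

/-- The discount factor `e^{-λ t}` for `t` in `[0, ∞]`, with `e^{-λ ∞} = 0`. -/
def discountFactor (lam : ℝ) (t : ℝ≥0∞) : ℝ≥0∞ :=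
  if t = ⊤ then 0 else ENNReal.ofReal (Real.exp (-lam * t.toReal))

/-! ### The game -/

/-- The data of the game: semigroup, dynamics `f`, running cost `k`, switching costs `c₁`, `c₂`,
closed convex impulse set `K`, impulse cost `l` and discount parameter `lam > 0`. Player 1 has the
continuous control set `U₁` and the modes `D₁`; player 2 has `U₂`, `D₂` and the impulses `K`. -/
structure HybridGame (E U₁ U₂ D₁ D₂ : Type*) [NormedAddCommGroup E] [NormedSpace ℝ E] where
  semigroup : ContractionSemigroup E
  f : E → U₁ → D₁ → U₂ → D₂ → E
  k : E → U₁ → D₁ → U₂ → D₂ → ℝ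
  c₁ : D₁ → D₁ → ℝ
  c₂ : D₂ → D₂ → ℝ
  K : Set E
  K_nonempty : K.Nonempty
  K_closed : IsClosed K
  K_convex : Convex ℝ K
  l : K → ℝ
  lam : ℝ
  lam_pos : 0 < lam

namespace HybridGame

variable {E U₁ U₂ D₁ D₂ : Type*} [NormedAddCommGroup E] [InnerProductSpace ℝ E]

/-- Assumption on the dynamics: `f` is bounded, continuous (the finite sets of modes are discrete),
and Lipschitz in the state, uniformly in the controls. -/
structure A1 [TopologicalSpace U₁] [TopologicalSpace U₂] (G : HybridGame E U₁ U₂ D₁ D₂) :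
    Prop where
  bounded : ∃ C : ℝ, ∀ x u₁ d₁ u₂ d₂, ‖G.f x u₁ d₁ u₂ d₂‖ ≤ C
  continuous : ∀ d₁ d₂, Continuous fun p : E × U₁ × U₂ => G.f p.1 p.2.1 d₁ p.2.2 d₂
  lipschitz : ∃ L : ℝ, ∀ x y u₁ d₁ u₂ d₂,
    ‖G.f x u₁ d₁ u₂ d₂ - G.f y u₁ d₁ u₂ d₂‖ ≤ L * ‖x - y‖

/-- Assumptions on the costs. The strict subadditivity of `l` is required whenever it makes sense,
that is, whenever the sum of the two impulses lies in `K`. -/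
structure A2 [TopologicalSpace U₁] [TopologicalSpace U₂] (G : HybridGame E U₁ U₂ D₁ D₂) :
    Prop where
  k_nonneg : ∀ x u₁ d₁ u₂ d₂, 0 ≤ G.k x u₁ d₁ u₂ d₂
  k_bounded : ∃ C : ℝ, ∀ x u₁ d₁ u₂ d₂, G.k x u₁ d₁ u₂ d₂ ≤ C
  k_continuous : ∀ d₁ d₂, Continuous fun p : E × U₁ × U₂ => G.k p.1 p.2.1 d₁ p.2.2 d₂
  k_lipschitz : ∃ L : ℝ, ∀ x y u₁ d₁ u₂ d₂,
    |G.k x u₁ d₁ u₂ d₂ - G.k y u₁ d₁ u₂ d₂| ≤ L * ‖x - y‖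
  c₁_nonneg : ∀ d d', 0 ≤ G.c₁ d d'
  c₂_nonneg : ∀ d d', 0 ≤ G.c₂ d d'
  c₁_pos : ∃ c₀ > 0, ∀ d d', d ≠ d' → c₀ ≤ G.c₁ d d'
  c₂_pos : ∃ c₀ > 0, ∀ d d', d ≠ d' → c₀ ≤ G.c₂ d d'
  l_nonneg : ∀ ξ, 0 ≤ G.l ξ
  l_continuous : Continuous G.l
  l_subadditive : ∀ (ξ₀ ξ₁ : G.K) (h : (ξ₀ : E) + ξ₁ ∈ G.K), G.l ⟨ξ₀ + ξ₁, h⟩ < G.l ξ₀ + G.l ξ₁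
  l_coercive : Tendsto G.l (comap (fun ξ : G.K => ‖(ξ : E)‖) atTop) atTop

section Values

variable [MeasurableSpace U₁] [MeasurableSpace U₂]

/-- The controls of player 1: a continuous and a switching control. -/
@[nolint unusedArguments]
abbrev C1 (_G : HybridGame E U₁ U₂ D₁ D₂) := ContControl U₁ × SwitchingControl D₁

/-- The controls of player 2: a continuous, a switching and an impulse control. -/
abbrev C2 (G : HybridGame E U₁ U₂ D₁ D₂) :=
  ContControl U₂ × SwitchingControl D₂ × ImpulseControl G.K

variable (G : HybridGame E U₁ U₂ D₁ D₂)

/-- Agreement of two controls of player 1 on `[0, t]`. -/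
def Agree1 (t : ℝ) (c c' : G.C1) : Prop :=
  ContControl.AgreeUpTo t c.1 c'.1 ∧ SwitchingControl.AgreeUpTo t c.2 c'.2

/-- Agreement of two controls of player 2 on `[0, t]`. -/
def Agree2 (t : ℝ) (c c' : G.C2) : Prop :=
  ContControl.AgreeUpTo t c.1 c'.1 ∧ SwitchingControl.AgreeUpTo t c.2.1 c'.2.1 ∧
    ImpulseControl.AgreeUpTo t c.2.2 c'.2.2

/-- The controls of player 1 that start in the mode `d`. -/
def C1From (d : D₁) : Set G.C1 := {c | c.2.mode 0 = d}

/-- The controls of player 2 that start in the mode `d`. -/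
def C2From (d : D₂) : Set G.C2 := {c | c.2.1.mode 0 = d}

/-- The strategies of player 1 that start in the mode `d`: nonanticipating maps from the controls
of player 2 to those of player 1. -/
def Strategy1 (d : D₁) : Set (G.C2 → G.C1) :=
  {α | (∀ t : ℝ, 0 ≤ t → ∀ c c', G.Agree2 t c c' → G.Agree1 t (α c) (α c')) ∧
    ∀ c, α c ∈ G.C1From d}

/-- The strategies of player 2 that start in the mode `d`: nonanticipating maps from the controls
of player 1 to those of player 2. -/
def Strategy2 (d : D₂) : Set (G.C1 → G.C2) :=
  {β | (∀ t : ℝ, 0 ≤ t → ∀ c c', G.Agree1 t c c' → G.Agree2 t (β c) (β c')) ∧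
    ∀ c, β c ∈ G.C2From d}

/-- `y` is a mild solution of `y' + A y = f(y, u₁, d₁, u₂, d₂) + ξ'`, `y(0-) = x`, that is,
`y(t) = S(t) x + ∫₀ᵗ S(t-s) f(y(s), u₁(s), d₁(s), u₂(s), d₂(s)) ds + ∑_{τ_j ≤ t} S(t-τ_j) ξ_j`
for all `t ≥ 0`. The sum is finite because the impulse times tend to `∞`. -/
structure IsMildSolution (x : E) (p : G.C1) (q : G.C2) (y : ℝ → E) : Prop where
  measurable : AEStronglyMeasurable y (volume.restrict (Ici (0 : ℝ)))
  eq : ∀ t : ℝ, 0 ≤ t → y t = G.semigroup.S t x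
    + (∫ s in (0 : ℝ)..t, G.semigroup.S (t - s)
        (G.f (y s) (p.1.1 s) (p.2.val s) (q.1.1 s) (q.2.1.val s)))
    + ∑' j : ℕ, if q.2.2.time j ≤ ENNReal.ofReal t then
        G.semigroup.S (t - (q.2.2.time j).toReal) (q.2.2.vec j : E) else 0

/-- The state trajectory: the mild solution, which exists and is unique on `[0, ∞)` under the
assumption on the dynamics. -/
def state (x : E) (p : G.C1) (q : G.C2) : ℝ → E :=
  Classical.epsilon (G.IsMildSolution x p q)

/-- Total discounted cost of the switches of player 1. -/
def switchCost1 (d : SwitchingControl D₁) : ℝ≥0∞ :=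
  ∑' j : ℕ, discountFactor G.lam (d.time (j + 1)) *
    ENNReal.ofReal (G.c₁ (d.mode j) (d.mode (j + 1)))

/-- Total discounted cost of the switches of player 2. -/
def switchCost2 (d : SwitchingControl D₂) : ℝ≥0∞ :=
  ∑' j : ℕ, discountFactor G.lam (d.time (j + 1)) *
    ENNReal.ofReal (G.c₂ (d.mode j) (d.mode (j + 1)))

/-- Total discounted cost of the impulses of player 2. -/
def impulseCost (ξ : ImpulseControl G.K) : ℝ≥0∞ :=
  ∑' j : ℕ, discountFactor G.lam (ξ.time j) * ENNReal.ofReal (G.l (ξ.vec j))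

/-- The total discounted cost functional: running cost, plus the switching and impulse costs of
player 2, minus the switching cost of player 1. These costs are series of nonnegative terms and may
be infinite, so the functional has values in `[-∞, ∞]`; it is `-∞` when player 1 has infinite
switching cost. -/
def J (x : E) (p : G.C1) (q : G.C2) : EReal :=
  ((∫ s in Ioi (0 : ℝ), Real.exp (-G.lam * s) *
      G.k (G.state x p q s) (p.1.1 s) (p.2.val s) (q.1.1 s) (q.2.1.val s) : ℝ) : EReal)
    + ((G.switchCost2 q.2.1 + G.impulseCost q.2.2 : ℝ≥0∞) : EReal)
    - ((G.switchCost1 p.2 : ℝ≥0∞) : EReal)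

/-- The upper value function `V₊`. -/
def upperValue (d₁ : D₁) (d₂ : D₂) (x : E) : EReal :=
  ⨆ α ∈ G.Strategy1 d₁, ⨅ q ∈ G.C2From d₂, G.J x (α q) q

/-- The lower value function `V₋`. -/
def lowerValue (d₁ : D₁) (d₂ : D₂) (x : E) : EReal :=
  ⨅ β ∈ G.Strategy2 d₂, ⨆ p ∈ G.C1From d₁, G.J x p (β p)

end Values

/-! ### The quasivariational inequalities -/

variable (G : HybridGame E U₁ U₂ D₁ D₂)

/-- `H₋(x, p) = max_{u₂} min_{u₁} [⟨-p, f⟩ - k]`. -/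
def Hminus (d₁ : D₁) (d₂ : D₂) (x p : E) : ℝ :=
  ⨆ u₂ : U₂, ⨅ u₁ : U₁, (inner ℝ (-p) (G.f x u₁ d₁ u₂ d₂) - G.k x u₁ d₁ u₂ d₂)

/-- `H₊(x, p) = min_{u₁} max_{u₂} [⟨-p, f⟩ - k]`. -/
def Hplus (d₁ : D₁) (d₂ : D₂) (x p : E) : ℝ :=
  ⨅ u₁ : U₁, ⨆ u₂ : U₂, (inner ℝ (-p) (G.f x u₁ d₁ u₂ d₂) - G.k x u₁ d₁ u₂ d₂)

/-- `M₋[V](x) = min_{d' ≠ d₂} [V^{d₁,d'}(x) + c₂(d₂, d')]`; it is `+∞` if `d₂` is the only mode. -/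
def Mminus (V : D₁ → D₂ → E → ℝ) (d₁ : D₁) (d₂ : D₂) (x : E) : EReal :=
  ⨅ (d' : D₂) (_ : d' ≠ d₂), ((V d₁ d' x + G.c₂ d₂ d' : ℝ) : EReal)

/-- `M₊[V](x) = max_{d' ≠ d₁} [V^{d',d₂}(x) - c₁(d₁, d')]`; it is `-∞` if `d₁` is the only mode. -/
def Mplus (V : D₁ → D₂ → E → ℝ) (d₁ : D₁) (d₂ : D₂) (x : E) : EReal :=
  ⨆ (d' : D₁) (_ : d' ≠ d₁), ((V d' d₂ x - G.c₁ d₁ d' : ℝ) : EReal)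

/-- `N[v](x) = inf_{ξ ∈ K} [v(x + ξ) + l(ξ)]`. -/
def N (v : E → ℝ) (x : E) : EReal :=
  ⨅ ξ : G.K, ((v (x + ξ) + G.l ξ : ℝ) : EReal)

/-- `D_A⁺ Φ(x) = limsup_{δ ↓ 0, y → x} (Φ(y) - Φ(S(δ) y)) / δ`, in `[-∞, ∞]`. -/
def DAplus (Φ : E → ℝ) (x : E) : EReal :=
  limsup (fun p : ℝ × E => (((Φ p.2 - Φ (G.semigroup.S p.1 p.2)) / p.1 : ℝ) : EReal))
    (𝓝[>] (0 : ℝ) ×ˢ 𝓝 x)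

/-- `D_A⁻ Φ(x) = liminf_{δ ↓ 0, y → x} (Φ(y) - Φ(S(δ) y)) / δ`, in `[-∞, ∞]`. -/
def DAminus (Φ : E → ℝ) (x : E) : EReal :=
  liminf (fun p : ℝ × E => (((Φ p.2 - Φ (G.semigroup.S p.1 p.2)) / p.1 : ℝ) : EReal))
    (𝓝[>] (0 : ℝ) ×ˢ 𝓝 x)

variable [CompleteSpace E]

/-- The left side of the equation `λ V + ⟨Ax, DV⟩ + H(x, DV) = 0`, evaluated at `x` for the test
function `φ + ψ`, where `a` stands for `⟨Ax, DV⟩` and `e` is an error term. -/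
def pdeTerm (H : D₁ → D₂ → E → E → ℝ) (V : D₁ → D₂ → E → ℝ) (d₁ : D₁) (d₂ : D₂) (x : E)
    (φ : E → ℝ) (a : EReal) (e : ℝ) : EReal :=
  ((G.lam * V d₁ d₂ x : ℝ) : EReal) + a + ((H d₁ d₂ x (gradient φ x) + e : ℝ) : EReal)

/-- The first system: the left side `min {max (P, V - M₋[V], V - N[V]), V - M₊[V]}` of the
quasivariational inequality, where `P` is the value of the differential term. -/
def sqvi1 (V : D₁ → D₂ → E → ℝ) (d₁ : D₁) (d₂ : D₂) (x : E) (P : EReal) : EReal :=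
  min (max P (max ((V d₁ d₂ x : EReal) - G.Mminus V d₁ d₂ x)
      ((V d₁ d₂ x : EReal) - G.N (V d₁ d₂) x)))
    ((V d₁ d₂ x : EReal) - G.Mplus V d₁ d₂ x)

/-- The second system: the left side `max {min (P, V - M₊[V]), V - M₋[V], V - N[V]}` of the
quasivariational inequality, where `P` is the value of the differential term. -/
def sqvi2 (V : D₁ → D₂ → E → ℝ) (d₁ : D₁) (d₂ : D₂) (x : E) (P : EReal) : EReal :=
  max (min P ((V d₁ d₂ x : EReal) - G.Mplus V d₁ d₂ x))
    (max ((V d₁ d₂ x : EReal) - G.Mminus V d₁ d₂ x)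
      ((V d₁ d₂ x : EReal) - G.N (V d₁ d₂) x))

/-- Approximate viscosity subsolutions of the system with left side `F` (one of `sqvi1`, `sqvi2`)
and Hamiltonian `H`. Test functions are `φ + ψ` with `φ` of class `C¹` and `ψ` Lipschitz. The
inequality is asked for every Lipschitz constant `L` of `ψ`; it is strongest for the least one. -/
def IsApproxSubsolution (F : (D₁ → D₂ → E → ℝ) → D₁ → D₂ → E → EReal → EReal)
    (H : D₁ → D₂ → E → E → ℝ) (V : D₁ → D₂ → E → ℝ) : Prop :=
  (∀ d₁ d₂, Continuous (V d₁ d₂)) ∧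
  ∀ R : ℝ, 0 < R → ∃ C : ℝ, 0 < C ∧
    ∀ (φ ψ : E → ℝ) (L : ℝ≥0), ContDiff ℝ 1 φ → LipschitzWith L ψ →
    ∀ (d₁ : D₁) (d₂ : D₂) (x : E), ‖x‖ ≤ R →
      IsLocalMax (fun z => V d₁ d₂ z - (φ z + ψ z)) x →
      F V d₁ d₂ x
        (G.pdeTerm H V d₁ d₂ x φ (G.DAminus (fun z => φ z + ψ z) x) (-(C * L))) ≤ 0

/-- Approximate viscosity supersolutions of the system with left side `F` (one of `sqvi1`, `sqvi2`)
and Hamiltonian `H`. -/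
def IsApproxSupersolution (F : (D₁ → D₂ → E → ℝ) → D₁ → D₂ → E → EReal → EReal)
    (H : D₁ → D₂ → E → E → ℝ) (V : D₁ → D₂ → E → ℝ) : Prop :=
  (∀ d₁ d₂, Continuous (V d₁ d₂)) ∧
  ∀ R : ℝ, 0 < R → ∃ C : ℝ, 0 < C ∧
    ∀ (φ ψ : E → ℝ) (L : ℝ≥0), ContDiff ℝ 1 φ → LipschitzWith L ψ →
    ∀ (d₁ : D₁) (d₂ : D₂) (x : E), ‖x‖ ≤ R →
      IsLocalMin (fun z => V d₁ d₂ z - (φ z + ψ z)) x →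
      0 ≤ F V d₁ d₂ x
        (G.pdeTerm H V d₁ d₂ x φ (G.DAplus (fun z => φ z + ψ z) x) (C * L))

/-- Approximate viscosity solutions of both systems with Hamiltonian `H`. -/
def IsApproxViscositySolution (H : D₁ → D₂ → E → E → ℝ) (V : D₁ → D₂ → E → ℝ) : Prop :=
  (G.IsApproxSubsolution G.sqvi1 H V ∧ G.IsApproxSupersolution G.sqvi1 H V) ∧
  (G.IsApproxSubsolution G.sqvi2 H V ∧ G.IsApproxSupersolution G.sqvi2 H V)

end HybridGame

end

open Set Filter Topology MeasureTheory
open scoped ENNReal NNReal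

noncomputable section

set_option linter.unusedSectionVars false

/-! No full dynamic programming principle is needed. For each value and each direction of the
differential inequality it suffices that one player can play a prescribed control or feedback for a
short time and then continue almost optimally.

Three facts about a value V carry the proof. First, V lies between 0 and K/λ, where K bounds the
running cost, because either player may refrain from intervening. It is also uniformly continuous,
with one modulus for all modes: the state enters the cost only through the running cost, discounting
cuts off the distant future, and a Gronwall estimate controls the rest
(`Regular.exists_totalRunCost_sub_le`). Second, the obstacle inequalities M₊[V] ≤ V ≤ M₋[V] and V ≤
N[V] hold everywhere, because a switch or an impulse can be prefixed at time 0
(`Regular.obeysObstacles_lowerVal`, `Regular.obeysObstacles_upperVal`). Hence the order of min and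
max no longer matters: both systems reduce to the differential subsolution inequality where M₊[V] <
V and the supersolution inequality where V < M₋[V] and V < N[V]
(`ObeysObstacles.isApproxViscositySolution`).

Third, the differential inequalities hold off the obstacles, by contradiction. If one is violated at
a local extremum of V - (φ + ψ), then, as long as the Hamiltonian is kept on the favourable side and
nobody intervenes, running cost plus discounted terminal value differs from V(x) by at least εt on a
short interval (`ContractionSemigroup.running_add_terminal_le`). The function φ is linearized and
the adjoint semigroup moves S(t-s) off the drift; ψ contributes at most its Lipschitz constant times
the bound on f, whence the error constant. If the opponent does intervene, the strict obstacle
inequality costs a fixed amount δ, which dominates all effects of a short time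
(`Regular.exists_runCost_sub_partialCost_add_le`, `Regular.exists_le_value_bounds`). Either way the
value is improved by some γ > 0, which is absurd.

The restart lemmas turn these estimates into play. The player who holds a strategy reacts to the
opponent's current continuous control through a measurable feedback and so realizes the inner
optimum of the Hamiltonian; the player who holds a control uses a constant one and realizes the
outer optimum. For V₋ player 2 holds the strategy, which gives H₊ = min max; for V₊ player 1 does,
which gives H₋ = max min. -/

theorem integrableOn_Ioc_of_norm_le {X : Type*} [NormedAddCommGroup X] {g : ℝ → X} {a b C : ℝ}
    (hg : AEStronglyMeasurable g (volume.restrict (Ioc a b))) (hC : ∀ s ∈ Ioc a b, ‖g s‖ ≤ C) :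
    IntegrableOn g (Ioc a b) :=
  Integrable.of_bound hg C ((ae_restrict_mem measurableSet_Ioc).mono hC)

theorem volume_real_Ioc_zero {t : ℝ} (ht : 0 ≤ t) : volume.real (Ioc 0 t) = t := by
  simp [Measure.real, ht]

/-! ### Discounting over a short time -/

theorem exp_neg_mul_le_one {lam t : ℝ} (hlam : 0 ≤ lam) (ht : 0 ≤ t) : Real.exp (-lam * t) ≤ 1 :=
  Real.exp_le_one_iff.2 (by nlinarith)

theorem abs_exp_neg_mul_sub_one_le {lam t : ℝ} (hlam : 0 ≤ lam) (ht : 0 ≤ t) :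
    |Real.exp (-lam * t) - 1| ≤ lam * t := by
  have h1 := exp_neg_mul_le_one hlam ht
  have h2 := Real.add_one_le_exp (-lam * t)
  rw [abs_le]
  constructor <;> nlinarith

/-- On `Ioc 0 t` the discount factor is within λt of 1, so dropping it from a bounded running cost
is an error of second order in t. -/
theorem setIntegral_exp_mul_le {κ : ℝ → ℝ} {lam K t : ℝ} (hlam : 0 ≤ lam) (ht : 0 ≤ t)
    (hκ : AEStronglyMeasurable κ (volume.restrict (Ioc 0 t))) (hκK : ∀ s ∈ Ioc 0 t, |κ s| ≤ K) :
    (∫ s in Ioc 0 t, Real.exp (-lam * s) * κ s) ≤ (∫ s in Ioc 0 t, κ s) + lam * K * t * t := by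
  have hκi : IntegrableOn κ (Ioc 0 t) := integrableOn_Ioc_of_norm_le hκ hκK
  have hconst : IntegrableOn (fun _ : ℝ => lam * K * t) (Ioc 0 t) :=
    integrableOn_const (by simp) enorm_ne_top
  have h1 : ∫ s in Ioc 0 t, Real.exp (-lam * s) * κ s ≤ ∫ s in Ioc 0 t, (κ s + lam * K * t) := by
    refine setIntegral_mono_on ?_ (hκi.add hconst) measurableSet_Ioc ?_
    · have hm : AEStronglyMeasurable (fun s => Real.exp (-lam * s))
          (volume.restrict (Ioc 0 t)) :=
        (by fun_prop : Continuous fun s => Real.exp (-lam * s)).aestronglyMeasurable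
      refine integrableOn_Ioc_of_norm_le (C := K) (hm.mul hκ) fun s hs => ?_
      rw [norm_mul, Real.norm_of_nonneg (Real.exp_pos _).le]
      calc _ ≤ 1 * K := mul_le_mul (exp_neg_mul_le_one hlam hs.1.le) (hκK s hs)
            (abs_nonneg _) zero_le_one
        _ = K := one_mul _
    · intro s hs
      have h4 : (Real.exp (-lam * s) - 1) * κ s ≤ lam * t * K := by
        refine (le_abs_self _).trans ?_
        rw [abs_mul]
        refine mul_le_mul ?_ (hκK s hs) (abs_nonneg _) (by positivity)
        exact (abs_exp_neg_mul_sub_one_le hlam hs.1.le).trans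
          (mul_le_mul_of_nonneg_left hs.2 hlam)
      linarith
  rw [integral_add hκi hconst, setIntegral_const, volume_real_Ioc_zero ht, smul_eq_mul] at h1
  linarith

/-- With Y = O(t), expand the exponential to first order against V and to zeroth order against Y;
both remainders are of second order in t. -/
theorem exp_mul_add_le {lam t V Y B : ℝ} (hlam : 0 ≤ lam) (ht : 0 ≤ t) (hlt : lam * t ≤ 1)
    (hY : |Y| ≤ B * t) : Real.exp (-lam * t) * (V + Y) ≤
      V + Y - lam * t * V + (lam ^ 2 * |V| + lam * B) * t * t := by
  have hexp2 := Real.abs_exp_sub_one_sub_id_le (x := -lam * t) (by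
    rw [abs_mul, abs_neg, abs_of_nonneg hlam, abs_of_nonneg ht]; exact hlt)
  have h1 := abs_exp_neg_mul_sub_one_le hlam ht
  set e := Real.exp (-lam * t)
  have h2 : (e - 1 - -lam * t) * V ≤ (-lam * t) ^ 2 * |V| := by
    refine (le_abs_self _).trans ?_
    rw [abs_mul]
    gcongr
  have h3 : (e - 1) * Y ≤ lam * t * (B * t) := by
    refine (le_abs_self _).trans ?_
    rw [abs_mul]
    exact mul_le_mul h1 hY (abs_nonneg _) (by positivity)
  linarith

/-! ### The semigroup and the estimate along a trajectory at a local extremum -/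

namespace ContractionSemigroup

section Normed

variable {E : Type*} [NormedAddCommGroup E] [NormedSpace ℝ E] (T : ContractionSemigroup E)

/-- The semigroup, extended to negative times by the identity. -/
def evol (t : ℝ) : E →L[ℝ] E := T.S (max t 0)

theorem evol_of_nonneg {t : ℝ} (ht : 0 ≤ t) : T.evol t = T.S t := by simp [evol, ht]

theorem evol_zero : T.evol 0 = ContinuousLinearMap.id ℝ E := by simp [evol, T.zero]

theorem norm_S_apply_le {t : ℝ} (ht : 0 ≤ t) (x : E) : ‖T.S t x‖ ≤ ‖x‖ :=
  (T.S t).le_of_opNorm_le (T.contraction t ht) x |>.trans (by simp)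

theorem norm_evol_apply_le (t : ℝ) (x : E) : ‖T.evol t x‖ ≤ ‖x‖ :=
  T.norm_S_apply_le (le_max_right _ _) x

theorem evol_add {s t : ℝ} (hs : 0 ≤ s) (ht : 0 ≤ t) (x : E) :
    T.evol (s + t) x = T.evol s (T.evol t x) := by
  rw [T.evol_of_nonneg hs, T.evol_of_nonneg ht, T.evol_of_nonneg (add_nonneg hs ht), T.add s t hs ht]
  rfl

theorem continuous_evol_apply (x : E) : Continuous fun t => T.evol t x :=
  (T.strongCont x).comp_continuous (by fun_prop) fun _ => mem_Ici.2 (le_max_right _ _)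

/-- Strong continuity together with a uniform Lipschitz constant in the vector gives joint
continuity, on which the measurability of all convolution integrands rests. -/
theorem continuous_evol : Continuous fun p : ℝ × E => T.evol p.1 p.2 := by
  refine continuous_prod_of_continuous_lipschitzWith' _ 1 (fun t => ?_) T.continuous_evol_apply
  refine LipschitzWith.of_dist_le_mul fun x y => ?_
  simpa [dist_eq_norm, ← map_sub] using T.norm_evol_apply_le t (x - y)

theorem eventually_norm_S_sub_le (x : E) {ε : ℝ} (hε : 0 < ε) :
    ∃ t₀ > 0, ∀ t, 0 ≤ t → t ≤ t₀ → ‖T.S t x - x‖ ≤ ε := by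
  have h := (T.continuous_evol_apply x).tendsto 0
  obtain ⟨r, hr, h⟩ := Metric.tendsto_nhds_nhds.1 h ε hε
  refine ⟨r / 2, by positivity, fun t ht htr => ?_⟩
  have := h (show dist t 0 < r by rw [Real.dist_eq, sub_zero, abs_of_nonneg ht]; linarith)
  rw [T.evol_zero, T.evol_of_nonneg ht, dist_eq_norm] at this
  exact this.le

theorem aestronglyMeasurable_evol_comp {μ : Measure ℝ} {g : ℝ → E} (hg : AEStronglyMeasurable g μ)
    (t : ℝ) : AEStronglyMeasurable (fun s => T.evol (t - s) (g s)) μ :=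
  T.continuous_evol.comp_aestronglyMeasurable
    (((by fun_prop : Continuous fun s : ℝ => t - s).aestronglyMeasurable).prodMk hg)

theorem integrableOn_evol_comp {g : ℝ → E} {a b F : ℝ}
    (hg : AEStronglyMeasurable g (volume.restrict (Ioc a b))) (hF : ∀ s ∈ Ioc a b, ‖g s‖ ≤ F)
    (t : ℝ) : IntegrableOn (fun s => T.evol (t - s) (g s)) (Ioc a b) := by
  exact integrableOn_Ioc_of_norm_le (T.aestronglyMeasurable_evol_comp hg t) fun s hs =>
    (T.norm_evol_apply_le _ _).trans (hF s hs)

theorem integral_S_eq_evol {t : ℝ} (ht : 0 ≤ t) (g : ℝ → E) :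
    ∫ s in (0 : ℝ)..t, T.S (t - s) (g s) = ∫ s in Ioc 0 t, T.evol (t - s) (g s) := by
  rw [intervalIntegral.integral_of_le ht]
  refine setIntegral_congr_fun measurableSet_Ioc fun s hs => ?_
  simp only [T.evol_of_nonneg (sub_nonneg.2 hs.2)]

theorem norm_integral_evol_le {g : ℝ → E} {t F : ℝ} (ht : 0 ≤ t)
    (hF : ∀ s ∈ Ioc 0 t, ‖g s‖ ≤ F) : ‖∫ s in Ioc 0 t, T.evol (t - s) (g s)‖ ≤ F * t := by
  have := norm_setIntegral_le_of_norm_le_const (μ := volume) (s := Ioc (0 : ℝ) t) (C := F)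
    (f := fun s => T.evol (t - s) (g s)) (by simp)
    fun s hs => (T.norm_evol_apply_le _ _).trans (hF s hs)
  rwa [volume_real_Ioc_zero ht] at this

end Normed

section Inner

variable {E : Type*} [NormedAddCommGroup E] [InnerProductSpace ℝ E] [CompleteSpace E]
  (T : ContractionSemigroup E)

/-- The adjoint semigroup is strongly continuous at `0`. -/
theorem eventually_abs_inner_S_sub_le (p : E) {ε : ℝ} (hε : 0 < ε) :
    ∃ t₀ > 0, ∀ t, 0 ≤ t → t ≤ t₀ → ∀ v, |inner ℝ p (T.S t v) - inner ℝ p v| ≤ ε * ‖v‖ := by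
  obtain ⟨t₀, ht₀, h⟩ := T.eventually_norm_S_sub_le p (ε := ε ^ 2 / (2 * (‖p‖ + 1)))
    (by positivity)
  refine ⟨t₀, ht₀, fun t ht htt v => ?_⟩
  set q := ContinuousLinearMap.adjoint (T.S t) p
  have hq : ‖q‖ ≤ ‖p‖ := by
    refine (ContinuousLinearMap.adjoint (T.S t)).le_of_opNorm_le (c := 1) ?_ p |>.trans (by simp)
    rw [LinearIsometryEquiv.norm_map]
    exact T.contraction t ht
  have hin : inner ℝ q p = inner ℝ p (T.S t p) := ContinuousLinearMap.adjoint_inner_left _ _ _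
  -- Since ‖q‖ ≤ ‖p‖, expanding the square gives ‖q - p‖² ≤ 2⟨p, p - S(t)p⟩, so strong continuity of
  -- the semigroup at p passes to its adjoint.
  have hsq : ‖q - p‖ ^ 2 ≤ ε ^ 2 := by
    have h1 : inner ℝ p (T.S t p - p) = inner ℝ q p - ‖p‖ ^ 2 := by
      rw [inner_sub_right, hin, real_inner_self_eq_norm_sq]
    have h2 : |inner ℝ p (T.S t p - p)| ≤ ‖p‖ * (ε ^ 2 / (2 * (‖p‖ + 1))) :=
      (abs_real_inner_le_norm _ _).trans (by gcongr; exact h t ht htt)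
    have h3 : ‖p‖ * (ε ^ 2 / (2 * (‖p‖ + 1))) ≤ ε ^ 2 / 2 := by
      rw [mul_div_assoc', div_le_div_iff₀ (by positivity) (by positivity)]
      nlinarith [sq_nonneg ε, norm_nonneg p]
    have h4 := norm_sub_sq_real q p
    have h5 : ‖q‖ ^ 2 ≤ ‖p‖ ^ 2 := by gcongr
    have h6 := abs_le.1 (h2.trans h3)
    nlinarith [h6.1]
  have hle : ‖q - p‖ ≤ ε := abs_le_of_sq_le_sq' hsq hε.le |>.2
  have : inner ℝ p (T.S t v) - inner ℝ p v = inner ℝ (q - p) v := by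
    rw [inner_sub_left, ContinuousLinearMap.adjoint_inner_left]
  rw [this]
  exact (abs_real_inner_le_norm _ _).trans (by gcongr)

set_option maxHeartbeats 800000 in
/-- Along a trajectory started at a local maximum of `V - (φ + ψ)`, the discounted running cost
plus the discounted terminal value of `V` falls short of the initial value of `V` at a linear rate,
if the differential inequality for `V` is violated along the trajectory. -/
theorem running_add_terminal_le {V φ ψ : E → ℝ} {x : E} {L : ℝ≥0} (hφ : ContDiff ℝ 1 φ)
    (hψ : LipschitzWith L ψ) (hmax : IsLocalMax (fun z => V z - (φ z + ψ z)) x)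
    {lam F K a H ε : ℝ} (hlam : 0 < lam) (hF : 0 ≤ F) (hK : 0 ≤ K) (hε : 0 < ε)
    (ha : ∀ᶠ δ in 𝓝[>] (0 : ℝ), a * δ ≤ (φ x + ψ x) - (φ (T.S δ x) + ψ (T.S δ x)))
    (hpos : 4 * ε ≤ lam * V x + a + H - F * L) :
    ∃ t₀ > 0, ∀ t, 0 < t → t ≤ t₀ → ∀ (g : ℝ → E) (κ : ℝ → ℝ),
      AEStronglyMeasurable g (volume.restrict (Ioc 0 t)) →
      AEStronglyMeasurable κ (volume.restrict (Ioc 0 t)) →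
      (∀ s ∈ Ioc 0 t, ‖g s‖ ≤ F) → (∀ s ∈ Ioc 0 t, |κ s| ≤ K) →
      (∀ᵐ s ∂volume.restrict (Ioc 0 t), H - ε ≤ -inner ℝ (gradient φ x) (g s) - κ s) →
      (∫ s in Ioc 0 t, Real.exp (-lam * s) * κ s) + Real.exp (-lam * t) *
        V (T.S t x + ∫ s in Ioc 0 t, T.evol (t - s) (g s)) ≤ V x - ε * t := by
  set p := gradient φ x with hp
  -- This tolerance is used twice, for linearizing φ and for removing the semigroup from the drift;
  -- each use costs at most εt/2.
  set ε₁ := ε / (2 * (F + 1)) with hε₁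
  have hε₁0 : 0 < ε₁ := by positivity
  have hε₁F : ε₁ * F ≤ ε / 2 := by
    rw [hε₁, div_mul_eq_mul_div, div_le_div_iff₀ (by positivity) (by positivity)]
    nlinarith
  -- strict differentiability of `φ`
  have hstrict : ∃ r > 0, ∀ y z, ‖y - x‖ ≤ r → ‖z - x‖ ≤ r →
      |φ y - φ z - inner ℝ p (y - z)| ≤ ε₁ * ‖y - z‖ := by
    have h1 : HasStrictFDerivAt φ (fderiv ℝ φ x) x :=
      hφ.contDiffAt.hasStrictFDerivAt one_ne_zero
    have h2 := (h1.isLittleO.bound hε₁0)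
    obtain ⟨r, hr, h3⟩ := Metric.eventually_nhds_iff.1 h2
    refine ⟨r / 2, by positivity, fun y z hy hz => ?_⟩
    have := h3 (y := (y, z)) (by
      rw [Prod.dist_eq, dist_eq_norm, dist_eq_norm]
      exact max_lt (by dsimp only; linarith) (by dsimp only; linarith))
    have h4 : inner ℝ p (y - z) = fderiv ℝ φ x (y - z) := by
      rw [hp, gradient, InnerProductSpace.toDual_symm_apply]
    simpa [h4] using this
  obtain ⟨r₁, hr₁, hstrict⟩ := hstrict
  obtain ⟨r₂, hr₂, hmax⟩ := Metric.eventually_nhds_iff.1 hmax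
  set r := min r₁ (r₂ / 2)
  have hr : 0 < r := by positivity
  obtain ⟨t₁, ht₁, hS⟩ := T.eventually_norm_S_sub_le x (half_pos hr)
  obtain ⟨t₂, ht₂, hadj⟩ := T.eventually_abs_inner_S_sub_le p hε₁0
  obtain ⟨t₃, ht₃, ha⟩ := mem_nhdsGT_iff_exists_Ioc_subset.1 ha
  set B := ‖p‖ * F + ε + F * L + |a| with hB
  have hB0 : 0 ≤ B := by positivity
  set Q := lam * K + lam ^ 2 * |V x| + lam * B with hQ
  have hQ0 : 0 ≤ Q := by positivity
  -- The bounds t₁ and r/(2(F+1)) keep the endpoint in the ball where the local estimates hold, t₂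
  -- serves the adjoint, t₃ the difference quotient along the semigroup, 1/λ the expansion of the
  -- exponential, and ε/(Q+1) makes the second-order terms at most εt.
  refine ⟨min (min t₁ t₂) (min (min t₃ (r / (2 * (F + 1)))) (min (1 / lam) (ε / (Q + 1)))),
    by have : 0 < t₃ := ht₃; positivity, fun t ht htle g κ hg hκ hgF hκK hH => ?_⟩
  simp only [le_min_iff] at htle
  obtain ⟨⟨htt₁, htt₂⟩, ⟨htt₃, htr⟩, htlam, htQ⟩ := htle
  rw [le_div_iff₀ (by positivity)] at htr htlam htQ
  set w := ∫ s in Ioc 0 t, T.evol (t - s) (g s) with hw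
  have hwn : ‖w‖ ≤ F * t := T.norm_integral_evol_le ht.le hgF
  have hSx := hS t ht.le htt₁
  have hyr : ‖T.S t x + w - x‖ ≤ r := by
    calc ‖T.S t x + w - x‖ = ‖(T.S t x - x) + w‖ := by congr 1; abel
      _ ≤ r / 2 + F * t := (norm_add_le _ _).trans (add_le_add hSx hwn)
      _ ≤ r := by linarith
  have hVle : V (T.S t x + w) ≤ V x + ((φ (T.S t x + w) + ψ (T.S t x + w)) - (φ x + ψ x)) := by
    have := hmax (y := T.S t x + w) (by
      rw [dist_eq_norm]; linarith [min_le_right r₁ (r₂ / 2), hyr])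
    dsimp only at this
    linarith
  have hpg : IntegrableOn (fun s => inner ℝ p (g s)) (Ioc 0 t) :=
    (integrableOn_Ioc_of_norm_le hg hgF).const_inner p
  have hκi : IntegrableOn κ (Ioc 0 t) := integrableOn_Ioc_of_norm_le hκ hκK
  have hvol : volume.real (Ioc 0 t) = t := volume_real_Ioc_zero ht.le
  have hpw : inner ℝ p w ≤ (∫ s in Ioc 0 t, inner ℝ p (g s)) + ε / 2 * t := by
    have hi := T.integrableOn_evol_comp hg hgF t
    rw [hw, ← integral_inner hi p]
    have h1 : ∫ s in Ioc 0 t, inner ℝ p (T.evol (t - s) (g s))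
        ≤ ∫ s in Ioc 0 t, (inner ℝ p (g s) + ε / 2) := by
      refine setIntegral_mono_on (hi.const_inner p) (hpg.add (by simp)) measurableSet_Ioc ?_
      intro s hs
      have := (abs_le.1 (hadj (t - s) (by linarith [hs.2]) (by linarith [hs.1]) (g s))).2
      rw [T.evol_of_nonneg (by linarith [hs.2])]
      have h2 : ε₁ * ‖g s‖ ≤ ε₁ * F := by gcongr; exact hgF s hs
      linarith
    rw [integral_add hpg (by simp), setIntegral_const, hvol, smul_eq_mul] at h1
    linarith
  have hpgB : |∫ s in Ioc 0 t, inner ℝ p (g s)| ≤ ‖p‖ * F * t := by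
    have := norm_setIntegral_le_of_norm_le_const (μ := volume) (s := Ioc (0 : ℝ) t)
      (C := ‖p‖ * F) (f := fun s => inner ℝ p (g s)) (by simp)
      fun s hs => (norm_inner_le_norm _ _).trans (by gcongr; exact hgF s hs)
    rwa [hvol] at this
  set Ig := ∫ s in Ioc 0 t, inner ℝ p (g s)
  -- S(t)x - x need not be of order t, so φ is not expanded from x. Only the displacement w from
  -- S(t)x is linearized, between two moving points, which is why strict differentiability is
  -- needed; the passage from x to S(t)x is accounted for by a.
  have hφle : φ (T.S t x + w) - φ (T.S t x) ≤ Ig + ε * t := by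
    have h1 := (abs_le.1 (hstrict (T.S t x + w) (T.S t x) (hyr.trans (min_le_left _ _))
      (by linarith [min_le_left r₁ (r₂ / 2)]))).2
    rw [add_sub_cancel_left] at h1
    have h2 : ε₁ * ‖w‖ ≤ ε₁ * (F * t) := by gcongr
    have h3 : ε₁ * (F * t) ≤ ε / 2 * t := by linarith [mul_le_mul_of_nonneg_right hε₁F ht.le]
    linarith
  have hψle : ψ (T.S t x + w) - ψ (T.S t x) ≤ F * L * t := by
    have h1 := hψ.dist_le_mul (T.S t x + w) (T.S t x)
    rw [dist_eq_norm (T.S t x + w), add_sub_cancel_left, Real.dist_eq] at h1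
    have h2 : (L : ℝ) * ‖w‖ ≤ L * (F * t) := by gcongr
    linarith [(abs_le.1 h1).2]
  have hat := ha ⟨ht, htt₃⟩
  change a * t ≤ φ x + ψ x - (φ (T.S t x) + ψ (T.S t x)) at hat
  set Y := Ig + (ε + F * L - a) * t with hY
  have hXY : (φ (T.S t x + w) + ψ (T.S t x + w)) - (φ x + ψ x) ≤ Y := by
    rw [hY]; linarith
  have hYB : |Y| ≤ B * t := by
    have h1 : |(ε + F * L - a) * t| ≤ (ε + F * L + |a|) * t := by
      rw [abs_mul, abs_of_pos ht]
      gcongr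
      refine (abs_sub _ _).trans ?_
      rw [abs_of_nonneg (by positivity)]
    rw [hY, hB]
    refine (abs_add_le _ _).trans ?_
    linarith
  have hκH : (∫ s in Ioc 0 t, κ s) + Ig ≤ -(H - ε) * t := by
    rw [← integral_add hκi hpg]
    have : ∫ s in Ioc 0 t, (κ s + inner ℝ p (g s)) ≤ ∫ s in Ioc 0 t, -(H - ε) := by
      refine setIntegral_mono_ae_restrict (hκi.add hpg) (by simp) ?_
      filter_upwards [hH] with s hs
      linarith
    rw [setIntegral_const, hvol, smul_eq_mul] at this
    linarith
  have hexpκ := setIntegral_exp_mul_le hlam.le ht.le hκ hκK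
  have hlt : lam * t ≤ 1 := by linarith
  have heV := exp_mul_add_le (V := V x) hlam.le ht.le hlt hYB
  have hfin : Real.exp (-lam * t) * V (T.S t x + w) ≤ Real.exp (-lam * t) * (V x + Y) :=
    mul_le_mul_of_nonneg_left (by linarith) (Real.exp_pos _).le
  have hQt : Q * t * t ≤ ε * t := by
    have : Q * t ≤ ε := by linarith
    exact mul_le_mul_of_nonneg_right this ht.le
  -- Of the margin 4ε, one ε pays for the slack in the Hamiltonian bound, one for the two uses of
  -- ε₁, one for the second-order terms, and one remains.
  have hpos' := mul_le_mul_of_nonneg_right hpos ht.le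
  have hQe : Q * t * t = lam * K * t * t + (lam ^ 2 * |V x| + lam * B) * t * t := by
    rw [hQ]; ring
  have hYe : V x + Y - lam * t * V x
      = V x + Ig - (lam * V x + a + H - F * L) * t + H * t + ε * t := by
    rw [hY]; ring
  linarith

end Inner

end ContractionSemigroup

/-! ### Operations on controls -/

namespace ContControl

variable {U : Type*} [MeasurableSpace U]

theorem agreeUpTo_iff {t : ℝ} {u v : ContControl U} :
    ContControl.AgreeUpTo t u v ↔ ∀ᵐ s, s ∈ Icc 0 t → u.1 s = v.1 s :=
  ae_restrict_iff' measurableSet_Icc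

/-- The control `u` seen from time `t` on. -/
def shift (t : ℝ) (u : ContControl U) : ContControl U :=
  ⟨fun s => u.1 (t + s), u.2.comp (measurable_const_add t)⟩

/-- The control that follows `u` until time `t` and then starts `v`. -/
def concat (t : ℝ) (u v : ContControl U) : ContControl U :=
  ⟨fun s => if s < t then u.1 s else v.1 (s - t),
    Measurable.ite measurableSet_Iio u.2 (v.2.comp (measurable_sub_const t))⟩

theorem concat_of_lt {t s : ℝ} (u v : ContControl U) (h : s < t) :
    (concat t u v).1 s = u.1 s := if_pos h

theorem concat_add {t s : ℝ} (u v : ContControl U) (h : 0 ≤ s) :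
    (concat t u v).1 (t + s) = v.1 s := by
  simp [concat, h]

theorem AgreeUpTo.mono {s t : ℝ} {u v : ContControl U} (h : ContControl.AgreeUpTo t u v)
    (hst : s ≤ t) : ContControl.AgreeUpTo s u v := by
  rw [agreeUpTo_iff] at *
  filter_upwards [h] with r hr hrs using hr ⟨hrs.1, hrs.2.trans hst⟩

theorem AgreeUpTo.symm {t : ℝ} {u v : ContControl U} (h : ContControl.AgreeUpTo t u v) :
    ContControl.AgreeUpTo t v u := Filter.Eventually.mono h fun _ hs => hs.symm

theorem AgreeUpTo.shift {s t : ℝ} {u v : ContControl U} (ht : 0 ≤ t)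
    (h : ContControl.AgreeUpTo (t + s) u v) :
    ContControl.AgreeUpTo s (shift t u) (shift t v) := by
  rw [agreeUpTo_iff] at *
  have := (measurePreserving_add_left volume t).quasiMeasurePreserving.ae h
  filter_upwards [this] with r hr hrs
  exact hr ⟨by linarith [hrs.1], by linarith [hrs.2]⟩

theorem AgreeUpTo.concat {s t : ℝ} {u u' v v' : ContControl U}
    (hu : ContControl.AgreeUpTo (t + s) u u') (h : ContControl.AgreeUpTo s v v') :
    ContControl.AgreeUpTo (t + s) (concat t u v) (concat t u' v') := by
  rw [agreeUpTo_iff] at *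
  have := (measurePreserving_sub_right volume t).quasiMeasurePreserving.ae h
  filter_upwards [this, hu] with r hr hr' hrs
  simp only [ContControl.concat]
  split_ifs with hrt
  · exact hr' hrs
  · exact hr ⟨by linarith, by linarith [hrs.2]⟩

theorem AgreeUpTo.concat_of_lt {s t t' : ℝ} {u u' v v' : ContControl U}
    (hu : ContControl.AgreeUpTo s u u') (hst : s < t) (hst' : s < t') :
    ContControl.AgreeUpTo s (ContControl.concat t u v) (ContControl.concat t' u' v') := by
  rw [agreeUpTo_iff] at *
  filter_upwards [hu] with r hr hrs
  rw [ContControl.concat_of_lt _ _ (hrs.2.trans_lt hst),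
    ContControl.concat_of_lt _ _ (hrs.2.trans_lt hst')]
  exact hr hrs

/-- Feedback of the control `u` through the measurable map `η`. -/
def map {U' : Type*} [MeasurableSpace U'] (η : U → U') (hη : Measurable η) (u : ContControl U) :
    ContControl U' := ⟨fun s => η (u.1 s), hη.comp u.2⟩

theorem AgreeUpTo.map {U' : Type*} [MeasurableSpace U'] {η : U → U'} (hη : Measurable η) {t : ℝ}
    {u v : ContControl U} (h : ContControl.AgreeUpTo t u v) :
    ContControl.AgreeUpTo t (map η hη u) (map η hη v) :=
  Filter.Eventually.mono h fun _ hs => congrArg η hs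

/-- A constant control. -/
def const (a : U) : ContControl U := ⟨fun _ => a, measurable_const⟩

end ContControl

theorem tendsto_tsub_nhds_top {a : ℕ → ℝ≥0∞} {c : ℝ≥0∞} (hc : c ≠ ⊤)
    (ha : Tendsto a atTop (𝓝 ⊤)) : Tendsto (fun j => a j - c) atTop (𝓝 ⊤) := by
  rw [ENNReal.tendsto_nhds_top_iff_nnreal] at *
  intro x
  filter_upwards [ha (x + c.toNNReal)] with j hj
  rw [lt_tsub_iff_right]
  simpa [ENNReal.coe_toNNReal hc] using hj

theorem tendsto_const_add_nhds_top {a : ℕ → ℝ≥0∞} (c : ℝ≥0∞)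
    (ha : Tendsto a atTop (𝓝 ⊤)) : Tendsto (fun j => c + a j) atTop (𝓝 ⊤) :=
  tendsto_of_tendsto_of_tendsto_of_le_of_le ha tendsto_const_nhds
    (fun _ => le_add_self) fun _ => le_top

theorem ofReal_add_le_ofReal_add {t s : ℝ} (ht : 0 ≤ t) (hs : 0 ≤ s) {x : ℝ≥0∞} :
    ENNReal.ofReal t + x ≤ ENNReal.ofReal (t + s) ↔ x ≤ ENNReal.ofReal s := by
  rw [ENNReal.ofReal_add ht hs]
  exact ENNReal.add_le_add_iff_left ENNReal.ofReal_ne_top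

namespace SwitchingControl

variable {D : Type*}

/-- The number of switches up to and including time `s`. -/
def idx (d : SwitchingControl D) (s : ℝ) : ℕ := sSup {j | d.time j ≤ ENNReal.ofReal s}

theorem bddAbove_time_le (d : SwitchingControl D) (s : ℝ) :
    BddAbove {j | d.time j ≤ ENNReal.ofReal s} := by
  obtain ⟨n, hn⟩ := ((d.time_tendsto.eventually (lt_mem_nhds
    (ENNReal.ofReal_lt_top (r := s)))).exists)
  refine ⟨n, fun j hj => ?_⟩
  by_contra h
  exact absurd (hn.trans_le (d.time_mono (not_le.1 h).le)) (not_lt.2 hj)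

theorem time_idx_le (d : SwitchingControl D) (s : ℝ) : d.time (d.idx s) ≤ ENNReal.ofReal s :=
  Nat.sSup_mem (s := {j | d.time j ≤ ENNReal.ofReal s})
    ⟨0, by simp [d.time_zero]⟩ (d.bddAbove_time_le s)

theorem lt_time_idx_succ (d : SwitchingControl D) (s : ℝ) :
    ENNReal.ofReal s < d.time (d.idx s + 1) := by
  by_contra h
  have := le_csSup (d.bddAbove_time_le s) (not_lt.1 h)
  change d.idx s + 1 ≤ d.idx s at this
  omega

theorem val_eq_mode_idx (d : SwitchingControl D) (s : ℝ) : d.val s = d.mode (d.idx s) := rfl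

theorem idx_mono (d : SwitchingControl D) : Monotone d.idx := fun s t h =>
  csSup_le_csSup (d.bddAbove_time_le t) ⟨0, by simp [d.time_zero]⟩
    fun _ hj => le_trans hj (ENNReal.ofReal_le_ofReal h)

theorem measurable_idx (d : SwitchingControl D) : Measurable d.idx := d.idx_mono.measurable

theorem val_of_lt {d : SwitchingControl D} {s : ℝ} (h : ENNReal.ofReal s < d.time 1) :
    d.val s = d.mode 0 :=
  d.val_eq (by simp [d.time_zero]) h

theorem AgreeUpTo.mono {s t : ℝ} {d d' : SwitchingControl D} (h : AgreeUpTo t d d') (hst : s ≤ t) :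
    AgreeUpTo s d d' := fun j hj => h j <| by
  have := ENNReal.ofReal_le_ofReal hst
  exact hj.imp (le_trans · this) (le_trans · this)

theorem AgreeUpTo.symm {t : ℝ} {d d' : SwitchingControl D} (h : AgreeUpTo t d d') :
    AgreeUpTo t d' d := fun j hj => ⟨(h j hj.symm).1.symm, (h j hj.symm).2.symm⟩

theorem AgreeUpTo.mode_zero {t : ℝ} {d d' : SwitchingControl D} (h : AgreeUpTo t d d') :
    d.mode 0 = d'.mode 0 := (h 0 (by simp [d.time_zero])).2

theorem AgreeUpTo.idx_eq {s t : ℝ} {d d' : SwitchingControl D} (h : AgreeUpTo t d d')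
    (hst : s ≤ t) : d.idx s = d'.idx s := by
  rw [idx, idx]
  congr 1
  ext j
  have h' := h.mono hst j
  constructor
  · intro hj; exact (h' (.inl hj)).1.symm.trans_le hj
  · intro hj; exact (h' (.inr hj)).1.trans_le hj

theorem AgreeUpTo.val_eq {s t : ℝ} {d d' : SwitchingControl D} (h : AgreeUpTo t d d')
    (hst : s ≤ t) : d.val s = d'.val s := by
  rw [val_eq_mode_idx, val_eq_mode_idx, ← h.idx_eq hst]
  exact (h.mono hst _ (.inl (d.time_idx_le s))).2

/-- The control `d'` is `d` seen from time `t` on, after `n` switches. -/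
structure IsShift (t : ℝ) (n : ℕ) (d d' : SwitchingControl D) : Prop where
  le : d.time n ≤ ENNReal.ofReal t
  mode : ∀ j, d'.mode j = d.mode (n + j)
  time : ∀ j, d.time (n + j + 1) = ENNReal.ofReal t + d'.time (j + 1)

theorem IsShift.val_eq {t s : ℝ} {n : ℕ} {d d' : SwitchingControl D} (h : IsShift t n d d')
    (ht : 0 ≤ t) (hs : 0 ≤ s) : d.val (t + s) = d'.val s := by
  rw [d'.val_eq_mode_idx, h.mode]
  refine d.val_eq ?_ ?_
  · rcases hj : d'.idx s with _ | j
    · exact h.le.trans (ENNReal.ofReal_le_ofReal (by linarith))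
    · rw [← add_assoc, h.time, ofReal_add_le_ofReal_add ht hs, ← hj]
      exact d'.time_idx_le s
  · rw [h.time, ← not_le, ofReal_add_le_ofReal_add ht hs, not_le]
    exact d'.lt_time_idx_succ s

/-- The control `d` seen from time `t` on, after `n` switches. -/
def shift (t : ℝ) (n : ℕ) (d : SwitchingControl D) : SwitchingControl D where
  time j := if j = 0 then 0 else d.time (n + j) - ENNReal.ofReal t
  mode j := d.mode (n + j)
  time_zero := if_pos rfl
  time_mono := monotone_nat_of_le_succ fun j => by
    rcases j with _ | j
    · simp
    · simpa using tsub_le_tsub_right (d.time_mono (by omega)) _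
  time_tendsto := by
    rw [← tendsto_add_atTop_iff_nat 1]
    simp only [Nat.add_eq_zero_iff, one_ne_zero, and_false, if_false]
    exact tendsto_tsub_nhds_top ENNReal.ofReal_ne_top
      (d.time_tendsto.comp (tendsto_atTop_mono (g := fun j => n + (j + 1)) (fun j : ℕ => show j ≤ n + (j + 1) by omega)
        tendsto_id))
  mode_ne j hj := by
    refine d.mode_ne (n + j) (lt_top_iff_ne_top.2 fun h => ?_)
    rw [add_assoc] at h
    simp [h] at hj

/-- Both inequalities are weak, so switches made exactly at time t may be counted before or after
the cut. Both conventions are used: a restarting strategy has already seen them, whereas against an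
opponent's strategy only switches strictly before t are known. -/
theorem isShift_shift {t : ℝ} {n : ℕ} {d : SwitchingControl D} (h : d.time n ≤ ENNReal.ofReal t)
    (h' : ENNReal.ofReal t ≤ d.time (n + 1)) : IsShift t n d (shift t n d) where
  le := h
  mode _ := rfl
  time j := by
    simp only [shift, Nat.add_eq_zero_iff, one_ne_zero, and_false, if_false]
    rw [add_tsub_cancel_of_le (h'.trans (d.time_mono (by omega)))]
    rfl

theorem AgreeUpTo.shift {s t : ℝ} {n : ℕ} {d d' : SwitchingControl D} (ht : 0 ≤ t) (hs : 0 ≤ s)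
    (h : AgreeUpTo (t + s) d d') (hn : d.time n ≤ ENNReal.ofReal t) :
    AgreeUpTo s (shift t n d) (shift t n d') := by
  intro j hj
  rcases j with _ | j
  · exact ⟨rfl, (h n (.inl (hn.trans (ENNReal.ofReal_le_ofReal (by linarith))))).2⟩
  · simp only [SwitchingControl.shift, Nat.add_eq_zero_iff, one_ne_zero, and_false, if_false,
      tsub_le_iff_left, ← ENNReal.ofReal_add ht hs] at hj ⊢
    have := h (n + (j + 1)) hj
    exact ⟨by rw [this.1], this.2⟩

/-- The control that stays in the first mode of `d` until time `t` and then starts `d`. -/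
def delay (t : ℝ) (d : SwitchingControl D) : SwitchingControl D where
  time j := if j = 0 then 0 else ENNReal.ofReal t + d.time j
  mode j := d.mode j
  time_zero := if_pos rfl
  time_mono := monotone_nat_of_le_succ fun j => by
    rcases j with _ | j
    · simp
    · simpa using d.time_mono (Nat.le_succ (j + 1))
  time_tendsto := by
    rw [← tendsto_add_atTop_iff_nat 1]
    simp only [Nat.add_eq_zero_iff, one_ne_zero, and_false, if_false]
    exact tendsto_const_add_nhds_top _ (d.time_tendsto.comp (tendsto_add_atTop_nat 1))
  mode_ne j hj := by
    refine d.mode_ne j (lt_top_iff_ne_top.2 fun h => ?_)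
    simp [h] at hj

theorem le_delay_time_one (t : ℝ) (d : SwitchingControl D) :
    ENNReal.ofReal t ≤ (delay t d).time 1 := by simp [delay]

theorem isShift_delay (t : ℝ) (d : SwitchingControl D) : IsShift t 0 (delay t d) d where
  le := by simp [delay]
  mode j := by simp [delay]
  time j := by simp [delay]

theorem AgreeUpTo.delay {s t : ℝ} {d d' : SwitchingControl D} (ht : 0 ≤ t) (hs : 0 ≤ s)
    (h : AgreeUpTo s d d') : AgreeUpTo (t + s) (delay t d) (delay t d') := by
  intro j hj
  rcases j with _ | j
  · exact ⟨rfl, h.mode_zero⟩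
  · simp only [SwitchingControl.delay, Nat.add_eq_zero_iff, one_ne_zero, and_false, if_false,
      ofReal_add_le_ofReal_add ht hs] at hj ⊢
    have := h (j + 1) hj
    exact ⟨by rw [this.1], this.2⟩

theorem agreeUpTo_of_lt {s : ℝ} {d d' : SwitchingControl D} (hm : d.mode 0 = d'.mode 0)
    (h : ENNReal.ofReal s < d.time 1) (h' : ENNReal.ofReal s < d'.time 1) : AgreeUpTo s d d' := by
  intro j hj
  rcases j with _ | j
  · exact ⟨d.time_zero.trans d'.time_zero.symm, hm⟩
  · exact absurd hj (not_or.2 ⟨not_le.2 (h.trans_le (d.time_mono (by omega))),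
      not_le.2 (h'.trans_le (d'.time_mono (by omega)))⟩)

/-- Controls that agree on `[0, s]` for all `s < t` make the same switches before time `t`. -/
theorem eq_of_forall_agreeUpTo {t : ℝ} {d d' : SwitchingControl D}
    (h : ∀ s, 0 ≤ s → s < t → AgreeUpTo s d d') {j : ℕ} (hj : d.time j < ENNReal.ofReal t) :
    d.time j = d'.time j ∧ d.mode j = d'.mode j := by
  have hfin : d.time j ≠ ⊤ := hj.ne_top
  refine h (d.time j).toReal ENNReal.toReal_nonneg ?_ j (.inl (ENNReal.ofReal_toReal hfin).ge)
  by_contra hle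
  rw [not_lt] at hle
  exact absurd hj (not_lt.2 ((ENNReal.ofReal_le_iff_le_toReal hfin).2 hle))

theorem le_time_of_forall_agreeUpTo {t : ℝ} {d d' : SwitchingControl D}
    (h : ∀ s, 0 ≤ s → s < t → AgreeUpTo s d d') {j : ℕ} (hj : ENNReal.ofReal t ≤ d.time j) :
    ENNReal.ofReal t ≤ d'.time j := by
  by_contra hlt
  rw [not_le] at hlt
  have := (eq_of_forall_agreeUpTo (fun s hs hst => (h s hs hst).symm) hlt).1
  exact absurd hj (not_le.2 (this ▸ hlt))

/-- The control that switches from `a` to the first mode of `d` at time `0` and then follows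
`d`. -/
def cons (a : D) (d : SwitchingControl D) (h : a ≠ d.mode 0) : SwitchingControl D where
  time j := d.time (j - 1)
  mode j := if j = 0 then a else d.mode (j - 1)
  time_zero := d.time_zero
  time_mono := fun i j hij => d.time_mono (by omega)
  time_tendsto := d.time_tendsto.comp (tendsto_sub_atTop_nat 1)
  mode_ne j hj := by
    rcases j with _ | j
    · simpa using h
    · simpa using d.mode_ne j (by simpa using hj)

theorem isShift_cons (a : D) (d : SwitchingControl D) (h : a ≠ d.mode 0) :
    IsShift 0 1 (cons a d h) d where
  le := by simp [cons, d.time_zero]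
  mode j := by simp [cons, add_comm 1]
  time j := by simp [cons, add_comm 1]

theorem AgreeUpTo.cons {t : ℝ} {a : D} {d d' : SwitchingControl D} (h : a ≠ d.mode 0)
    (h' : a ≠ d'.mode 0) (hd : AgreeUpTo t d d') : AgreeUpTo t (cons a d h) (cons a d' h') := by
  intro j hj
  rcases j with _ | j
  · exact ⟨by simp [SwitchingControl.cons, d.time_zero, d'.time_zero], rfl⟩
  · simpa [SwitchingControl.cons] using hd j (by simpa [SwitchingControl.cons] using hj)

/-- The control that stays in the mode `a`. -/
def const (a : D) : SwitchingControl D where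
  time j := if j = 0 then 0 else ⊤
  mode _ := a
  time_zero := if_pos rfl
  time_mono := monotone_nat_of_le_succ fun j => by simp
  time_tendsto := by
    refine tendsto_const_nhds.congr' ?_
    filter_upwards [eventually_ne_atTop 0] with j hj
    simp [hj]
  mode_ne j hj := by simp at hj

end SwitchingControl

namespace ImpulseControl

variable {E : Type*} {K : Set E}

open scoped Classical in
/-- The number of impulses up to and including time `s`. -/
def count (ξ : ImpulseControl K) (s : ℝ) : ℕ :=
  Nat.find (p := fun j => ENNReal.ofReal s < ξ.time j) (ξ.time_tendsto.eventually (lt_mem_nhds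
    (ENNReal.ofReal_lt_top (r := s)))).exists

theorem lt_time_count (ξ : ImpulseControl K) (s : ℝ) :
    ENNReal.ofReal s < ξ.time (ξ.count s) :=
  Nat.find_spec (p := fun j => ENNReal.ofReal s < ξ.time j) _

theorem time_le_of_lt_count (ξ : ImpulseControl K) {s : ℝ} {j : ℕ} (h : j < ξ.count s) :
    ξ.time j ≤ ENNReal.ofReal s :=
  not_lt.1 (Nat.find_min (p := fun j => ENNReal.ofReal s < ξ.time j) _ h)

theorem time_le_iff_lt_count (ξ : ImpulseControl K) {s : ℝ} {j : ℕ} :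
    ξ.time j ≤ ENNReal.ofReal s ↔ j < ξ.count s := by
  refine ⟨fun h => ?_, ξ.time_le_of_lt_count⟩
  by_contra hj
  exact absurd ((ξ.lt_time_count s).trans_le (ξ.time_mono (not_lt.1 hj))) (not_lt.2 h)

theorem AgreeUpTo.mono {s t : ℝ} {ξ ξ' : ImpulseControl K} (h : AgreeUpTo t ξ ξ') (hst : s ≤ t) :
    AgreeUpTo s ξ ξ' := fun j hj => h j <| by
  have := ENNReal.ofReal_le_ofReal hst
  exact hj.imp (le_trans · this) (le_trans · this)

theorem AgreeUpTo.symm {t : ℝ} {ξ ξ' : ImpulseControl K} (h : AgreeUpTo t ξ ξ') :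
    AgreeUpTo t ξ' ξ := fun j hj => ⟨(h j hj.symm).1.symm, (h j hj.symm).2.symm⟩

theorem AgreeUpTo.count_eq {s t : ℝ} {ξ ξ' : ImpulseControl K} (h : AgreeUpTo t ξ ξ')
    (hst : s ≤ t) : ξ.count s = ξ'.count s := by
  have h' := h.mono hst
  refine le_antisymm ?_ ?_
  · refine le_of_forall_lt fun j hj => ?_
    rw [← time_le_iff_lt_count] at *
    exact (h' j (.inl hj)).1 ▸ hj
  · refine le_of_forall_lt fun j hj => ?_
    rw [← time_le_iff_lt_count] at *
    exact (h' j (.inr hj)).1 ▸ hj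

/-- The control `ξ'` is `ξ` seen from time `t` on, after `m` impulses. -/
structure IsShift (t : ℝ) (m : ℕ) (ξ ξ' : ImpulseControl K) : Prop where
  le : ∀ j < m, ξ.time j ≤ ENNReal.ofReal t
  vec : ∀ j, ξ'.vec j = ξ.vec (m + j)
  time : ∀ j, ξ.time (m + j) = ENNReal.ofReal t + ξ'.time j

/-- The control `ξ` seen from time `t` on, after `m` impulses. -/
def shift (t : ℝ) (m : ℕ) (ξ : ImpulseControl K) : ImpulseControl K where
  time j := ξ.time (m + j) - ENNReal.ofReal t
  vec j := ξ.vec (m + j)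
  time_mono := fun i j hij => tsub_le_tsub_right (ξ.time_mono (by omega)) _
  time_tendsto := tendsto_tsub_nhds_top ENNReal.ofReal_ne_top
    (ξ.time_tendsto.comp (tendsto_atTop_mono (fun j : ℕ => show j ≤ m + j by omega) tendsto_id))

theorem isShift_shift {t : ℝ} {m : ℕ} {ξ : ImpulseControl K}
    (h : ∀ j < m, ξ.time j ≤ ENNReal.ofReal t) (h' : ENNReal.ofReal t ≤ ξ.time m) :
    IsShift t m ξ (shift t m ξ) where
  le := h
  vec _ := rfl
  time j := (add_tsub_cancel_of_le (h'.trans (ξ.time_mono (by omega)))).symm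

theorem AgreeUpTo.shift {s t : ℝ} {ξ ξ' : ImpulseControl K} (ht : 0 ≤ t) (hs : 0 ≤ s)
    (h : AgreeUpTo (t + s) ξ ξ') (m : ℕ) : AgreeUpTo s (shift t m ξ) (shift t m ξ') := by
  intro j hj
  simp only [ImpulseControl.shift, tsub_le_iff_left, ← ENNReal.ofReal_add ht hs] at hj ⊢
  have := h (m + j) hj
  exact ⟨by rw [this.1], this.2⟩

/-- The control that starts `ξ` at time `t`. -/
def delay (t : ℝ) (ξ : ImpulseControl K) : ImpulseControl K where
  time j := ENNReal.ofReal t + ξ.time j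
  vec := ξ.vec
  time_mono := fun _ _ hij => add_le_add_right (ξ.time_mono hij) _
  time_tendsto := tendsto_const_add_nhds_top _ ξ.time_tendsto

theorem isShift_delay (t : ℝ) (ξ : ImpulseControl K) : IsShift t 0 (delay t ξ) ξ where
  le := by simp
  vec j := by simp [delay]
  time j := by simp [delay]

theorem AgreeUpTo.delay {s t : ℝ} {ξ ξ' : ImpulseControl K} (ht : 0 ≤ t) (hs : 0 ≤ s)
    (h : AgreeUpTo s ξ ξ') : AgreeUpTo (t + s) (delay t ξ) (delay t ξ') := by
  intro j hj
  simp only [ImpulseControl.delay, ofReal_add_le_ofReal_add ht hs] at hj ⊢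
  have := h j hj
  exact ⟨by rw [this.1], this.2⟩

theorem agreeUpTo_of_lt {s : ℝ} {ξ ξ' : ImpulseControl K} (h : ENNReal.ofReal s < ξ.time 0)
    (h' : ENNReal.ofReal s < ξ'.time 0) : AgreeUpTo s ξ ξ' := fun j hj =>
  absurd hj (not_or.2 ⟨not_le.2 (h.trans_le (ξ.time_mono j.zero_le)),
    not_le.2 (h'.trans_le (ξ'.time_mono j.zero_le))⟩)

/-- Controls that agree on `[0, s]` for all `s < t` make the same impulses before time `t`. -/
theorem eq_of_forall_agreeUpTo {t : ℝ} {ξ ξ' : ImpulseControl K}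
    (h : ∀ s, 0 ≤ s → s < t → AgreeUpTo s ξ ξ') {j : ℕ} (hj : ξ.time j < ENNReal.ofReal t) :
    ξ.time j = ξ'.time j ∧ ξ.vec j = ξ'.vec j := by
  have hfin : ξ.time j ≠ ⊤ := hj.ne_top
  refine h (ξ.time j).toReal ENNReal.toReal_nonneg ?_ j (.inl (ENNReal.ofReal_toReal hfin).ge)
  by_contra hle
  rw [not_lt] at hle
  exact absurd hj (not_lt.2 ((ENNReal.ofReal_le_iff_le_toReal hfin).2 hle))

theorem le_time_of_forall_agreeUpTo {t : ℝ} {ξ ξ' : ImpulseControl K}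
    (h : ∀ s, 0 ≤ s → s < t → AgreeUpTo s ξ ξ') {j : ℕ} (hj : ENNReal.ofReal t ≤ ξ.time j) :
    ENNReal.ofReal t ≤ ξ'.time j := by
  by_contra hlt
  rw [not_le] at hlt
  have := (eq_of_forall_agreeUpTo (fun s hs hst => (h s hs hst).symm) hlt).1
  exact absurd hj (not_le.2 (this ▸ hlt))

theorem le_delay_time_zero (t : ℝ) (ξ : ImpulseControl K) :
    ENNReal.ofReal t ≤ (delay t ξ).time 0 := by simp [delay]

/-- The control that makes the impulse `v` at time `0` and then follows `ξ`. -/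
def cons (v : K) (ξ : ImpulseControl K) : ImpulseControl K where
  time j := if j = 0 then 0 else ξ.time (j - 1)
  vec j := if j = 0 then v else ξ.vec (j - 1)
  time_mono := monotone_nat_of_le_succ fun j => by
    rcases j with _ | j
    · simp
    · simpa using ξ.time_mono (by omega)
  time_tendsto := by
    rw [← tendsto_add_atTop_iff_nat 1]
    simpa using ξ.time_tendsto

theorem isShift_cons (v : K) (ξ : ImpulseControl K) : IsShift 0 1 (cons v ξ) ξ where
  le j hj := by simp [cons, Nat.lt_one_iff.1 hj]
  vec j := by simp [cons, add_comm 1]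
  time j := by simp [cons, add_comm 1]

theorem AgreeUpTo.cons {t : ℝ} (v : K) {ξ ξ' : ImpulseControl K} (h : AgreeUpTo t ξ ξ') :
    AgreeUpTo t (cons v ξ) (cons v ξ') := by
  intro j hj
  rcases j with _ | j
  · exact ⟨rfl, rfl⟩
  · simpa [ImpulseControl.cons] using h j (by simpa [ImpulseControl.cons] using hj)

/-- The control without impulses. -/
def none (v : K) : ImpulseControl K where
  time _ := ⊤
  vec _ := v
  time_mono := monotone_const
  time_tendsto := tendsto_const_nhds

end ImpulseControl

/-! ### Integral inequalities and Picard iteration -/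

theorem setIntegral_exp_const_mul {M t : ℝ} (hM : M ≠ 0) (ht : 0 ≤ t) :
    ∫ s in Ioc 0 t, Real.exp (M * s) = (Real.exp (M * t) - 1) / M := by
  rw [← intervalIntegral.integral_of_le ht]
  have h : ∀ s ∈ uIcc 0 t, HasDerivAt (fun s => Real.exp (M * s) / M) (Real.exp (M * s)) s := by
    intro s _
    have := (((hasDerivAt_id s).const_mul M).exp).div_const M
    simpa [hM] using this
  rw [intervalIntegral.integral_eq_sub_of_hasDerivAt h
    ((by fun_prop : Continuous fun s => Real.exp (M * s)).intervalIntegrable _ _)]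
  simp [sub_div]

theorem integrableOn_exp_const_mul (M t : ℝ) :
    IntegrableOn (fun s => Real.exp (M * s)) (Ioc 0 t) :=
  ((by fun_prop : Continuous fun s => Real.exp (M * s)).integrableOn_Icc).mono_set Ioc_subset_Icc_self

/-- A Gronwall inequality. -/
theorem le_two_mul_exp_of_le_add_integral {e : ℝ → ℝ} {a L T B : ℝ} (hL : 0 < L)
    (he : IntegrableOn e (Ioc 0 T)) (he0 : ∀ t ∈ Icc 0 T, 0 ≤ e t) (hB : ∀ t ∈ Icc 0 T, e t ≤ B)
    (h : ∀ t ∈ Icc 0 T, e t ≤ a + L * ∫ s in Ioc 0 t, e s) :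
    ∀ t ∈ Icc 0 T, e t ≤ 2 * a * Real.exp (2 * L * t) := by
  intro t₁ ht₁
  set w : ℝ → ℝ := fun t => Real.exp (-(2 * L) * t) * e t
  have hexp : ∀ t, Real.exp (2 * L * t) * Real.exp (-(2 * L) * t) = 1 := fun t => by
    rw [← Real.exp_add]; simp
  -- In the sup norm weighted by exp(-2Lt) the integral operator has norm at most 1/2, so M ≤ a +
  -- M/2. The bound B guarantees that M is a genuine supremum, without continuity of e.
  set M := sSup (w '' Icc 0 T)
  have hbdd : BddAbove (w '' Icc 0 T) := by
    refine ⟨B, ?_⟩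
    rintro _ ⟨t, ht, rfl⟩
    calc w t ≤ 1 * e t := mul_le_mul_of_nonneg_right
          (exp_neg_mul_le_one (by positivity) ht.1) (he0 t ht)
      _ ≤ B := by rw [one_mul]; exact hB t ht
  have hwM : ∀ t ∈ Icc 0 T, e t ≤ M * Real.exp (2 * L * t) := by
    intro t ht
    have h1 : w t ≤ M := le_csSup hbdd ⟨t, ht, rfl⟩
    calc e t = w t * Real.exp (2 * L * t) := by
          simp only [w]; linear_combination -(e t) * hexp t
      _ ≤ _ := mul_le_mul_of_nonneg_right h1 (Real.exp_pos _).le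
  have hM0 : 0 ≤ M := le_trans (mul_nonneg (Real.exp_pos _).le (he0 t₁ ht₁))
    (le_csSup hbdd ⟨t₁, ht₁, rfl⟩)
  have hkey : ∀ t ∈ Icc 0 T, w t ≤ a + M / 2 := by
    intro t ht
    have h1 : ∫ s in Ioc 0 t, e s ≤ ∫ s in Ioc 0 t, M * Real.exp (2 * L * s) :=
      setIntegral_mono_on (he.mono_set (Ioc_subset_Ioc_right ht.2))
        ((integrableOn_exp_const_mul _ _).const_mul M) measurableSet_Ioc
        fun s hs => hwM s ⟨hs.1.le, hs.2.trans ht.2⟩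
    rw [integral_const_mul, setIntegral_exp_const_mul (by positivity) ht.1] at h1
    have h2 : L * (M * ((Real.exp (2 * L * t) - 1) / (2 * L)))
        = M / 2 * (Real.exp (2 * L * t) - 1) := by field_simp
    have h3 : e t ≤ a + M / 2 * (Real.exp (2 * L * t) - 1) := by
      rw [← h2]
      exact (h t ht).trans (by gcongr)
    have ha : 0 ≤ a := by
      have h4 := h 0 ⟨le_rfl, ht.1.trans ht.2⟩
      have h5 := he0 0 ⟨le_rfl, ht.1.trans ht.2⟩
      simp at h4
      linarith
    have h6 : Real.exp (-(2 * L) * t) ≤ 1 := exp_neg_mul_le_one (by positivity) ht.1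
    have h7 : e t ≤ a + M / 2 * Real.exp (2 * L * t) := by linarith
    calc w t ≤ Real.exp (-(2 * L) * t) * (a + M / 2 * Real.exp (2 * L * t)) :=
          mul_le_mul_of_nonneg_left h7 (Real.exp_pos _).le
      _ = Real.exp (-(2 * L) * t) * a + M / 2 := by linear_combination M / 2 * hexp t
      _ ≤ a + M / 2 := by nlinarith
  have hM : M ≤ a + M / 2 := by
    refine csSup_le ⟨w t₁, t₁, ht₁, rfl⟩ ?_
    rintro _ ⟨t, ht, rfl⟩
    exact hkey t ht
  refine (hwM t₁ ht₁).trans (mul_le_mul_of_nonneg_right (by linarith) (Real.exp_pos _).le)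

namespace ContractionSemigroup

variable {E : Type*} [NormedAddCommGroup E] [NormedSpace ℝ E] (T : ContractionSemigroup E)

theorem aestronglyMeasurable_integral_evol {g : ℝ → E} (hg : AEStronglyMeasurable g volume) :
    AEStronglyMeasurable (fun t => ∫ s in Ioc 0 t, T.evol (t - s) (g s)) volume := by
  have h1 : AEStronglyMeasurable (fun p : ℝ × ℝ => T.evol (p.1 - p.2) (g p.2))
      (volume.prod volume) :=
    T.continuous_evol.comp_aestronglyMeasurable
      (((by fun_prop : Continuous fun p : ℝ × ℝ => p.1 - p.2).aestronglyMeasurable).prodMk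
        hg.comp_snd)
  have hs : MeasurableSet {p : ℝ × ℝ | p.2 ∈ Ioc 0 p.1} :=
    (measurableSet_lt measurable_const measurable_snd).inter
      (measurableSet_le measurable_snd measurable_fst)
  have h2 := (h1.indicator hs).integral_prod_right'
  refine h2.congr (Eventually.of_forall fun t => ?_)
  dsimp only
  rw [← integral_indicator measurableSet_Ioc]
  rfl

/-- Semilinear integral equations with bounded Lipschitz nonlinearity are solvable. -/
theorem exists_mild_solution [CompleteSpace E] {Φ : ℝ → E → E} {g : ℝ → E} {F L : ℝ}
    (hF : 0 ≤ F) (hL : 0 < L)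
    (hΦ : ∀ y, AEStronglyMeasurable y volume → AEStronglyMeasurable (fun s => Φ s (y s)) volume)
    (hΦF : ∀ s y, ‖Φ s y‖ ≤ F) (hΦL : ∀ s y z, ‖Φ s y - Φ s z‖ ≤ L * ‖y - z‖)
    (hg : AEStronglyMeasurable g volume) :
    ∃ y : ℝ → E, AEStronglyMeasurable y volume ∧
      ∀ t, 0 ≤ t → y t = g t + ∫ s in Ioc 0 t, T.evol (t - s) (Φ s (y s)) := by
  set P : (ℝ → E) → ℝ → E := fun y t => g t + ∫ s in Ioc 0 t, T.evol (t - s) (Φ s (y s))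
  set y : ℕ → ℝ → E := fun n => P^[n] g
  have hsucc : ∀ n, y (n + 1) = P (y n) := fun n => Function.iterate_succ_apply' P n g
  have hmeas : ∀ n, AEStronglyMeasurable (y n) volume := by
    intro n
    induction n with
    | zero => exact hg
    | succ n ih => rw [hsucc]; exact hg.add (T.aestronglyMeasurable_integral_evol (hΦ _ ih))
  have hint : ∀ n t, IntegrableOn (fun s => T.evol (t - s) (Φ s (y n s))) (Ioc 0 t) := fun n t =>
    T.integrableOn_evol_comp (hΦ _ (hmeas n)).restrict (fun s _ => hΦF s _) t
  -- The weight exp(Mt) makes each Picard step at least halve the differences because L/M ≤ 1/2; the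
  -- summand 1 gives t ≤ exp(Mt), which starts the induction.
  set M := 2 * L + 1 with hM
  have hdist : ∀ n t, 0 ≤ t → dist (y n t) (y (n + 1) t) ≤ F * Real.exp (M * t) / 2 / 2 ^ n * 2 := by
    intro n
    induction n with
    | zero =>
      intro t ht
      rw [hsucc, dist_comm, dist_eq_norm]
      have h1 : P (y 0) t - y 0 t = ∫ s in Ioc 0 t, T.evol (t - s) (Φ s (y 0 s)) := by
        simp [P, y]
      rw [h1]
      refine (T.norm_integral_evol_le ht fun s _ => hΦF s _).trans ?_
      have h2 := Real.add_one_le_exp (M * t)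
      have h3 : t ≤ Real.exp (M * t) := by nlinarith
      calc F * t ≤ F * Real.exp (M * t) := by gcongr
        _ = _ := by ring
    | succ n ih =>
      intro t ht
      rw [hsucc (n + 1), dist_eq_norm, show y (n + 1) t = P (y n) t from congrFun (hsucc n) t]
      have h1 : P (y n) t - P (y (n + 1)) t = ∫ s in Ioc 0 t,
          (T.evol (t - s) (Φ s (y n s)) - T.evol (t - s) (Φ s (y (n + 1) s))) := by
        rw [integral_sub (hint n t) (hint (n + 1) t)]
        simp [P]
      rw [h1]
      have hc : 0 ≤ F / 2 / 2 ^ n * 2 := by positivity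
      have h2 : ‖∫ s in Ioc 0 t,
          (T.evol (t - s) (Φ s (y n s)) - T.evol (t - s) (Φ s (y (n + 1) s)))‖
          ≤ ∫ s in Ioc 0 t, L * (F / 2 / 2 ^ n * 2) * Real.exp (M * s) := by
        refine norm_integral_le_of_norm_le ((integrableOn_exp_const_mul M t).const_mul _) ?_
        filter_upwards [ae_restrict_mem measurableSet_Ioc] with s hs
        rw [← map_sub]
        refine (T.norm_evol_apply_le _ _).trans ((hΦL s _ _).trans ?_)
        rw [← dist_eq_norm, mul_assoc]
        refine mul_le_mul_of_nonneg_left ((ih s hs.1.le).trans_eq (by ring)) hL.le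
      refine h2.trans ?_
      rw [integral_const_mul, setIntegral_exp_const_mul (by positivity) ht, mul_div_assoc',
        div_le_iff₀ (by positivity)]
      have h4 : F * Real.exp (M * t) / 2 / 2 ^ (n + 1) * 2 * M
          = (F / 2 / 2 ^ n * 2) * Real.exp (M * t) * (L + 1 / 2) := by
        rw [hM, pow_succ]; field_simp
      rw [h4]
      have h5 := mul_nonneg hc (Real.exp_pos (M * t)).le
      have h6 := mul_nonneg hL.le hc
      nlinarith
  have hcauchy : ∀ t, 0 ≤ t → CauchySeq fun n => y n t := fun t ht =>
    cauchySeq_of_le_geometric_two (C := 2 * (F * Real.exp (M * t))) fun n =>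
      (hdist n t ht).trans_eq (by ring)
  set Y : ℝ → E := fun t => limUnder atTop fun n => y n (max t 0)
  have hlim : ∀ t, 0 ≤ t → Tendsto (fun n => y n t) atTop (𝓝 (Y t)) := by
    intro t ht
    have := (hcauchy t ht).tendsto_limUnder
    simpa [Y, ht] using this
  -- The iterates are known to converge only for t ≥ 0, so the solution is cut off to 0 at negative
  -- times before passing to the limit.
  have hYm : AEStronglyMeasurable ((Ici (0 : ℝ)).indicator Y) volume := by
    refine aestronglyMeasurable_of_tendsto_ae atTop
      (f := fun n => (Ici (0 : ℝ)).indicator (y n)) (fun n => (hmeas n).indicator measurableSet_Ici)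
      (Eventually.of_forall fun t => ?_)
    by_cases ht : t ∈ Ici (0 : ℝ)
    · simpa [ht] using hlim t ht
    · simp [ht]
  refine ⟨_, hYm, fun t ht => ?_⟩
  have hY : ∀ s, 0 ≤ s → (Ici (0 : ℝ)).indicator Y s = Y s := fun s hs =>
    indicator_of_mem (mem_Ici.2 hs) _
  rw [hY t ht]
  have h1 : Tendsto (fun n => y (n + 1) t) atTop (𝓝 (Y t)) :=
    (hlim t ht).comp (tendsto_add_atTop_nat 1)
  refine tendsto_nhds_unique h1 ?_
  simp only [hsucc, P]
  refine tendsto_const_nhds.add ?_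
  refine tendsto_integral_of_dominated_convergence (fun _ => F) (fun n => (hint n t).1)
    (integrableOn_const (by simp) enorm_ne_top) (fun n => Eventually.of_forall fun s =>
      (T.norm_evol_apply_le _ _).trans (hΦF _ _)) ?_
  filter_upwards [ae_restrict_mem measurableSet_Ioc] with s hs
  refine ((T.evol (t - s)).continuous.tendsto _).comp ?_
  rw [tendsto_iff_norm_sub_tendsto_zero, hY s hs.1.le]
  have h2 := tendsto_iff_norm_sub_tendsto_zero.1 (hlim s hs.1.le)
  exact squeeze_zero (fun _ => norm_nonneg _) (fun n => hΦL s _ _) (by simpa using h2.const_mul L)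

end ContractionSemigroup

/-- The sets of modes carry no σ-algebra. Measurability is obtained through the integer index of the
current mode: on each of its countably many level sets the integrand is a single measurable
function. -/
theorem aestronglyMeasurable_of_countable_switching {X ι : Type*} [Countable ι]
    [MeasurableSpace ι] [MeasurableSingletonClass ι] [TopologicalSpace X]
    [TopologicalSpace.PseudoMetrizableSpace X]
    {μ : Measure ℝ} {h : ι → ℝ → X} {i : ℝ → ι} (hi : Measurable i)
    (hh : ∀ n, AEStronglyMeasurable (h n) μ) : AEStronglyMeasurable (fun s => h (i s) s) μ := by
  have hu : (⋃ n, i ⁻¹' {n}) = univ := by ext s; simp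
  rw [← Measure.restrict_univ (μ := μ), ← hu, aestronglyMeasurable_iUnion_iff]
  intro n
  refine (hh n).restrict.congr ?_
  filter_upwards [ae_restrict_mem (hi (measurableSet_singleton n))] with s hs
  rw [show i s = n from hs]

/-! ### State trajectories: existence, stability and restarting -/

namespace HybridGame

variable {E U₁ U₂ D₁ D₂ : Type*} [NormedAddCommGroup E] [InnerProductSpace ℝ E]
  [MeasurableSpace U₁] [MeasurableSpace U₂]

/-- Uniform bounds on the data of a game. -/
structure Regular [TopologicalSpace U₁] [TopologicalSpace U₂] (G : HybridGame E U₁ U₂ D₁ D₂)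
    (F K L : ℝ) : Prop where
  F_nonneg : 0 ≤ F
  K_nonneg : 0 ≤ K
  L_pos : 0 < L
  norm_f_le : ∀ x u₁ d₁ u₂ d₂, ‖G.f x u₁ d₁ u₂ d₂‖ ≤ F
  continuous_f : ∀ d₁ d₂, Continuous fun p : E × U₁ × U₂ => G.f p.1 p.2.1 d₁ p.2.2 d₂
  lipschitz_f : ∀ x y u₁ d₁ u₂ d₂, ‖G.f x u₁ d₁ u₂ d₂ - G.f y u₁ d₁ u₂ d₂‖ ≤ L * ‖x - y‖
  k_nonneg : ∀ x u₁ d₁ u₂ d₂, 0 ≤ G.k x u₁ d₁ u₂ d₂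
  k_le : ∀ x u₁ d₁ u₂ d₂, G.k x u₁ d₁ u₂ d₂ ≤ K
  continuous_k : ∀ d₁ d₂, Continuous fun p : E × U₁ × U₂ => G.k p.1 p.2.1 d₁ p.2.2 d₂
  lipschitz_k : ∀ x y u₁ d₁ u₂ d₂, |G.k x u₁ d₁ u₂ d₂ - G.k y u₁ d₁ u₂ d₂| ≤ L * ‖x - y‖
  c₁_nonneg : ∀ d d', 0 ≤ G.c₁ d d'
  c₂_nonneg : ∀ d d', 0 ≤ G.c₂ d d'
  l_nonneg : ∀ ξ, 0 ≤ G.l ξ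

theorem exists_regular [TopologicalSpace U₁] [TopologicalSpace U₂]
    {G : HybridGame E U₁ U₂ D₁ D₂} (hA1 : G.A1) (hA2 : G.A2) : ∃ F K L, G.Regular F K L := by
  obtain ⟨F, hF⟩ := hA1.bounded
  obtain ⟨K, hK⟩ := hA2.k_bounded
  obtain ⟨L₁, hL₁⟩ := hA1.lipschitz
  obtain ⟨L₂, hL₂⟩ := hA2.k_lipschitz
  have h1 : L₁ ≤ max 1 (max L₁ L₂) := by simp
  have h2 : L₂ ≤ max 1 (max L₁ L₂) := by simp
  exact ⟨max F 0, max K 0, max 1 (max L₁ L₂),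
    { F_nonneg := le_max_right _ _
      K_nonneg := le_max_right _ _
      L_pos := zero_lt_one.trans_le (le_max_left _ _)
      norm_f_le := fun x u₁ d₁ u₂ d₂ => (hF x u₁ d₁ u₂ d₂).trans (le_max_left _ _)
      continuous_f := hA1.continuous
      lipschitz_f := fun x y u₁ d₁ u₂ d₂ => (hL₁ x y u₁ d₁ u₂ d₂).trans (by gcongr)
      k_nonneg := hA2.k_nonneg
      k_le := fun x u₁ d₁ u₂ d₂ => (hK x u₁ d₁ u₂ d₂).trans (le_max_left _ _)
      continuous_k := hA2.k_continuous
      lipschitz_k := fun x y u₁ d₁ u₂ d₂ => (hL₂ x y u₁ d₁ u₂ d₂).trans (by gcongr)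
      c₁_nonneg := hA2.c₁_nonneg
      c₂_nonneg := hA2.c₂_nonneg
      l_nonneg := hA2.l_nonneg }⟩

section State

variable (G : HybridGame E U₁ U₂ D₁ D₂)

/-- The right-hand side of the state equation along `y`. -/
def drift (p : G.C1) (q : G.C2) (y : ℝ → E) (s : ℝ) : E :=
  G.f (y s) (p.1.1 s) (p.2.val s) (q.1.1 s) (q.2.1.val s)

/-- The running cost along `y`. -/
def rate (p : G.C1) (q : G.C2) (y : ℝ → E) (s : ℝ) : ℝ :=
  G.k (y s) (p.1.1 s) (p.2.val s) (q.1.1 s) (q.2.1.val s)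

/-- The contribution at time `t` of the impulses up to and including time `t`. -/
def impulseSum (ξ : ImpulseControl G.K) (t : ℝ) : E :=
  ∑' j : ℕ, if ξ.time j ≤ ENNReal.ofReal t then
    G.semigroup.evol (t - (ξ.time j).toReal) (ξ.vec j : E) else 0

/-- The state at time `t` when only the first `m` impulses are made. -/
def preState (x : E) (p : G.C1) (q : G.C2) (y : ℝ → E) (t : ℝ) (m : ℕ) : E :=
  G.semigroup.evol t x + (∫ s in Ioc 0 t, G.semigroup.evol (t - s) (G.drift p q y s))
    + ∑ j ∈ Finset.range m, G.semigroup.evol (t - (q.2.2.time j).toReal) (q.2.2.vec j : E)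

theorem impulseSum_eq_sum {ξ : ImpulseControl G.K} {t : ℝ} {m : ℕ}
    (h : ENNReal.ofReal t < ξ.time m) : G.impulseSum ξ t =
      ∑ j ∈ Finset.range m, if ξ.time j ≤ ENNReal.ofReal t then
        G.semigroup.evol (t - (ξ.time j).toReal) (ξ.vec j : E) else 0 := by
  refine tsum_eq_sum fun j hj => if_neg (not_le.2 ?_)
  exact h.trans_le (ξ.time_mono (by simpa using hj))

theorem summable_impulse (ξ : ImpulseControl G.K) (t : ℝ) :
    Summable fun j : ℕ => if ξ.time j ≤ ENNReal.ofReal t then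
      G.semigroup.evol (t - (ξ.time j).toReal) (ξ.vec j : E) else 0 := by
  refine summable_of_ne_finset_zero (s := Finset.range (ξ.count t)) fun j hj => if_neg (not_le.2 ?_)
  exact (ξ.lt_time_count t).trans_le (ξ.time_mono (by simpa using hj))

theorem toReal_le_of_le_ofReal {a : ℝ≥0∞} {t : ℝ} (ht : 0 ≤ t) (h : a ≤ ENNReal.ofReal t) :
    a.toReal ≤ t := ENNReal.toReal_le_of_le_ofReal ht h

theorem isMildSolution_iff {x : E} {p : G.C1} {q : G.C2} {y : ℝ → E} :
    G.IsMildSolution x p q y ↔ AEStronglyMeasurable y (volume.restrict (Ici (0 : ℝ))) ∧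
      ∀ t, 0 ≤ t → y t = G.semigroup.evol t x
        + (∫ s in Ioc 0 t, G.semigroup.evol (t - s) (G.drift p q y s))
        + G.impulseSum q.2.2 t := by
  have key : ∀ t : ℝ, 0 ≤ t → G.semigroup.S t x
      + (∫ s in (0 : ℝ)..t, G.semigroup.S (t - s)
        (G.f (y s) (p.1.1 s) (p.2.val s) (q.1.1 s) (q.2.1.val s)))
      + (∑' j : ℕ, if q.2.2.time j ≤ ENNReal.ofReal t then
        G.semigroup.S (t - (q.2.2.time j).toReal) (q.2.2.vec j : E) else 0)
      = G.semigroup.evol t x + (∫ s in Ioc 0 t, G.semigroup.evol (t - s) (G.drift p q y s))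
        + G.impulseSum q.2.2 t := by
    intro t ht
    rw [G.semigroup.integral_S_eq_evol ht, G.semigroup.evol_of_nonneg ht]
    refine congrArg₂ _ rfl (tsum_congr fun j => ?_)
    split_ifs with h
    · rw [G.semigroup.evol_of_nonneg (sub_nonneg.2 (toReal_le_of_le_ofReal ht h))]
    · rfl
  exact ⟨fun h => ⟨h.1, fun t ht => (h.2 t ht).trans (key t ht)⟩,
    fun h => ⟨h.1, fun t ht => (h.2 t ht).trans (key t ht).symm⟩⟩

theorem aestronglyMeasurable_impulseSum (ξ : ImpulseControl G.K) :
    AEStronglyMeasurable (G.impulseSum ξ) volume := by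
  refine aestronglyMeasurable_of_tendsto_ae atTop
    (f := fun n t => ∑ j ∈ Finset.range n, if ξ.time j ≤ ENNReal.ofReal t then
      G.semigroup.evol (t - (ξ.time j).toReal) (ξ.vec j : E) else 0) (fun n => ?_)
    (Eventually.of_forall fun t => (G.summable_impulse ξ t).hasSum.tendsto_sum_nat)
  refine Finset.aestronglyMeasurable_fun_sum _ fun j _ => ?_
  have hs : MeasurableSet {t : ℝ | ξ.time j ≤ ENNReal.ofReal t} :=
    measurableSet_le measurable_const ENNReal.measurable_ofReal
  have hc : Continuous fun t => G.semigroup.evol (t - (ξ.time j).toReal) (ξ.vec j : E) :=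
    (G.semigroup.continuous_evol_apply _).comp (by fun_prop)
  refine (hc.aestronglyMeasurable.indicator hs).congr (Eventually.of_forall fun t => ?_)
  simp [indicator_apply]

variable [MetricSpace U₁] [CompactSpace U₁] [BorelSpace U₁]
  [MetricSpace U₂] [CompactSpace U₂] [BorelSpace U₂]

omit [InnerProductSpace ℝ E] in
theorem aestronglyMeasurable_comp_controls {X : Type*} [TopologicalSpace X]
    [TopologicalSpace.PseudoMetrizableSpace X] {h : E → U₁ → D₁ → U₂ → D₂ → X}
    (hh : ∀ d₁ d₂, Continuous fun p : E × U₁ × U₂ => h p.1 p.2.1 d₁ p.2.2 d₂)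
    {μ : Measure ℝ} {y : ℝ → E} (hy : AEStronglyMeasurable y μ) (u₁ : ContControl U₁)
    (d₁ : SwitchingControl D₁) (u₂ : ContControl U₂) (d₂ : SwitchingControl D₂) :
    AEStronglyMeasurable (fun s => h (y s) (u₁.1 s) (d₁.val s) (u₂.1 s) (d₂.val s)) μ := by
  refine aestronglyMeasurable_of_countable_switching
    (h := fun (n : ℕ × ℕ) s => h (y s) (u₁.1 s) (d₁.mode n.1) (u₂.1 s) (d₂.mode n.2))
    (i := fun s => (d₁.idx s, d₂.idx s)) (d₁.measurable_idx.prodMk d₂.measurable_idx) fun n => ?_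
  exact (hh _ _).comp_aestronglyMeasurable (hy.prodMk
    (u₁.2.stronglyMeasurable.aestronglyMeasurable.prodMk
      u₂.2.stronglyMeasurable.aestronglyMeasurable))

variable {G} {F K L : ℝ} (hG : G.Regular F K L)

include hG

theorem Regular.aestronglyMeasurable_drift {μ : Measure ℝ} {y : ℝ → E}
    (hy : AEStronglyMeasurable y μ) (p : G.C1) (q : G.C2) :
    AEStronglyMeasurable (G.drift p q y) μ :=
  aestronglyMeasurable_comp_controls hG.continuous_f hy p.1 p.2 q.1 q.2.1

theorem Regular.aestronglyMeasurable_rate {μ : Measure ℝ} {y : ℝ → E}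
    (hy : AEStronglyMeasurable y μ) (p : G.C1) (q : G.C2) :
    AEStronglyMeasurable (G.rate p q y) μ :=
  aestronglyMeasurable_comp_controls hG.continuous_k hy p.1 p.2 q.1 q.2.1

end State

end HybridGame

namespace HybridGame

variable {E U₁ U₂ D₁ D₂ : Type*} [NormedAddCommGroup E] [InnerProductSpace ℝ E] [CompleteSpace E]
  [MetricSpace U₁] [CompactSpace U₁] [MeasurableSpace U₁] [BorelSpace U₁]
  [MetricSpace U₂] [CompactSpace U₂] [MeasurableSpace U₂] [BorelSpace U₂]
  {G : HybridGame E U₁ U₂ D₁ D₂} {F K L : ℝ}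

/-- The values of two pairs of controls coincide at time `s`. -/
def SameValues (p p' : G.C1) (q q' : G.C2) (s : ℝ) : Prop :=
  p.1.1 s = p'.1.1 s ∧ p.2.val s = p'.2.val s ∧ q.1.1 s = q'.1.1 s ∧ q.2.1.val s = q'.2.1.val s

theorem drift_eq_of_sameValues {p p' : G.C1} {q q' : G.C2} {y y' : ℝ → E} {s s' : ℝ}
    (h1 : p.1.1 s = p'.1.1 s') (h2 : p.2.val s = p'.2.val s') (h3 : q.1.1 s = q'.1.1 s')
    (h4 : q.2.1.val s = q'.2.1.val s') (hy : y s = y' s') :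
    G.drift p q y s = G.drift p' q' y' s' := by
  rw [drift, drift, h1, h2, h3, h4, hy]

theorem rate_eq_of_sameValues {p p' : G.C1} {q q' : G.C2} {y y' : ℝ → E} {s s' : ℝ}
    (h1 : p.1.1 s = p'.1.1 s') (h2 : p.2.val s = p'.2.val s') (h3 : q.1.1 s = q'.1.1 s')
    (h4 : q.2.1.val s = q'.2.1.val s') (hy : y s = y' s') :
    G.rate p q y s = G.rate p' q' y' s' := by
  rw [rate, rate, h1, h2, h3, h4, hy]

namespace Regular

variable (hG : G.Regular F K L)
include hG

theorem exists_isMildSolution (x : E) (p : G.C1) (q : G.C2) : ∃ y, G.IsMildSolution x p q y := by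
  obtain ⟨y, hy, h⟩ := G.semigroup.exists_mild_solution
    (Φ := fun s z => G.f z (p.1.1 s) (p.2.val s) (q.1.1 s) (q.2.1.val s))
    (g := fun t => G.semigroup.evol t x + G.impulseSum q.2.2 t) hG.F_nonneg hG.L_pos
    (fun y hy => hG.aestronglyMeasurable_drift hy p q) (fun s y => hG.norm_f_le _ _ _ _ _)
    (fun s y z => hG.lipschitz_f _ _ _ _ _ _)
    ((G.semigroup.continuous_evol_apply x).aestronglyMeasurable.add
      (G.aestronglyMeasurable_impulseSum _))
  refine ⟨y, G.isMildSolution_iff.2 ⟨hy.restrict, fun t ht => ?_⟩⟩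
  rw [h t ht, add_right_comm]
  rfl

theorem isMildSolution_state (x : E) (p : G.C1) (q : G.C2) :
    G.IsMildSolution x p q (G.state x p q) :=
  Classical.epsilon_spec (hG.exists_isMildSolution x p q)

theorem integrableOn_drift {p : G.C1} {q : G.C2} {y : ℝ → E}
    (hy : AEStronglyMeasurable y (volume.restrict (Ici (0 : ℝ)))) {a : ℝ} (ha : 0 ≤ a) (b t : ℝ) :
    IntegrableOn (fun s => G.semigroup.evol (t - s) (G.drift p q y s)) (Ioc a b) :=
  G.semigroup.integrableOn_evol_comp (hG.aestronglyMeasurable_drift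
    (hy.mono_set fun _ hs => mem_Ici.2 (ha.trans hs.1.le)) p q) (fun _ _ => hG.norm_f_le _ _ _ _ _) t

/-- Continuous dependence of mild solutions on the initial state. -/
theorem norm_sub_le_of_isMildSolution {x x' : E} {p p' : G.C1} {q q' : G.C2} {y y' : ℝ → E}
    (hy : G.IsMildSolution x p q y) (hy' : G.IsMildSolution x' p' q' y') {T : ℝ}
    (hc : ∀ᵐ s ∂volume.restrict (Ioc 0 T), SameValues p p' q q' s)
    (hI : ∀ t ∈ Icc 0 T, G.impulseSum q.2.2 t = G.impulseSum q'.2.2 t) :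
    ∀ t ∈ Icc 0 T, ‖y t - y' t‖ ≤ 2 * ‖x - x'‖ * Real.exp (2 * L * t) := by
  obtain ⟨hym, hy⟩ := G.isMildSolution_iff.1 hy
  obtain ⟨hym', hy'⟩ := G.isMildSolution_iff.1 hy'
  have hi : ∀ t, IntegrableOn (fun s => G.semigroup.evol (t - s) (G.drift p q y s)) (Ioc 0 t) :=
    fun t => hG.integrableOn_drift hym le_rfl t t
  have hi' : ∀ t, IntegrableOn (fun s => G.semigroup.evol (t - s) (G.drift p' q' y' s)) (Ioc 0 t) :=
    fun t => hG.integrableOn_drift hym' le_rfl t t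
  have hdiff : ∀ t ∈ Icc 0 T, y t - y' t = G.semigroup.evol t (x - x') + ∫ s in Ioc 0 t,
      (G.semigroup.evol (t - s) (G.drift p q y s)
        - G.semigroup.evol (t - s) (G.drift p' q' y' s)) := by
    intro t ht
    rw [integral_sub (hi t) (hi' t), hy t ht.1, hy' t ht.1, hI t ht, map_sub]
    abel
  have hbound : ∀ t ∈ Icc 0 T, ‖y t - y' t‖ ≤ ‖x - x'‖ + 2 * F * T := by
    intro t ht
    rw [hdiff t ht]
    refine (norm_add_le _ _).trans (add_le_add (G.semigroup.norm_evol_apply_le _ _) ?_)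
    have := norm_setIntegral_le_of_norm_le_const (μ := volume) (s := Ioc (0 : ℝ) t) (C := 2 * F)
      (f := fun s => G.semigroup.evol (t - s) (G.drift p q y s)
        - G.semigroup.evol (t - s) (G.drift p' q' y' s)) (by simp) fun s _ => by
        refine (norm_sub_le _ _).trans ?_
        have h1 := (G.semigroup.norm_evol_apply_le (t - s) (G.drift p q y s)).trans
          (hG.norm_f_le _ _ _ _ _)
        have h2 := (G.semigroup.norm_evol_apply_le (t - s) (G.drift p' q' y' s)).trans
          (hG.norm_f_le _ _ _ _ _)
        linarith
    rw [volume_real_Ioc_zero ht.1] at this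
    refine this.trans ?_
    have := hG.F_nonneg
    have := ht.2
    gcongr
  have hm : ∀ {z : ℝ → E}, AEStronglyMeasurable z (volume.restrict (Ici (0 : ℝ))) →
      AEStronglyMeasurable z (volume.restrict (Ioc 0 T)) := fun h =>
    h.mono_set fun _ hs => mem_Ici.2 hs.1.le
  have hint : IntegrableOn (fun t => ‖y t - y' t‖) (Ioc 0 T) :=
    integrableOn_Ioc_of_norm_le (C := ‖x - x'‖ + 2 * F * T) ((hm hym).sub (hm hym')).norm
      fun s hs => by rw [norm_norm]; exact hbound s ⟨hs.1.le, hs.2⟩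
  refine le_two_mul_exp_of_le_add_integral hG.L_pos hint (fun _ _ => norm_nonneg _) hbound ?_
  intro t ht
  rw [hdiff t ht, ← integral_const_mul]
  refine (norm_add_le _ _).trans (add_le_add (G.semigroup.norm_evol_apply_le _ _) ?_)
  refine norm_integral_le_of_norm_le
    ((hint.mono_set (Ioc_subset_Ioc_right ht.2)).const_mul L) ?_
  filter_upwards [ae_restrict_of_ae_restrict_of_subset (Ioc_subset_Ioc_right ht.2) hc]
    with s ⟨h1, h2, h3, h4⟩
  rw [← map_sub]
  refine (G.semigroup.norm_evol_apply_le _ _).trans ?_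
  rw [drift, drift, h1, h2, h3, h4]
  exact hG.lipschitz_f _ _ _ _ _ _

/-- The stability estimate with equal initial states. It gives uniqueness, and also causality: the
state up to time T depends only on the controls up to T. -/
theorem eqOn_of_isMildSolution {x : E} {p p' : G.C1} {q q' : G.C2} {y y' : ℝ → E}
    (hy : G.IsMildSolution x p q y) (hy' : G.IsMildSolution x p' q' y') {T : ℝ}
    (hc : ∀ᵐ s ∂volume.restrict (Ioc 0 T), SameValues p p' q q' s)
    (hI : ∀ t ∈ Icc 0 T, G.impulseSum q.2.2 t = G.impulseSum q'.2.2 t) : EqOn y y' (Icc 0 T) := by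
  intro t ht
  have := hG.norm_sub_le_of_isMildSolution hy hy' hc hI t ht
  simp only [sub_self, norm_zero, mul_zero, zero_mul] at this
  exact sub_eq_zero.1 (norm_le_zero_iff.1 this)

/-- By the semigroup law, everything that happened before t factors through S(s) applied to the
state at t. The restart state is `preState` rather than y(t), because the cut m may separate
impulses made at the same time t: those left to the future reappear at time 0 of the restarted game.
-/
theorem isMildSolution_shift {x : E} {p p' : G.C1} {q q' : G.C2} {y : ℝ → E} {t : ℝ} (ht : 0 ≤ t)
    {n₁ n₂ m : ℕ} (hy : G.IsMildSolution x p q y) (hu₁ : ∀ s, 0 ≤ s → p'.1.1 s = p.1.1 (t + s))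
    (hu₂ : ∀ s, 0 ≤ s → q'.1.1 s = q.1.1 (t + s)) (hd₁ : p.2.IsShift t n₁ p'.2)
    (hd₂ : q.2.1.IsShift t n₂ q'.2.1) (hξ : q.2.2.IsShift t m q'.2.2) :
    G.IsMildSolution (G.preState x p q y t m) p' q' (fun s => y (t + s)) := by
  obtain ⟨hym, hy⟩ := G.isMildSolution_iff.1 hy
  refine G.isMildSolution_iff.2 ⟨?_, fun s hs => ?_⟩
  · have h1 := (measurePreserving_add_left volume t).restrict_preimage (s := Ici t) measurableSet_Ici
    have h2 : (t + ·) ⁻¹' Ici t = Ici (0 : ℝ) := by ext; simp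
    rw [h2] at h1
    exact (hym.mono_set (Ici_subset_Ici.2 ht)).comp_quasiMeasurePreserving
      h1.quasiMeasurePreserving
  have hI : G.impulseSum q.2.2 (t + s) = G.semigroup.evol s (∑ j ∈ Finset.range m,
      G.semigroup.evol (t - (q.2.2.time j).toReal) (q.2.2.vec j : E)) + G.impulseSum q'.2.2 s := by
    rw [impulseSum, ← (G.summable_impulse q.2.2 (t + s)).sum_add_tsum_nat_add m, map_sum]
    congr 1
    · refine Finset.sum_congr rfl fun j hj => ?_
      have h1 := hξ.le j (Finset.mem_range.1 hj)
      rw [if_pos (h1.trans (ENNReal.ofReal_le_ofReal (by linarith))), ← G.semigroup.evol_add hs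
        (sub_nonneg.2 (toReal_le_of_le_ofReal ht h1))]
      congr 2
      ring
    · refine tsum_congr fun j => ?_
      rw [add_comm j, hξ.time, hξ.vec]
      simp only [ofReal_add_le_ofReal_add ht hs]
      split_ifs with h
      · rw [ENNReal.toReal_add ENNReal.ofReal_ne_top (h.trans_lt ENNReal.ofReal_lt_top).ne,
          ENNReal.toReal_ofReal ht, add_sub_add_left_eq_sub]
      · rfl
  have hint : ∫ r in Ioc 0 (t + s), G.semigroup.evol (t + s - r) (G.drift p q y r)
      = G.semigroup.evol s (∫ r in Ioc 0 t, G.semigroup.evol (t - r) (G.drift p q y r))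
        + ∫ r in Ioc 0 s, G.semigroup.evol (s - r) (G.drift p' q' (fun s => y (t + s)) r) := by
    rw [← Ioc_union_Ioc_eq_Ioc ht (by linarith : t ≤ t + s),
      setIntegral_union (Ioc_disjoint_Ioc_of_le le_rfl) measurableSet_Ioc
        (hG.integrableOn_drift hym le_rfl _ _) (hG.integrableOn_drift hym ht _ _),
      ← ContinuousLinearMap.integral_comp_comm _ (hG.integrableOn_drift hym le_rfl _ _)]
    congr 1
    · refine setIntegral_congr_fun measurableSet_Ioc fun r hr => ?_
      rw [← G.semigroup.evol_add hs (sub_nonneg.2 hr.2)]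
      congr 2
      ring
    · rw [← intervalIntegral.integral_of_le (by linarith), ← intervalIntegral.integral_of_le hs]
      have h1 := intervalIntegral.integral_comp_add_left (a := 0) (b := s)
        (fun r => G.semigroup.evol (t + s - r) (G.drift p q y r)) t
      rw [add_zero] at h1
      rw [← h1, intervalIntegral.integral_of_le hs, intervalIntegral.integral_of_le hs]
      refine setIntegral_congr_fun measurableSet_Ioc fun r hr => ?_
      rw [add_sub_add_left_eq_sub]
      congr 1
      exact drift_eq_of_sameValues (hu₁ r hr.1.le).symm (hd₁.val_eq ht hr.1.le)
        (hu₂ r hr.1.le).symm (hd₂.val_eq ht hr.1.le) rfl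
  rw [hy _ (add_nonneg ht hs), hI, hint, add_comm t s, G.semigroup.evol_add hs ht, preState,
    map_add, map_add]
  abel

end Regular

end HybridGame

/-! ### Splitting the cost at an intermediate time -/

theorem EReal.coe_ofReal_of_nonneg {x : ℝ} (hx : 0 ≤ x) :
    ((ENNReal.ofReal x : ℝ≥0∞) : EReal) = (x : EReal) := by
  rw [EReal.coe_ennreal_ofReal, max_eq_left hx]

theorem ENNReal.exists_eq_ofReal {x : ℝ≥0∞} (hx : x ≠ ⊤) : ∃ r, 0 ≤ r ∧ x = ENNReal.ofReal r :=
  ⟨x.toReal, ENNReal.toReal_nonneg, (ENNReal.ofReal_toReal hx).symm⟩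

/-- Distributivity fails in general in `EReal`. Here a finite past and a positive factor e do not
change which of A and C is infinite, and C = ∞ gives -∞ on both sides whatever A is. -/
theorem EReal.add_sub_affine {R R' a c e : ℝ} (ha : 0 ≤ a) (hc : 0 ≤ c) (he : 0 < e)
    (A C : ℝ≥0∞) : ((R + e * R' : ℝ) : EReal) + ((ENNReal.ofReal a + ENNReal.ofReal e * A : ℝ≥0∞) : EReal)
      - ((ENNReal.ofReal c + ENNReal.ofReal e * C : ℝ≥0∞) : EReal)
      = ((R + a - c : ℝ) : EReal) + (e : EReal) * ((R' : EReal) + (A : EReal) - (C : EReal)) := by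
  have he' : ENNReal.ofReal e ≠ 0 := by simpa using he
  by_cases hC : C = ⊤
  · rw [hC, ENNReal.mul_top he', add_top, EReal.coe_ennreal_top, EReal.sub_top, EReal.sub_top,
      EReal.coe_mul_bot_of_pos he, EReal.add_bot]
  obtain ⟨c', hc', rfl⟩ := ENNReal.exists_eq_ofReal hC
  by_cases hA : A = ⊤
  · rw [hA, ENNReal.mul_top he', add_top, EReal.coe_ennreal_top, ← ENNReal.ofReal_mul he.le,
      ← ENNReal.ofReal_add hc (by positivity), EReal.coe_ofReal_of_nonneg (by positivity),
      EReal.coe_ofReal_of_nonneg hc', EReal.coe_add_top, EReal.coe_add_top, EReal.top_sub_coe,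
      EReal.top_sub_coe, EReal.coe_mul_top_of_pos he, EReal.coe_add_top]
  obtain ⟨a', ha', rfl⟩ := ENNReal.exists_eq_ofReal hA
  rw [← ENNReal.ofReal_mul he.le, ← ENNReal.ofReal_mul he.le,
    ← ENNReal.ofReal_add hc (by positivity), ← ENNReal.ofReal_add ha (by positivity),
    EReal.coe_ofReal_of_nonneg (by positivity), EReal.coe_ofReal_of_nonneg (by positivity),
    EReal.coe_ofReal_of_nonneg ha', EReal.coe_ofReal_of_nonneg hc']
  norm_cast
  ring

theorem discountFactor_ofReal_add (lam : ℝ) {t : ℝ} (ht : 0 ≤ t) (a : ℝ≥0∞) :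
    discountFactor lam (ENNReal.ofReal t + a)
      = ENNReal.ofReal (Real.exp (-lam * t)) * discountFactor lam a := by
  by_cases ha : a = ⊤
  · simp [ha, discountFactor]
  · rw [discountFactor, discountFactor, if_neg ha, if_neg (by simp [ha]),
      ENNReal.toReal_add ENNReal.ofReal_ne_top ha, ENNReal.toReal_ofReal ht, mul_add, Real.exp_add,
      ENNReal.ofReal_mul (Real.exp_pos _).le]

theorem discountFactor_of_ne_top (lam : ℝ) {a : ℝ≥0∞} (ha : a ≠ ⊤) :
    discountFactor lam a = ENNReal.ofReal (Real.exp (-lam * a.toReal)) := if_neg ha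

/-- The discounted cost of the first `n` switches. -/
def SwitchingControl.partialCost {D : Type*} (lam : ℝ) (c : D → D → ℝ) (d : SwitchingControl D)
    (n : ℕ) : ℝ :=
  ∑ j ∈ Finset.range n, Real.exp (-lam * (d.time (j + 1)).toReal) * c (d.mode j) (d.mode (j + 1))

theorem SwitchingControl.partialCost_nonneg {D : Type*} (lam : ℝ) {c : D → D → ℝ}
    (hc : ∀ d d', 0 ≤ c d d') (d : SwitchingControl D) (n : ℕ) : 0 ≤ d.partialCost lam c n :=
  Finset.sum_nonneg fun _ _ => mul_nonneg (Real.exp_pos _).le (hc _ _)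

theorem SwitchingControl.IsShift.tsum_cost {D : Type*} {lam : ℝ} {c : D → D → ℝ}
    (hc : ∀ d d', 0 ≤ c d d') {t : ℝ} (ht : 0 ≤ t) {n : ℕ} {d d' : SwitchingControl D}
    (h : d.IsShift t n d') :
    ∑' j : ℕ, discountFactor lam (d.time (j + 1)) *
        ENNReal.ofReal (c (d.mode j) (d.mode (j + 1)))
      = ENNReal.ofReal (d.partialCost lam c n) + ENNReal.ofReal (Real.exp (-lam * t)) *
        ∑' j : ℕ, discountFactor lam (d'.time (j + 1)) *
          ENNReal.ofReal (c (d'.mode j) (d'.mode (j + 1))) := by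
  rw [← Summable.sum_add_tsum_nat_add' (k := n) ENNReal.summable, SwitchingControl.partialCost,
    ENNReal.ofReal_sum_of_nonneg fun _ _ => mul_nonneg (Real.exp_pos _).le (hc _ _),
    ← ENNReal.tsum_mul_left]
  congr 1
  · refine Finset.sum_congr rfl fun j hj => ?_
    have hfin : d.time (j + 1) ≠ ⊤ := ((d.time_mono (Finset.mem_range.1 hj)).trans_lt
      (h.le.trans_lt ENNReal.ofReal_lt_top)).ne
    rw [discountFactor_of_ne_top _ hfin, ENNReal.ofReal_mul (Real.exp_pos _).le]
  · refine tsum_congr fun j => ?_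
    rw [add_comm j n, h.time, discountFactor_ofReal_add _ ht, h.mode, h.mode, mul_assoc]
    rfl

namespace HybridGame

variable {E U₁ U₂ D₁ D₂ : Type*} [NormedAddCommGroup E] [InnerProductSpace ℝ E]
  {G : HybridGame E U₁ U₂ D₁ D₂}

variable (G) in
/-- The discounted cost of the first `m` impulses. -/
def partialImpulseCost (ξ : ImpulseControl G.K) (m : ℕ) : ℝ :=
  ∑ j ∈ Finset.range m, Real.exp (-G.lam * (ξ.time j).toReal) * G.l (ξ.vec j)

theorem partialImpulseCost_nonneg (hl : ∀ ξ, 0 ≤ G.l ξ) (ξ : ImpulseControl G.K) (m : ℕ) :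
    0 ≤ G.partialImpulseCost ξ m :=
  Finset.sum_nonneg fun _ _ => mul_nonneg (Real.exp_pos _).le (hl _)

theorem impulseCost_of_isShift (hl : ∀ ξ, 0 ≤ G.l ξ) {t : ℝ} (ht : 0 ≤ t) {m : ℕ}
    {ξ ξ' : ImpulseControl G.K} (h : ξ.IsShift t m ξ') : G.impulseCost ξ
      = ENNReal.ofReal (G.partialImpulseCost ξ m)
        + ENNReal.ofReal (Real.exp (-G.lam * t)) * G.impulseCost ξ' := by
  rw [impulseCost, ← Summable.sum_add_tsum_nat_add' (k := m) ENNReal.summable, partialImpulseCost,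
    ENNReal.ofReal_sum_of_nonneg fun _ _ => mul_nonneg (Real.exp_pos _).le (hl _), impulseCost,
    ← ENNReal.tsum_mul_left]
  congr 1
  · refine Finset.sum_congr rfl fun j hj => ?_
    have hfin : ξ.time j ≠ ⊤ :=
      ((h.le j (Finset.mem_range.1 hj)).trans_lt ENNReal.ofReal_lt_top).ne
    rw [discountFactor_of_ne_top _ hfin, ENNReal.ofReal_mul (Real.exp_pos _).le]
  · refine tsum_congr fun j => ?_
    rw [add_comm j m, h.time, discountFactor_ofReal_add _ ht, h.vec, mul_assoc]

/-- The control `p'` of player 1 is `p` seen from time `t` on, after `n` switches. -/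
structure IsShift1 [MeasurableSpace U₁] (t : ℝ) (n : ℕ) (p p' : G.C1) : Prop where
  cont : ∀ s, 0 ≤ s → p'.1.1 s = p.1.1 (t + s)
  switch : p.2.IsShift t n p'.2

/-- The control `q'` of player 2 is `q` seen from time `t` on, after `n` switches and `m`
impulses. -/
structure IsShift2 [MeasurableSpace U₂] (t : ℝ) (n m : ℕ) (q q' : G.C2) : Prop where
  cont : ∀ s, 0 ≤ s → q'.1.1 s = q.1.1 (t + s)
  switch : q.2.1.IsShift t n q'.2.1
  impulse : q.2.2.IsShift t m q'.2.2

end HybridGame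

namespace HybridGame

variable {E U₁ U₂ D₁ D₂ : Type*} [NormedAddCommGroup E] [InnerProductSpace ℝ E] [CompleteSpace E]
  [MetricSpace U₁] [CompactSpace U₁] [MeasurableSpace U₁] [BorelSpace U₁]
  [MetricSpace U₂] [CompactSpace U₂] [MeasurableSpace U₂] [BorelSpace U₂]
  {G : HybridGame E U₁ U₂ D₁ D₂} {F K L : ℝ}

variable (G) in
/-- The discounted running cost up to time `t`. -/
def runCost (x : E) (p : G.C1) (q : G.C2) (t : ℝ) : ℝ :=
  ∫ s in Ioc 0 t, Real.exp (-G.lam * s) * G.rate p q (G.state x p q) s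

variable (G) in
/-- The total discounted running cost. -/
def totalRunCost (x : E) (p : G.C1) (q : G.C2) : ℝ :=
  ∫ s in Ioi (0 : ℝ), Real.exp (-G.lam * s) * G.rate p q (G.state x p q) s

theorem J_eq (x : E) (p : G.C1) (q : G.C2) : G.J x p q = (G.totalRunCost x p q : EReal)
    + ((G.switchCost2 q.2.1 + G.impulseCost q.2.2 : ℝ≥0∞) : EReal)
    - ((G.switchCost1 p.2 : ℝ≥0∞) : EReal) := rfl

theorem integrableOn_discount (t : ℝ) :
    IntegrableOn (fun s => Real.exp (-G.lam * s)) (Ioi t) :=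
  integrableOn_exp_mul_Ioi (neg_lt_zero.2 G.lam_pos) t

namespace Regular

variable (hG : G.Regular F K L)
include hG

theorem abs_rate_le (p : G.C1) (q : G.C2) (y : ℝ → E) (s : ℝ) : |G.rate p q y s| ≤ K := by
  rw [rate, abs_of_nonneg (hG.k_nonneg _ _ _ _ _)]
  exact hG.k_le _ _ _ _ _

theorem rate_nonneg (p : G.C1) (q : G.C2) (y : ℝ → E) (s : ℝ) : 0 ≤ G.rate p q y s :=
  hG.k_nonneg _ _ _ _ _

theorem integrableOn_discount_rate (x : E) (p : G.C1) (q : G.C2) :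
    IntegrableOn (fun s => Real.exp (-G.lam * s) * G.rate p q (G.state x p q) s) (Ioi 0) := by
  refine Integrable.mul_bdd (c := K) (integrableOn_discount 0) ?_
    (Eventually.of_forall fun s => hG.abs_rate_le p q _ s)
  exact hG.aestronglyMeasurable_rate
    ((hG.isMildSolution_state x p q).1.mono_set Ioi_subset_Ici_self) p q

theorem runCost_nonneg (x : E) (p : G.C1) (q : G.C2) (t : ℝ) : 0 ≤ G.runCost x p q t :=
  integral_nonneg fun _ => mul_nonneg (Real.exp_pos _).le (hG.rate_nonneg _ _ _ _)

theorem runCost_le (x : E) (p : G.C1) (q : G.C2) {t : ℝ} (ht : 0 ≤ t) :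
    G.runCost x p q t ≤ K * t := by
  have := norm_setIntegral_le_of_norm_le_const (μ := volume) (s := Ioc (0 : ℝ) t) (C := K)
    (f := fun s => Real.exp (-G.lam * s) * G.rate p q (G.state x p q) s) (by simp) fun s hs => by
      rw [norm_mul, Real.norm_of_nonneg (Real.exp_pos _).le]
      calc _ ≤ 1 * K := mul_le_mul (exp_neg_mul_le_one G.lam_pos.le hs.1.le)
            (hG.abs_rate_le _ _ _ _) (abs_nonneg _) zero_le_one
        _ = K := one_mul _
  rw [volume_real_Ioc_zero ht] at this
  exact (le_abs_self _).trans this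

theorem totalRunCost_nonneg (x : E) (p : G.C1) (q : G.C2) : 0 ≤ G.totalRunCost x p q :=
  integral_nonneg fun _ => mul_nonneg (Real.exp_pos _).le (hG.rate_nonneg _ _ _ _)

theorem totalRunCost_le (x : E) (p : G.C1) (q : G.C2) : G.totalRunCost x p q ≤ K / G.lam := by
  have h1 : G.totalRunCost x p q ≤ ∫ s in Ioi (0 : ℝ), K * Real.exp (-G.lam * s) := by
    refine setIntegral_mono (hG.integrableOn_discount_rate x p q)
      ((integrableOn_discount 0).const_mul K) fun s => ?_
    dsimp only
    rw [mul_comm]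
    exact mul_le_mul_of_nonneg_right (hG.k_le _ _ _ _ _) (Real.exp_pos _).le
  rw [integral_const_mul, integral_exp_mul_Ioi (neg_lt_zero.2 G.lam_pos)] at h1
  simpa [div_eq_mul_inv] using h1

theorem state_shift {x : E} {p p' : G.C1} {q q' : G.C2} {t : ℝ} (ht : 0 ≤ t) {n₁ n₂ m : ℕ}
    (hp : IsShift1 t n₁ p p') (hq : IsShift2 t n₂ m q q') {s : ℝ} (hs : 0 ≤ s) :
    G.state (G.preState x p q (G.state x p q) t m) p' q' s = G.state x p q (t + s) :=
  (hG.eqOn_of_isMildSolution (T := s) (hG.isMildSolution_state _ p' q')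
    (hG.isMildSolution_shift ht (hG.isMildSolution_state x p q) hp.cont hq.cont hp.switch
      hq.switch hq.impulse) (Eventually.of_forall fun _ => ⟨rfl, rfl, rfl, rfl⟩)
      fun _ _ => rfl) ⟨hs, le_rfl⟩

/-- The cost splits at time `t` into the cost up to time `t` and the discounted cost of the game
restarted at time `t`. -/
theorem J_eq_of_isShift {x : E} {p p' : G.C1} {q q' : G.C2} {t : ℝ} (ht : 0 ≤ t) {n₁ n₂ m : ℕ}
    (hp : IsShift1 t n₁ p p') (hq : IsShift2 t n₂ m q q') :
    G.J x p q = ((G.runCost x p q t + (q.2.1.partialCost G.lam G.c₂ n₂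
        + G.partialImpulseCost q.2.2 m) - p.2.partialCost G.lam G.c₁ n₁ : ℝ) : EReal)
      + (Real.exp (-G.lam * t) : EReal)
        * G.J (G.preState x p q (G.state x p q) t m) p' q' := by
  set z := G.preState x p q (G.state x p q) t m
  have hrun : G.totalRunCost x p q
      = G.runCost x p q t + Real.exp (-G.lam * t) * G.totalRunCost z p' q' := by
    have hi := hG.integrableOn_discount_rate x p q
    rw [totalRunCost, ← Ioc_union_Ioi_eq_Ioi ht, setIntegral_union (Ioc_disjoint_Ioi le_rfl)
      measurableSet_Ioi (hi.mono_set Ioc_subset_Ioi_self) (hi.mono_set (Ioi_subset_Ioi ht)),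
      runCost, totalRunCost, ← integral_const_mul]
    congr 1
    rw [← (measurePreserving_add_left volume t).setIntegral_preimage_emb
      (measurableEmbedding_addLeft t), show (t + ·) ⁻¹' Ioi t = Ioi (0 : ℝ) by ext; simp]
    refine setIntegral_congr_fun measurableSet_Ioi fun s hs => ?_
    have hs : 0 ≤ s := le_of_lt hs
    rw [mul_add, Real.exp_add, mul_assoc]
    congr 2
    exact rate_eq_of_sameValues (hp.cont s hs).symm (hp.switch.val_eq ht hs) (hq.cont s hs).symm
      (hq.switch.val_eq ht hs) (hG.state_shift ht hp hq hs).symm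
  have h1 : G.switchCost1 p.2 = _ := hp.switch.tsum_cost (lam := G.lam) hG.c₁_nonneg ht
  have h2 : G.switchCost2 q.2.1 = _ := hq.switch.tsum_cost (lam := G.lam) hG.c₂_nonneg ht
  have h3 := impulseCost_of_isShift hG.l_nonneg ht hq.impulse
  rw [J_eq, J_eq, hrun, h1, h2, h3, add_add_add_comm, ← mul_add,
    ← ENNReal.ofReal_add (SwitchingControl.partialCost_nonneg _ hG.c₂_nonneg _ _)
      (partialImpulseCost_nonneg hG.l_nonneg _ _), EReal.add_sub_affine
      (add_nonneg (SwitchingControl.partialCost_nonneg _ hG.c₂_nonneg _ _)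
      (partialImpulseCost_nonneg hG.l_nonneg _ _))
      (SwitchingControl.partialCost_nonneg _ hG.c₁_nonneg _ _) (Real.exp_pos _)]
  rfl

/-- The running cost is uniformly continuous in the initial state, uniformly in the controls. -/
theorem exists_totalRunCost_sub_le {ε : ℝ} (hε : 0 < ε) : ∃ δ > 0, ∀ x x' : E, ‖x - x'‖ ≤ δ →
    ∀ (p : G.C1) (q : G.C2), G.totalRunCost x p q ≤ G.totalRunCost x' p q + ε := by
  have hlam := G.lam_pos
  -- After T discounting makes the running cost at most ε/2; before T the Gronwall constant is
  -- finite. The growth rate 2L may exceed λ, so this route gives uniform rather than Lipschitz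
  -- continuity.
  obtain ⟨T, hT0, hT⟩ : ∃ T, 0 ≤ T ∧ K * (Real.exp (-G.lam * T) / G.lam) ≤ ε / 2 := by
    have h1 : Tendsto (fun T => K * (Real.exp (-G.lam * T) / G.lam)) atTop (𝓝 (K * (0 / G.lam))) :=
      (((Real.tendsto_exp_atBot.comp ((tendsto_const_mul_atBot_of_neg
        (neg_lt_zero.2 hlam)).2 tendsto_id))).div_const _).const_mul _
    rw [zero_div, mul_zero] at h1
    obtain ⟨T, h2, h3⟩ := ((h1.eventually (ge_mem_nhds (half_pos hε))).and
      (eventually_ge_atTop 0)).exists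
    exact ⟨T, h3, h2⟩
  set B := L * (2 * Real.exp (2 * L * T)) * T
  have hL := hG.L_pos
  have hB : 0 ≤ B := by positivity
  refine ⟨ε / (2 * (B + 1)), by positivity, fun x x' hx p q => ?_⟩
  have hi := hG.integrableOn_discount_rate x p q
  have hi' := hG.integrableOn_discount_rate x' p q
  set h := fun s => Real.exp (-G.lam * s) * G.rate p q (G.state x p q) s
  set h' := fun s => Real.exp (-G.lam * s) * G.rate p q (G.state x' p q) s
  have hfst : ∫ s in Ioc 0 T, (h s - h' s) ≤ ε / 2 := by
    have h1 := norm_setIntegral_le_of_norm_le_const (μ := volume) (s := Ioc (0 : ℝ) T)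
      (C := L * (2 * ‖x - x'‖ * Real.exp (2 * L * T))) (f := fun s => h s - h' s) (by simp)
      fun s hs => by
        have h2 := hG.norm_sub_le_of_isMildSolution (T := T) (hG.isMildSolution_state x p q)
          (hG.isMildSolution_state x' p q) (Eventually.of_forall fun _ => ⟨rfl, rfl, rfl, rfl⟩)
          (fun _ _ => rfl) s ⟨hs.1.le, hs.2⟩
        have h3 : Real.exp (2 * L * s) ≤ Real.exp (2 * L * T) := by
          have := hs.2
          gcongr
        simp only [h, h']
        rw [← mul_sub, norm_mul, Real.norm_of_nonneg (Real.exp_pos _).le]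
        calc _ ≤ 1 * (L * ‖G.state x p q s - G.state x' p q s‖) :=
              mul_le_mul (exp_neg_mul_le_one hlam.le hs.1.le) (hG.lipschitz_k _ _ _ _ _ _)
                (abs_nonneg _) zero_le_one
          _ ≤ L * (2 * ‖x - x'‖ * Real.exp (2 * L * T)) := by
              rw [one_mul]
              refine mul_le_mul_of_nonneg_left (h2.trans ?_) hL.le
              gcongr
    rw [volume_real_Ioc_zero hT0] at h1
    refine (le_abs_self _).trans (h1.trans ?_)
    have h4 : L * (2 * ‖x - x'‖ * Real.exp (2 * L * T)) * T = B * ‖x - x'‖ := by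
      simp only [B]; ring
    rw [h4]
    rw [le_div_iff₀ (by positivity)] at hx
    nlinarith [norm_nonneg (x - x')]
  have hsnd : ∫ s in Ioi T, (h s - h' s) ≤ ε / 2 := by
    have h1 : ∫ s in Ioi T, (h s - h' s) ≤ ∫ s in Ioi T, K * Real.exp (-G.lam * s) := by
      refine setIntegral_mono ((hi.sub hi').mono_set (Ioi_subset_Ioi hT0))
        ((integrableOn_discount T).const_mul K) fun s => ?_
      simp only [h, h']
      rw [← mul_sub, mul_comm]
      refine mul_le_mul_of_nonneg_right ?_ (Real.exp_pos _).le
      have h1 := hG.rate_nonneg p q (G.state x' p q) s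
      have h2 := hG.abs_rate_le p q (G.state x p q) s
      linarith [(abs_le.1 h2).2]
    rw [integral_const_mul, integral_exp_mul_Ioi (neg_lt_zero.2 hlam)] at h1
    refine h1.trans ?_
    rwa [neg_div_neg_eq]
  have hsub : G.totalRunCost x p q - G.totalRunCost x' p q
      = (∫ s in Ioc 0 T, (h s - h' s)) + ∫ s in Ioi T, (h s - h' s) := by
    have hd : IntegrableOn (fun s => h s - h' s) (Ioi 0) := hi.sub hi'
    rw [← setIntegral_union (Ioc_disjoint_Ioi le_rfl) measurableSet_Ioi
      (hd.mono_set Ioc_subset_Ioi_self) (hd.mono_set (Ioi_subset_Ioi hT0)),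
      Ioc_union_Ioi_eq_Ioi hT0, integral_sub hi hi']
    rfl
  linarith

end Regular

end HybridGame

theorem EReal.affine_le {a e s : ℝ} {z : EReal} (he : 0 ≤ e) (h : z ≤ (s : EReal)) :
    (a : EReal) + (e : EReal) * z ≤ ((a + e * s : ℝ) : EReal) := by
  rw [EReal.coe_add, EReal.coe_mul]
  gcongr

theorem EReal.le_affine {a e s : ℝ} {z : EReal} (he : 0 ≤ e) (h : (s : EReal) ≤ z) :
    ((a + e * s : ℝ) : EReal) ≤ (a : EReal) + (e : EReal) * z := by
  rw [EReal.coe_add, EReal.coe_mul]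
  gcongr

theorem SwitchingControl.isShift_zero {D : Type*} (d : SwitchingControl D) : d.IsShift 0 0 d where
  le := by simp [d.time_zero]
  mode := by simp
  time := by simp

theorem ImpulseControl.isShift_zero {E : Type*} {K : Set E} (ξ : ImpulseControl K) :
    ξ.IsShift 0 0 ξ where
  le := by simp
  vec := by simp
  time := by simp

/-! ### Finiteness, uniform continuity and obstacle inequalities of the values -/

namespace HybridGame

variable {E U₁ U₂ D₁ D₂ : Type*} [NormedAddCommGroup E] [InnerProductSpace ℝ E] [CompleteSpace E]
  [MetricSpace U₁] [CompactSpace U₁] [MeasurableSpace U₁] [BorelSpace U₁]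
  [MetricSpace U₂] [CompactSpace U₂] [MeasurableSpace U₂] [BorelSpace U₂]
  {G : HybridGame E U₁ U₂ D₁ D₂} {F K L : ℝ}

theorem isShift1_zero (p : G.C1) : IsShift1 0 0 p p := ⟨by simp, p.2.isShift_zero⟩

theorem isShift2_zero (q : G.C2) : IsShift2 0 0 0 q q :=
  ⟨by simp, q.2.1.isShift_zero, q.2.2.isShift_zero⟩

variable (G) in
/-- Functions with a common modulus of continuity that obey the obstacle constraints of the
quasivariational inequalities. -/
structure ObeysObstacles (V : D₁ → D₂ → E → ℝ) : Prop where
  modulus : ∀ ε > 0, ∃ δ > 0, ∀ d₁ d₂ x x', ‖x - x'‖ ≤ δ → V d₁ d₂ x ≤ V d₁ d₂ x' + ε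
  nonneg : ∀ d₁ d₂ x, 0 ≤ V d₁ d₂ x
  ge_switch₁ : ∀ d₁ d₂ x d', d₁ ≠ d' → V d' d₂ x - G.c₁ d₁ d' ≤ V d₁ d₂ x
  le_switch₂ : ∀ d₁ d₂ x d', d₂ ≠ d' → V d₁ d₂ x ≤ V d₁ d' x + G.c₂ d₂ d'
  le_impulse : ∀ d₁ d₂ x (ξ : G.K), V d₁ d₂ x ≤ V d₁ d₂ (x + ξ) + G.l ξ

theorem switchCost1_const (d : D₁) : G.switchCost1 (SwitchingControl.const d) = 0 := by
  simp [switchCost1, SwitchingControl.const, discountFactor]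

theorem switchCost2_const (d : D₂) : G.switchCost2 (SwitchingControl.const d) = 0 := by
  simp [switchCost2, SwitchingControl.const, discountFactor]

theorem impulseCost_none (v : G.K) : G.impulseCost (ImpulseControl.none v) = 0 := by
  simp [impulseCost, ImpulseControl.none, discountFactor]

namespace Regular

variable (hG : G.Regular F K L)
include hG

theorem preState_zero_zero (x : E) (p : G.C1) (q : G.C2) (y : ℝ → E) :
    G.preState x p q y 0 0 = x := by
  simp [preState, ContractionSemigroup.evol_zero]

/-- The splitting of the cost at time 0 after a single switch. The factor 1 is the discount over no
time, kept so that `EReal.le_affine` applies. -/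
theorem J_switch₁ (x : E) (p : G.C1) (q : G.C2) {a : D₁} (h : a ≠ p.2.mode 0) :
    G.J x (p.1, p.2.cons a h) q
      = ((-G.c₁ a (p.2.mode 0) : ℝ) : EReal) + ((1 : ℝ) : EReal) * G.J x p q := by
  have h1 : IsShift1 0 1 ((p.1, p.2.cons a h) : G.C1) p :=
    ⟨by simp, SwitchingControl.isShift_cons a p.2 h⟩
  rw [hG.J_eq_of_isShift le_rfl h1 (isShift2_zero q), hG.preState_zero_zero]
  simp [runCost, partialImpulseCost, SwitchingControl.partialCost, SwitchingControl.cons,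
    p.2.time_zero]

theorem J_switch₂ (x : E) (p : G.C1) (q : G.C2) {a : D₂} (h : a ≠ q.2.1.mode 0) :
    G.J x p (q.1, q.2.1.cons a h, q.2.2)
      = ((G.c₂ a (q.2.1.mode 0) : ℝ) : EReal) + ((1 : ℝ) : EReal) * G.J x p q := by
  have h1 : IsShift2 0 1 0 ((q.1, q.2.1.cons a h, q.2.2) : G.C2) q :=
    ⟨by simp, SwitchingControl.isShift_cons a q.2.1 h, q.2.2.isShift_zero⟩
  rw [hG.J_eq_of_isShift le_rfl (isShift1_zero p) h1, hG.preState_zero_zero]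
  simp [runCost, partialImpulseCost, SwitchingControl.partialCost, SwitchingControl.cons,
    q.2.1.time_zero]

theorem J_impulse (x : E) (p : G.C1) (q : G.C2) (ξ : G.K) :
    G.J x p (q.1, q.2.1, q.2.2.cons ξ)
      = ((G.l ξ : ℝ) : EReal) + ((1 : ℝ) : EReal) * G.J (x + ξ) p q := by
  have h1 : IsShift2 0 0 1 ((q.1, q.2.1, q.2.2.cons ξ) : G.C2) q :=
    ⟨by simp, q.2.1.isShift_zero, ImpulseControl.isShift_cons ξ q.2.2⟩
  rw [hG.J_eq_of_isShift le_rfl (isShift1_zero p) h1]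
  simp [preState, runCost, partialImpulseCost, SwitchingControl.partialCost, ImpulseControl.cons,
    ContractionSemigroup.evol_zero]

/-- Intervention costs do not depend on the state, so for fixed controls a comparison of running
costs carries over to J, even when these costs are infinite. -/
theorem J_le_of_le {x x' : E} {p : G.C1} {q : G.C2} {r ε : ℝ}
    (h : G.totalRunCost x p q ≤ G.totalRunCost x' p q + ε) (hr : G.J x' p q ≤ (r : EReal)) :
    G.J x p q ≤ ((r + ε : ℝ) : EReal) := by
  rw [J_eq, sub_eq_add_neg, add_assoc] at *
  calc _ ≤ ((G.totalRunCost x' p q + ε : ℝ) : EReal) + _ :=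
        add_le_add (EReal.coe_le_coe_iff.2 h) le_rfl
    _ = (ε : EReal) + (((G.totalRunCost x' p q : ℝ) : EReal) + _) := by
        rw [add_comm (G.totalRunCost x' p q), EReal.coe_add, add_assoc]
    _ ≤ (ε : EReal) + (r : EReal) := by gcongr
    _ = _ := by rw [← EReal.coe_add, add_comm]

theorem J_nonneg_of_switchCost1 (x : E) {p : G.C1} (q : G.C2) (h : G.switchCost1 p.2 = 0) :
    0 ≤ G.J x p q := by
  rw [J_eq, h, EReal.coe_ennreal_zero, sub_zero]
  exact add_nonneg (EReal.coe_nonneg.2 (hG.totalRunCost_nonneg x p q)) (EReal.coe_ennreal_nonneg _)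

theorem J_le_of_cost₂ (x : E) (p : G.C1) {q : G.C2} (h : G.switchCost2 q.2.1 = 0)
    (h' : G.impulseCost q.2.2 = 0) : G.J x p q ≤ ((K / G.lam : ℝ) : EReal) := by
  rw [J_eq, h, h', add_zero, EReal.coe_ennreal_zero, add_zero]
  refine (EReal.sub_le_sub (EReal.coe_le_coe_iff.2 (hG.totalRunCost_le x p q))
    (EReal.coe_ennreal_nonneg _)).trans (by simp)

end Regular

section Lower

variable (G) in
/-- The lower value as a real number. -/
def lowerVal (d₁ : D₁) (d₂ : D₂) (x : E) : ℝ := (G.lowerValue d₁ d₂ x).toReal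

variable (G) in
/-- The upper value as a real number. -/
def upperVal (d₁ : D₁) (d₂ : D₂) (x : E) : ℝ := (G.upperValue d₁ d₂ x).toReal

theorem Agree2.symm {t : ℝ} {q q' : G.C2} (h : G.Agree2 t q q') : G.Agree2 t q' q :=
  ⟨h.1.symm, h.2.1.symm, h.2.2.symm⟩

theorem Agree1.mono {s t : ℝ} {p p' : G.C1} (h : G.Agree1 t p p') (hst : s ≤ t) :
    G.Agree1 s p p' := ⟨h.1.mono hst, h.2.mono hst⟩

theorem Agree2.mono {s t : ℝ} {q q' : G.C2} (h : G.Agree2 t q q') (hst : s ≤ t) :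
    G.Agree2 s q q' := ⟨h.1.mono hst, h.2.1.mono hst, h.2.2.mono hst⟩

theorem agree1_refl (t : ℝ) (p : G.C1) : G.Agree1 t p p :=
  ⟨Eventually.of_forall fun _ => rfl, fun _ _ => ⟨rfl, rfl⟩⟩

theorem agree2_refl (t : ℝ) (q : G.C2) : G.Agree2 t q q :=
  ⟨Eventually.of_forall fun _ => rfl, fun _ _ => ⟨rfl, rfl⟩, fun _ _ => ⟨rfl, rfl⟩⟩

variable (G) in
/-- The control of player 1 with constant continuous control and no switches. -/
def idle1 (a : U₁) (d : D₁) : G.C1 := (ContControl.const a, SwitchingControl.const d)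

variable (G) in
/-- The control of player 2 with constant continuous control and no switches or impulses. -/
def idle2 (a : U₂) (d : D₂) : G.C2 :=
  (ContControl.const a, SwitchingControl.const d, ImpulseControl.none ⟨_, G.K_nonempty.some_mem⟩)

namespace Regular

variable (hG : G.Regular F K L)
include hG

variable [Nonempty U₁] [Nonempty U₂]

theorem lowerValue_nonneg (d₁ : D₁) (d₂ : D₂) (x : E) : 0 ≤ G.lowerValue d₁ d₂ x :=
  le_iInf₂ fun _ _ => le_iSup₂_of_le (G.idle1 (Classical.arbitrary U₁) d₁)
    (show _ ∈ G.C1From d₁ from rfl) (hG.J_nonneg_of_switchCost1 x _ (switchCost1_const d₁))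

theorem upperValue_nonneg (d₁ : D₁) (d₂ : D₂) (x : E) : 0 ≤ G.upperValue d₁ d₂ x :=
  le_iSup₂_of_le (fun _ => G.idle1 (Classical.arbitrary U₁) d₁)
    (show _ ∈ G.Strategy1 d₁ from ⟨fun t _ _ _ _ => agree1_refl t _, fun _ => rfl⟩)
    (le_iInf₂ fun _ _ => hG.J_nonneg_of_switchCost1 x _ (switchCost1_const d₁))

/-- A player 2 who never intervenes keeps J below the discounted integral of the bound on k; a
player 1 who never switches keeps it nonnegative. -/
theorem coe_lowerVal (d₁ : D₁) (d₂ : D₂) (x : E) :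
    (G.lowerVal d₁ d₂ x : EReal) = G.lowerValue d₁ d₂ x := by
  have h1 : G.lowerValue d₁ d₂ x ≤ ((K / G.lam : ℝ) : EReal) :=
    iInf₂_le_of_le (fun _ => G.idle2 (Classical.arbitrary U₂) d₂)
      (show _ ∈ G.Strategy2 d₂ from ⟨fun t _ _ _ _ => agree2_refl t _, fun _ => rfl⟩)
      (iSup₂_le fun p _ => hG.J_le_of_cost₂ x p (switchCost2_const d₂) (impulseCost_none _))
  exact EReal.coe_toReal (h1.trans_lt (EReal.coe_lt_top _)).ne
    (EReal.bot_lt_zero.trans_le (hG.lowerValue_nonneg d₁ d₂ x)).ne'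

theorem coe_upperVal (d₁ : D₁) (d₂ : D₂) (x : E) :
    (G.upperVal d₁ d₂ x : EReal) = G.upperValue d₁ d₂ x := by
  have h1 : G.upperValue d₁ d₂ x ≤ ((K / G.lam : ℝ) : EReal) :=
    iSup₂_le fun α _ => iInf₂_le_of_le (G.idle2 (Classical.arbitrary U₂) d₂)
      (show _ ∈ G.C2From d₂ from rfl)
      (hG.J_le_of_cost₂ x _ (switchCost2_const d₂) (impulseCost_none _))
  exact EReal.coe_toReal (h1.trans_lt (EReal.coe_lt_top _)).ne
    (EReal.bot_lt_zero.trans_le (hG.upperValue_nonneg d₁ d₂ x)).ne'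

theorem lowerVal_nonneg (d₁ : D₁) (d₂ : D₂) (x : E) : 0 ≤ G.lowerVal d₁ d₂ x := by
  rw [← EReal.coe_nonneg, hG.coe_lowerVal]
  exact hG.lowerValue_nonneg d₁ d₂ x

theorem upperVal_nonneg (d₁ : D₁) (d₂ : D₂) (x : E) : 0 ≤ G.upperVal d₁ d₂ x := by
  rw [← EReal.coe_nonneg, hG.coe_upperVal]
  exact hG.upperValue_nonneg d₁ d₂ x

theorem exists_strategy2_J_le (d₁ : D₁) (d₂ : D₂) (x : E) {ε : ℝ} (hε : 0 < ε) :
    ∃ β ∈ G.Strategy2 d₂, ∀ p ∈ G.C1From d₁,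
      G.J x p (β p) ≤ ((G.lowerVal d₁ d₂ x + ε : ℝ) : EReal) := by
  have h : G.lowerValue d₁ d₂ x < ((G.lowerVal d₁ d₂ x + ε : ℝ) : EReal) := by
    rw [← hG.coe_lowerVal]
    exact EReal.coe_lt_coe_iff.2 (by linarith)
  simp only [lowerValue, iInf_lt_iff] at h
  obtain ⟨β, hβ, h⟩ := h
  exact ⟨β, hβ, fun p hp => (le_iSup₂ (f := fun p (_ : p ∈ G.C1From d₁) => G.J x p (β p)) p hp).trans
    h.le⟩

theorem exists_control1_le_J {d₁ : D₁} {d₂ : D₂} (x : E) {β : G.C1 → G.C2}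
    (hβ : β ∈ G.Strategy2 d₂) {ε : ℝ} (hε : 0 < ε) :
    ∃ p ∈ G.C1From d₁, ((G.lowerVal d₁ d₂ x - ε : ℝ) : EReal) ≤ G.J x p (β p) := by
  have h : ((G.lowerVal d₁ d₂ x - ε : ℝ) : EReal) < ⨆ p ∈ G.C1From d₁, G.J x p (β p) := by
    refine lt_of_lt_of_le ?_ (iInf₂_le (f := fun β (_ : β ∈ G.Strategy2 d₂) =>
      ⨆ p ∈ G.C1From d₁, G.J x p (β p)) β hβ)
    refine lt_of_lt_of_eq ?_ (hG.coe_lowerVal d₁ d₂ x)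
    exact EReal.coe_lt_coe_iff.2 (by linarith)
  simp only [lt_iSup_iff] at h
  obtain ⟨p, hp, h⟩ := h
  exact ⟨p, hp, h.le⟩

theorem exists_strategy1_le_J (d₁ : D₁) (d₂ : D₂) (x : E) {ε : ℝ} (hε : 0 < ε) :
    ∃ α ∈ G.Strategy1 d₁, ∀ q ∈ G.C2From d₂,
      ((G.upperVal d₁ d₂ x - ε : ℝ) : EReal) ≤ G.J x (α q) q := by
  have h : ((G.upperVal d₁ d₂ x - ε : ℝ) : EReal) < G.upperValue d₁ d₂ x := by
    rw [← hG.coe_upperVal]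
    exact EReal.coe_lt_coe_iff.2 (by linarith)
  simp only [upperValue, lt_iSup_iff] at h
  obtain ⟨α, hα, h⟩ := h
  exact ⟨α, hα, fun q hq => h.le.trans
    (iInf₂_le (f := fun q (_ : q ∈ G.C2From d₂) => G.J x (α q) q) q hq)⟩

theorem exists_control2_J_le {d₁ : D₁} {d₂ : D₂} (x : E) {α : G.C2 → G.C1}
    (hα : α ∈ G.Strategy1 d₁) {ε : ℝ} (hε : 0 < ε) :
    ∃ q ∈ G.C2From d₂, G.J x (α q) q ≤ ((G.upperVal d₁ d₂ x + ε : ℝ) : EReal) := by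
  have h : ⨅ q ∈ G.C2From d₂, G.J x (α q) q < ((G.upperVal d₁ d₂ x + ε : ℝ) : EReal) := by
    refine lt_of_le_of_lt (le_iSup₂ (f := fun α (_ : α ∈ G.Strategy1 d₁) =>
      ⨅ q ∈ G.C2From d₂, G.J x (α q) q) α hα) ?_
    refine lt_of_eq_of_lt (hG.coe_upperVal d₁ d₂ x).symm ?_
    exact EReal.coe_lt_coe_iff.2 (by linarith)
  simp only [iInf_lt_iff] at h
  obtain ⟨q, hq, h⟩ := h
  exact ⟨q, hq, h.le⟩

theorem lowerVal_le {d₁ : D₁} {d₂ : D₂} {x : E} {β : G.C1 → G.C2} (hβ : β ∈ G.Strategy2 d₂) {r : ℝ}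
    (h : ∀ p ∈ G.C1From d₁, G.J x p (β p) ≤ (r : EReal)) : G.lowerVal d₁ d₂ x ≤ r := by
  refine le_of_forall_pos_le_add fun ε hε => ?_
  obtain ⟨p, hp, h'⟩ := hG.exists_control1_le_J (d₁ := d₁) x hβ hε
  linarith [EReal.coe_le_coe_iff.1 (h'.trans (h p hp))]

theorem le_lowerVal {d₁ : D₁} {d₂ : D₂} {x : E} {r : ℝ}
    (h : ∀ β ∈ G.Strategy2 d₂, ∃ p ∈ G.C1From d₁, (r : EReal) ≤ G.J x p (β p)) :
    r ≤ G.lowerVal d₁ d₂ x := by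
  refine le_of_forall_pos_le_add fun ε hε => ?_
  obtain ⟨β, hβ, h'⟩ := hG.exists_strategy2_J_le d₁ d₂ x hε
  obtain ⟨p, hp, h⟩ := h β hβ
  exact EReal.coe_le_coe_iff.1 (h.trans (h' p hp))

theorem le_upperVal {d₁ : D₁} {d₂ : D₂} {x : E} {α : G.C2 → G.C1} (hα : α ∈ G.Strategy1 d₁) {r : ℝ}
    (h : ∀ q ∈ G.C2From d₂, (r : EReal) ≤ G.J x (α q) q) : r ≤ G.upperVal d₁ d₂ x := by
  refine le_of_forall_pos_le_add fun ε hε => ?_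
  obtain ⟨q, hq, h'⟩ := hG.exists_control2_J_le (d₂ := d₂) x hα hε
  exact EReal.coe_le_coe_iff.1 ((h q hq).trans h')

theorem upperVal_le {d₁ : D₁} {d₂ : D₂} {x : E} {r : ℝ}
    (h : ∀ α ∈ G.Strategy1 d₁, ∃ q ∈ G.C2From d₂, G.J x (α q) q ≤ (r : EReal)) :
    G.upperVal d₁ d₂ x ≤ r := by
  refine le_of_forall_pos_le_add fun ε hε => ?_
  obtain ⟨α, hα, h'⟩ := hG.exists_strategy1_le_J d₁ d₂ x hε
  obtain ⟨q, hq, h⟩ := h α hα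
  linarith [EReal.coe_le_coe_iff.1 ((h' q hq).trans h)]

/-- Continuity: the same strategy is used from the nearby state. Obstacles: an intervention at time
0 is prefixed to near-optimal play from the new mode or state. -/
theorem obeysObstacles_lowerVal : G.ObeysObstacles G.lowerVal where
  modulus ε hε := by
    obtain ⟨δ, hδ, h⟩ := hG.exists_totalRunCost_sub_le hε
    refine ⟨δ, hδ, fun d₁ d₂ x x' hx => le_of_forall_pos_le_add fun η hη => ?_⟩
    obtain ⟨β, hβ, hβ'⟩ := hG.exists_strategy2_J_le d₁ d₂ x' hη
    refine hG.lowerVal_le hβ fun p hp => ?_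
    refine (hG.J_le_of_le (h x x' hx p (β p)) (hβ' p hp)).trans_eq ?_
    rw [add_right_comm]
  nonneg := hG.lowerVal_nonneg
  ge_switch₁ d₁ d₂ x d' hd := by
    refine le_of_forall_pos_le_add fun ε hε => sub_le_iff_le_add.1 (hG.le_lowerVal fun β hβ => ?_)
    classical
    -- The strategy β is shown the control of player 1 with the switch out of d₁ prefixed. A control
    -- starting in d₁ admits no such prefix; its case is irrelevant, since only controls starting in
    -- d' are tested. Controls that agree share the initial mode, so the case distinction is
    -- nonanticipating.
    set β' : G.C1 → G.C2 := fun p => if h : d₁ ≠ p.2.mode 0 then β (p.1, p.2.cons d₁ h) else β p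
    have hβ' : β' ∈ G.Strategy2 d₂ := by
      refine ⟨fun t ht p p' hp => ?_, fun p => ?_⟩
      · have hm := hp.2.mode_zero
        by_cases h : d₁ ≠ p.2.mode 0
        · have h' : d₁ ≠ p'.2.mode 0 := hm ▸ h
          simp only [β', dif_pos h, dif_pos h']
          exact hβ.1 t ht _ _ ⟨hp.1, hp.2.cons h h'⟩
        · have h' : ¬ d₁ ≠ p'.2.mode 0 := hm ▸ h
          simp only [β', dif_neg h, dif_neg h']
          exact hβ.1 t ht _ _ hp
      · simp only [β']
        split_ifs
        · exact hβ.2 _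
        · exact hβ.2 _
    obtain ⟨p, hp, hJ⟩ := hG.exists_control1_le_J (d₁ := d') x hβ' hε
    have h : d₁ ≠ p.2.mode 0 := fun h => hd (h.trans hp)
    refine ⟨(p.1, p.2.cons d₁ h), rfl, ?_⟩
    simp only [β', dif_pos h] at hJ
    rw [hG.J_switch₁, show p.2.mode 0 = d' from hp]
    exact (EReal.coe_le_coe_iff.2 (by linarith)).trans (EReal.le_affine zero_le_one hJ)
  le_switch₂ d₁ d₂ x d' hd := by
    refine le_of_forall_pos_le_add fun ε hε => ?_
    obtain ⟨β, hβ, hJ⟩ := hG.exists_strategy2_J_le d₁ d' x hε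
    have h : ∀ p, d₂ ≠ (β p).2.1.mode 0 := fun p h => hd (h.trans (hβ.2 p))
    refine hG.lowerVal_le (β := fun p => ((β p).1, (β p).2.1.cons d₂ (h p), (β p).2.2))
      ⟨fun t ht p p' hp => ?_, fun _ => rfl⟩ fun p hp => ?_
    · have h1 := hβ.1 t ht p p' hp
      exact ⟨h1.1, h1.2.1.cons (h p) (h p'), h1.2.2⟩
    · rw [hG.J_switch₂, show (β p).2.1.mode 0 = d' from hβ.2 p]
      exact (EReal.affine_le zero_le_one (hJ p hp)).trans (EReal.coe_le_coe_iff.2 (by linarith))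
  le_impulse d₁ d₂ x ξ := by
    refine le_of_forall_pos_le_add fun ε hε => ?_
    obtain ⟨β, hβ, hJ⟩ := hG.exists_strategy2_J_le d₁ d₂ (x + ξ) hε
    refine hG.lowerVal_le (β := fun p => ((β p).1, (β p).2.1, (β p).2.2.cons ξ))
      ⟨fun t ht p p' hp => ?_, fun p => hβ.2 p⟩ fun p hp => ?_
    · have h1 := hβ.1 t ht p p' hp
      exact ⟨h1.1, h1.2.1, h1.2.2.cons ξ⟩
    · rw [hG.J_impulse]
      exact (EReal.affine_le zero_le_one (hJ p hp)).trans (EReal.coe_le_coe_iff.2 (by linarith))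

theorem obeysObstacles_upperVal : G.ObeysObstacles G.upperVal where
  modulus ε hε := by
    obtain ⟨δ, hδ, h⟩ := hG.exists_totalRunCost_sub_le hε
    refine ⟨δ, hδ, fun d₁ d₂ x x' hx => le_of_forall_pos_le_add fun η hη => ?_⟩
    refine hG.upperVal_le fun α hα => ?_
    obtain ⟨q, hq, hJ⟩ := hG.exists_control2_J_le (d₂ := d₂) x' hα hη
    refine ⟨q, hq, (hG.J_le_of_le (h x x' hx (α q) q) hJ).trans_eq ?_⟩
    rw [add_right_comm]
  nonneg := hG.upperVal_nonneg
  ge_switch₁ d₁ d₂ x d' hd := by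
    refine le_of_forall_pos_le_add fun ε hε => ?_
    obtain ⟨α, hα, hJ⟩ := hG.exists_strategy1_le_J d' d₂ x hε
    have h : ∀ q, d₁ ≠ (α q).2.mode 0 := fun q h => hd (h.trans (hα.2 q))
    refine sub_le_iff_le_add.1 (hG.le_upperVal (α := fun q => ((α q).1, (α q).2.cons d₁ (h q)))
      ⟨fun t ht q q' hq => ?_, fun _ => rfl⟩ fun q hq => ?_)
    · have h1 := hα.1 t ht q q' hq
      exact ⟨h1.1, h1.2.cons (h q) (h q')⟩
    · rw [hG.J_switch₁, show (α q).2.mode 0 = d' from hα.2 q]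
      exact (EReal.coe_le_coe_iff.2 (by linarith)).trans (EReal.le_affine zero_le_one (hJ q hq))
  le_switch₂ d₁ d₂ x d' hd := by
    refine le_of_forall_pos_le_add fun ε hε => hG.upperVal_le fun α hα => ?_
    classical
    -- As for the lower value, with the prefix made by player 2; the second branch is never tested.
    set α' : G.C2 → G.C1 := fun q =>
      if h : d₂ ≠ q.2.1.mode 0 then α (q.1, q.2.1.cons d₂ h, q.2.2) else α q
    have hα' : α' ∈ G.Strategy1 d₁ := by
      refine ⟨fun t ht q q' hq => ?_, fun q => ?_⟩
      · have hm := hq.2.1.mode_zero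
        by_cases h : d₂ ≠ q.2.1.mode 0
        · have h' : d₂ ≠ q'.2.1.mode 0 := hm ▸ h
          simp only [α', dif_pos h, dif_pos h']
          exact hα.1 t ht _ _ ⟨hq.1, hq.2.1.cons h h', hq.2.2⟩
        · have h' : ¬ d₂ ≠ q'.2.1.mode 0 := hm ▸ h
          simp only [α', dif_neg h, dif_neg h']
          exact hα.1 t ht _ _ hq
      · simp only [α']
        split_ifs
        · exact hα.2 _
        · exact hα.2 _
    obtain ⟨q, hq, hJ⟩ := hG.exists_control2_J_le (d₂ := d') x hα' hε
    have h : d₂ ≠ q.2.1.mode 0 := fun h => hd (h.trans hq)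
    refine ⟨(q.1, q.2.1.cons d₂ h, q.2.2), rfl, ?_⟩
    simp only [α', dif_pos h] at hJ
    rw [hG.J_switch₂, show q.2.1.mode 0 = d' from hq]
    exact (EReal.affine_le zero_le_one hJ).trans (EReal.coe_le_coe_iff.2 (by linarith))
  le_impulse d₁ d₂ x ξ := by
    refine le_of_forall_pos_le_add fun ε hε => hG.upperVal_le fun α hα => ?_
    obtain ⟨q, hq, hJ⟩ := hG.exists_control2_J_le (d₂ := d₂)
      (α := fun q => α (q.1, q.2.1, q.2.2.cons ξ)) (x + ξ)
      ⟨fun t ht q q' hq => hα.1 t ht _ _ ⟨hq.1, hq.2.1, hq.2.2.cons ξ⟩, fun q => hα.2 _⟩ hε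
    refine ⟨(q.1, q.2.1, q.2.2.cons ξ), hq, ?_⟩
    rw [hG.J_impulse]
    exact (EReal.affine_le zero_le_one hJ).trans (EReal.coe_le_coe_iff.2 (by linarith))

end Regular

end Lower

/-! ### Restarting the game -/

/-- The exceptional null set may depend on s, so a sequence increasing to t is used. -/
theorem ae_of_forall_lt {P : ℝ → Prop} {t : ℝ}
    (h : ∀ s, 0 ≤ s → s < t → ∀ᵐ r, r ∈ Icc 0 s → P r) : ∀ᵐ r, r ∈ Ico 0 t → P r := by
  obtain ⟨u, -, hut, hu⟩ := exists_seq_strictMono_tendsto t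
  have h' : ∀ n, ∀ᵐ r, r ∈ Icc 0 (u n) → P r := fun n => by
    by_cases hn : 0 ≤ u n
    · exact h _ hn (hut n)
    · exact Eventually.of_forall fun r hr => absurd (hr.1.trans hr.2) hn
  filter_upwards [ae_all_iff.2 h'] with r hr hrt
  obtain ⟨n, hn⟩ := (hu.eventually (lt_mem_nhds hrt.2)).exists
  exact hr n ⟨hrt.1, hn.le⟩

theorem Agree1.ae_eq {t : ℝ} {p p' : G.C1} (h : G.Agree1 t p p') :
    ∀ᵐ s, s ∈ Icc 0 t → p.1.1 s = p'.1.1 s ∧ p.2.val s = p'.2.val s := by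
  filter_upwards [ContControl.agreeUpTo_iff.1 h.1] with s hs hst
  exact ⟨hs hst, h.2.val_eq hst.2⟩

theorem Agree2.ae_eq {t : ℝ} {q q' : G.C2} (h : G.Agree2 t q q') :
    ∀ᵐ s, s ∈ Icc 0 t → q.1.1 s = q'.1.1 s ∧ q.2.1.val s = q'.2.1.val s := by
  filter_upwards [ContControl.agreeUpTo_iff.1 h.1] with s hs hst
  exact ⟨hs hst, h.2.1.val_eq hst.2⟩

/-- The control of player 1 that follows `u` without switches until time `t` and then starts
`p`. -/
def concat1 (t : ℝ) (u : ContControl U₁) (p : G.C1) : G.C1 := (u.concat t p.1, p.2.delay t)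

/-- The control of player 2 that follows `u` without switches and impulses until time `t` and then
starts `q`. -/
def concat2 (t : ℝ) (u : ContControl U₂) (q : G.C2) : G.C2 :=
  (u.concat t q.1, q.2.1.delay t, q.2.2.delay t)

/-- The control `p` seen from time `t` on, after `n` switches. -/
def shift1 (t : ℝ) (n : ℕ) (p : G.C1) : G.C1 := (p.1.shift t, p.2.shift t n)

/-- The control `q` seen from time `t` on, after `n` switches and `m` impulses. -/
def shift2 (t : ℝ) (n m : ℕ) (q : G.C2) : G.C2 :=
  (q.1.shift t, q.2.1.shift t n, q.2.2.shift t m)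

theorem isShift1_concat1 (t : ℝ) (u : ContControl U₁) (p : G.C1) :
    IsShift1 t 0 (concat1 t u p) p :=
  ⟨fun _ hs => (ContControl.concat_add u p.1 hs).symm, p.2.isShift_delay t⟩

theorem isShift2_concat2 (t : ℝ) (u : ContControl U₂) (q : G.C2) :
    IsShift2 t 0 0 (concat2 t u q) q :=
  ⟨fun _ hs => (ContControl.concat_add u q.1 hs).symm, q.2.1.isShift_delay t,
    q.2.2.isShift_delay t⟩

theorem isShift1_shift1 {t : ℝ} {n : ℕ} {p : G.C1} (h : p.2.time n ≤ ENNReal.ofReal t)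
    (h' : ENNReal.ofReal t ≤ p.2.time (n + 1)) : IsShift1 t n p (shift1 t n p) :=
  ⟨fun _ _ => rfl, SwitchingControl.isShift_shift h h'⟩

theorem isShift2_shift2 {t : ℝ} {n m : ℕ} {q : G.C2} (h : q.2.1.time n ≤ ENNReal.ofReal t)
    (h' : ENNReal.ofReal t ≤ q.2.1.time (n + 1)) (hm : ∀ j < m, q.2.2.time j ≤ ENNReal.ofReal t)
    (hm' : ENNReal.ofReal t ≤ q.2.2.time m) : IsShift2 t n m q (shift2 t n m q) :=
  ⟨fun _ _ => rfl, SwitchingControl.isShift_shift h h', ImpulseControl.isShift_shift hm hm'⟩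

theorem Agree1.concat1_of_lt {s t t' : ℝ} {u u' : ContControl U₁} {p p' : G.C1} (hs : 0 ≤ s)
    (hst : s < t) (hst' : s < t') (hu : u.AgreeUpTo s u') (hm : p.2.mode 0 = p'.2.mode 0) :
    G.Agree1 s (concat1 t u p) (concat1 t' u' p') := by
  have h : ∀ {r : ℝ}, s < r → ENNReal.ofReal s < ENNReal.ofReal r := fun h =>
    (ENNReal.ofReal_lt_ofReal_iff (hs.trans_lt h)).2 h
  exact ⟨ContControl.AgreeUpTo.concat_of_lt hu hst hst', SwitchingControl.agreeUpTo_of_lt hm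
    ((h hst).trans_le (p.2.le_delay_time_one t)) ((h hst').trans_le (p'.2.le_delay_time_one t'))⟩

theorem Agree2.concat2_of_lt {s t t' : ℝ} {u u' : ContControl U₂} {q q' : G.C2} (hs : 0 ≤ s)
    (hst : s < t) (hst' : s < t') (hu : u.AgreeUpTo s u') (hm : q.2.1.mode 0 = q'.2.1.mode 0) :
    G.Agree2 s (concat2 t u q) (concat2 t' u' q') := by
  have h : ∀ {r : ℝ}, s < r → ENNReal.ofReal s < ENNReal.ofReal r := fun h =>
    (ENNReal.ofReal_lt_ofReal_iff (hs.trans_lt h)).2 h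
  exact ⟨ContControl.AgreeUpTo.concat_of_lt hu hst hst', SwitchingControl.agreeUpTo_of_lt hm
    ((h hst).trans_le (SwitchingControl.le_delay_time_one t _))
    ((h hst').trans_le (SwitchingControl.le_delay_time_one t' _)),
    ImpulseControl.agreeUpTo_of_lt ((h hst).trans_le (ImpulseControl.le_delay_time_zero t _))
      ((h hst').trans_le (ImpulseControl.le_delay_time_zero t' _))⟩

theorem Agree1.concat1 {s t : ℝ} {u u' : ContControl U₁} {p p' : G.C1} (ht : 0 ≤ t) (hs : 0 ≤ s)
    (hu : u.AgreeUpTo (t + s) u') (h : G.Agree1 s p p') :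
    G.Agree1 (t + s) (concat1 t u p) (HybridGame.concat1 t u' p') :=
  ⟨ContControl.AgreeUpTo.concat hu h.1, h.2.delay ht hs⟩

theorem Agree2.concat2 {s t : ℝ} {u u' : ContControl U₂} {q q' : G.C2} (ht : 0 ≤ t) (hs : 0 ≤ s)
    (hu : u.AgreeUpTo (t + s) u') (h : G.Agree2 s q q') :
    G.Agree2 (t + s) (concat2 t u q) (HybridGame.concat2 t u' q') :=
  ⟨ContControl.AgreeUpTo.concat hu h.1, h.2.1.delay ht hs, h.2.2.delay ht hs⟩

theorem Agree1.shift1 {s t : ℝ} {n : ℕ} {p p' : G.C1} (ht : 0 ≤ t) (hs : 0 ≤ s)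
    (h : G.Agree1 (t + s) p p') (hn : p.2.time n ≤ ENNReal.ofReal t) :
    G.Agree1 s (shift1 t n p) (HybridGame.shift1 t n p') :=
  ⟨h.1.shift ht, h.2.shift ht hs hn⟩

theorem Agree2.shift2 {s t : ℝ} {n m : ℕ} {q q' : G.C2} (ht : 0 ≤ t) (hs : 0 ≤ s)
    (h : G.Agree2 (t + s) q q') (hn : q.2.1.time n ≤ ENNReal.ofReal t) :
    G.Agree2 s (shift2 t n m q) (HybridGame.shift2 t n m q') :=
  ⟨h.1.shift ht, h.2.1.shift ht hs hn, h.2.2.shift ht hs m⟩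

namespace Regular

variable (hG : G.Regular F K L)
include hG

theorem state_congr {x : E} {p p' : G.C1} {q q' : G.C2} {t : ℝ} {m : ℕ}
    (hv : ∀ᵐ s, s ∈ Ico 0 t → SameValues p p' q q' s)
    (hj : ∀ j < m, q.2.2.time j = q'.2.2.time j ∧ q.2.2.vec j = q'.2.2.vec j)
    (hm : ENNReal.ofReal t ≤ q.2.2.time m) (hm' : ENNReal.ofReal t ≤ q'.2.2.time m) :
    EqOn (G.state x p q) (G.state x p' q') (Ico 0 t) := by
  intro s hs
  refine hG.eqOn_of_isMildSolution (T := s) (hG.isMildSolution_state x p q)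
    (hG.isMildSolution_state x p' q') ?_ (fun r hr => ?_) ⟨hs.1, le_rfl⟩
  · rw [ae_restrict_iff' measurableSet_Ioc]
    filter_upwards [hv] with r hr hrs
    exact hr ⟨hrs.1.le, hrs.2.trans_lt hs.2⟩
  · have hrt : ENNReal.ofReal r < ENNReal.ofReal t :=
      (ENNReal.ofReal_lt_ofReal_iff (hs.1.trans_lt hs.2)).2 (hr.2.trans_lt hs.2)
    rw [G.impulseSum_eq_sum (hrt.trans_le hm), G.impulseSum_eq_sum (hrt.trans_le hm')]
    refine Finset.sum_congr rfl fun j hjm => ?_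
    rw [(hj j (Finset.mem_range.1 hjm)).1, (hj j (Finset.mem_range.1 hjm)).2]

theorem preState_congr {x : E} {p p' : G.C1} {q q' : G.C2} {t : ℝ} {m : ℕ}
    (hv : ∀ᵐ s, s ∈ Ico 0 t → SameValues p p' q q' s)
    (hj : ∀ j < m, q.2.2.time j = q'.2.2.time j ∧ q.2.2.vec j = q'.2.2.vec j)
    (hm : ENNReal.ofReal t ≤ q.2.2.time m) (hm' : ENNReal.ofReal t ≤ q'.2.2.time m) :
    G.preState x p q (G.state x p q) t m = G.preState x p' q' (G.state x p' q') t m := by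
  have hy := hG.state_congr (x := x) hv hj hm hm'
  rw [preState, preState]
  congr 1
  · congr 1
    refine setIntegral_congr_ae measurableSet_Ioc ?_
    filter_upwards [hv, Measure.ae_ne volume t] with s hs hst hsI
    have hsI' : s ∈ Ico 0 t := ⟨hsI.1.le, lt_of_le_of_ne hsI.2 hst⟩
    obtain ⟨h1, h2, h3, h4⟩ := hs hsI'
    rw [drift_eq_of_sameValues h1 h2 h3 h4 (hy hsI')]
  · refine Finset.sum_congr rfl fun j hjm => ?_
    rw [(hj j (Finset.mem_range.1 hjm)).1, (hj j (Finset.mem_range.1 hjm)).2]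

theorem runCost_congr {x : E} {p p' : G.C1} {q q' : G.C2} {t : ℝ} {m : ℕ}
    (hv : ∀ᵐ s, s ∈ Ico 0 t → SameValues p p' q q' s)
    (hj : ∀ j < m, q.2.2.time j = q'.2.2.time j ∧ q.2.2.vec j = q'.2.2.vec j)
    (hm : ENNReal.ofReal t ≤ q.2.2.time m) (hm' : ENNReal.ofReal t ≤ q'.2.2.time m) :
    G.runCost x p q t = G.runCost x p' q' t := by
  have hy := hG.state_congr (x := x) hv hj hm hm'
  refine setIntegral_congr_ae measurableSet_Ioc ?_
  filter_upwards [hv, Measure.ae_ne volume t] with s hs hst hsI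
  have hsI' : s ∈ Ico 0 t := ⟨hsI.1.le, lt_of_le_of_ne hsI.2 hst⟩
  obtain ⟨h1, h2, h3, h4⟩ := hs hsI'
  rw [rate_eq_of_sameValues h1 h2 h3 h4 (hy hsI')]

variable [Nonempty U₁] [Nonempty U₂]

/-- Against a strategy of player 2, player 1 can idle until time `t` and then secure the lower
value of the game restarted at time `t`. -/
theorem exists_control1_restart {d₁ : D₁} {d₂ : D₂} (x : E) {β : G.C1 → G.C2}
    (hβ : β ∈ G.Strategy2 d₂) (a : U₁) {t ε : ℝ} (ht : 0 < t) (hε : 0 < ε) {n m : ℕ} {p₀ : G.C1}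
    {q₀ : G.C2} (hp₀ : p₀ = G.idle1 a d₁) (hq₀ : q₀ = β p₀)
    (hn : q₀.2.1.time n < ENNReal.ofReal t) (hn' : ENNReal.ofReal t ≤ q₀.2.1.time (n + 1))
    (hm : ∀ j < m, q₀.2.2.time j < ENNReal.ofReal t) (hm' : ENNReal.ofReal t ≤ q₀.2.2.time m) :
    ∃ p ∈ G.C1From d₁, ((G.runCost x p₀ q₀ t + (q₀.2.1.partialCost G.lam G.c₂ n
        + G.partialImpulseCost q₀.2.2 m) + Real.exp (-G.lam * t) *
          (G.lowerVal d₁ (q₀.2.1.mode n) (G.preState x p₀ q₀ (G.state x p₀ q₀) t m) - ε) : ℝ) :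
        EReal) ≤ G.J x p (β p) := by
  classical
  set Q : G.C1 → G.C2 := fun p => β (concat1 t (ContControl.const a) p) with hQ
  -- Agreement holds only for s < t, because p may switch at once, that is, at time t. Hence only
  -- the responses strictly before t are known in advance, and n and m count exactly these.
  have hag1 : ∀ p : G.C1, p.2.mode 0 = d₁ → ∀ s, 0 ≤ s → s < t →
      G.Agree1 s p₀ (concat1 t (ContControl.const a) p) := by
    intro p hp s hs hst
    rw [hp₀]
    refine ⟨?_, SwitchingControl.agreeUpTo_of_lt hp.symm (by simp [idle1, SwitchingControl.const])
      (((ENNReal.ofReal_lt_ofReal_iff ht).2 hst).trans_le (p.2.le_delay_time_one t))⟩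
    rw [ContControl.agreeUpTo_iff]
    exact Eventually.of_forall fun r hr => (ContControl.concat_of_lt _ _ (hr.2.trans_lt hst)).symm
  have hag2 : ∀ p : G.C1, p.2.mode 0 = d₁ → ∀ s, 0 ≤ s → s < t → G.Agree2 s q₀ (Q p) :=
    fun p hp s hs hst => hq₀ ▸ hβ.1 s hs _ _ (hag1 p hp s hs hst)
  have hsw : ∀ p : G.C1, p.2.mode 0 = d₁ → ∀ j ≤ n, q₀.2.1.time j = (Q p).2.1.time j ∧
      q₀.2.1.mode j = (Q p).2.1.mode j := fun p hp j hj =>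
    SwitchingControl.eq_of_forall_agreeUpTo (fun s hs hst => (hag2 p hp s hs hst).2.1)
      ((q₀.2.1.time_mono hj).trans_lt hn)
  have him : ∀ p : G.C1, p.2.mode 0 = d₁ → ∀ j < m, q₀.2.2.time j = (Q p).2.2.time j ∧
      q₀.2.2.vec j = (Q p).2.2.vec j := fun p hp j hj =>
    ImpulseControl.eq_of_forall_agreeUpTo (fun s hs hst => (hag2 p hp s hs hst).2.2) (hm j hj)
  have hsw' : ∀ p : G.C1, p.2.mode 0 = d₁ → ENNReal.ofReal t ≤ (Q p).2.1.time (n + 1) :=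
    fun p hp => SwitchingControl.le_time_of_forall_agreeUpTo
      (fun s hs hst => (hag2 p hp s hs hst).2.1) hn'
  have him' : ∀ p : G.C1, p.2.mode 0 = d₁ → ENNReal.ofReal t ≤ (Q p).2.2.time m :=
    fun p hp => ImpulseControl.le_time_of_forall_agreeUpTo
      (fun s hs hst => (hag2 p hp s hs hst).2.2) hm'
  -- What β does after t against idling followed by p is a strategy in the restarted game. Its
  -- initial mode is the mode reached by q₀ before t, also on the controls that do not start in d₁.
  set β' : G.C1 → G.C2 := fun p =>
    if p.2.mode 0 = d₁ then shift2 t n m (Q p) else shift2 t n m q₀ with hβ'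
  have hβ'mem : β' ∈ G.Strategy2 (q₀.2.1.mode n) := by
    refine ⟨fun s hs p p' hpp => ?_, fun p => ?_⟩
    · have h0 := hpp.2.mode_zero
      simp only [hβ']
      by_cases hp : p.2.mode 0 = d₁
      · rw [if_pos hp, if_pos (h0 ▸ hp)]
        refine (hβ.1 (t + s) (by linarith) _ _ ?_).shift2 ht.le hs ?_
        · exact hpp.concat1 ht.le hs (Eventually.of_forall fun _ => rfl)
        · rw [← (hsw p hp n le_rfl).1]
          exact hn.le
      · rw [if_neg hp, if_neg (h0 ▸ hp)]
        exact agree2_refl s _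
    · simp only [hβ']
      split_ifs with hp
      · exact (hsw p hp n le_rfl).2.symm
      · rfl
  set z := G.preState x p₀ q₀ (G.state x p₀ q₀) t m
  obtain ⟨p, hp, hJ⟩ := hG.exists_control1_le_J (d₁ := d₁) z hβ'mem hε
  have hp' : p.2.mode 0 = d₁ := hp
  refine ⟨concat1 t (ContControl.const a) p, hp, ?_⟩
  have hv : ∀ᵐ s, s ∈ Ico 0 t →
      SameValues p₀ (concat1 t (ContControl.const a) p) q₀ (Q p) s := by
    refine ae_of_forall_lt fun s hs hst => ?_
    filter_upwards [(hag1 p hp s hs hst).ae_eq, (hag2 p hp s hs hst).ae_eq] with r h1 h2 hr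
    exact ⟨(h1 hr).1, (h1 hr).2, (h2 hr).1, (h2 hr).2⟩
  have hshift := isShift2_shift2 ((hsw p hp n le_rfl).1 ▸ hn.le) (hsw' p hp)
    (fun j hj => (him p hp j hj).1 ▸ (hm j hj).le) (him' p hp)
  rw [hG.J_eq_of_isShift ht.le (isShift1_concat1 t _ p) hshift,
    ← hG.preState_congr hv (him p hp) hm' (him' p hp),
    ← hG.runCost_congr hv (him p hp) hm' (him' p hp)]
  simp only [hβ', if_pos hp'] at hJ
  refine le_trans ?_ (EReal.le_affine (Real.exp_pos _).le hJ)
  refine EReal.coe_le_coe_iff.2 (le_of_eq ?_)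
  have h1 : q₀.2.1.partialCost G.lam G.c₂ n = (Q p).2.1.partialCost G.lam G.c₂ n :=
    Finset.sum_congr rfl fun j hj => by
      have hj := Finset.mem_range.1 hj
      rw [(hsw p hp (j + 1) hj).1, (hsw p hp (j + 1) hj).2, (hsw p hp j hj.le).2]
  have h2 : G.partialImpulseCost q₀.2.2 m = G.partialImpulseCost (Q p).2.2 m :=
    Finset.sum_congr rfl fun j hj => by
      rw [(him p hp j (Finset.mem_range.1 hj)).1, (him p hp j (Finset.mem_range.1 hj)).2]
  rw [h1, h2]
  simp [SwitchingControl.partialCost, hQ]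

/-- Against a strategy of player 1, player 2 can idle until time `t` and then secure the upper
value of the game restarted at time `t`. -/
theorem exists_control2_restart {d₁ : D₁} {d₂ : D₂} (x : E) {α : G.C2 → G.C1}
    (hα : α ∈ G.Strategy1 d₁) (b : U₂) {t ε : ℝ} (ht : 0 < t) (hε : 0 < ε) {n : ℕ} {p₀ : G.C1}
    {q₀ : G.C2} (hq₀ : q₀ = G.idle2 b d₂) (hp₀ : p₀ = α q₀)
    (hn : p₀.2.time n < ENNReal.ofReal t) (hn' : ENNReal.ofReal t ≤ p₀.2.time (n + 1)) :
    ∃ q ∈ G.C2From d₂, G.J x (α q) q ≤ ((G.runCost x p₀ q₀ t - p₀.2.partialCost G.lam G.c₁ n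
      + Real.exp (-G.lam * t) *
        (G.upperVal (p₀.2.mode n) d₂ (G.preState x p₀ q₀ (G.state x p₀ q₀) t 0) + ε) : ℝ) :
        EReal) := by
  classical
  set P : G.C2 → G.C1 := fun q => α (concat2 t (ContControl.const b) q) with hP
  have hag2 : ∀ q : G.C2, q.2.1.mode 0 = d₂ → ∀ s, 0 ≤ s → s < t →
      G.Agree2 s q₀ (concat2 t (ContControl.const b) q) := by
    intro q hq s hs hst
    have hlt := (ENNReal.ofReal_lt_ofReal_iff ht).2 hst
    rw [hq₀]
    refine ⟨?_, SwitchingControl.agreeUpTo_of_lt hq.symm (by simp [idle2, SwitchingControl.const])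
      (hlt.trans_le (SwitchingControl.le_delay_time_one t _)),
      ImpulseControl.agreeUpTo_of_lt (by simp [idle2, ImpulseControl.none])
      (hlt.trans_le (ImpulseControl.le_delay_time_zero t _))⟩
    rw [ContControl.agreeUpTo_iff]
    exact Eventually.of_forall fun r hr => (ContControl.concat_of_lt _ _ (hr.2.trans_lt hst)).symm
  have hag1 : ∀ q : G.C2, q.2.1.mode 0 = d₂ → ∀ s, 0 ≤ s → s < t → G.Agree1 s p₀ (P q) :=
    fun q hq s hs hst => hp₀ ▸ hα.1 s hs _ _ (hag2 q hq s hs hst)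
  have hsw : ∀ q : G.C2, q.2.1.mode 0 = d₂ → ∀ j ≤ n, p₀.2.time j = (P q).2.time j ∧
      p₀.2.mode j = (P q).2.mode j := fun q hq j hj =>
    SwitchingControl.eq_of_forall_agreeUpTo (fun s hs hst => (hag1 q hq s hs hst).2)
      ((p₀.2.time_mono hj).trans_lt hn)
  have hsw' : ∀ q : G.C2, q.2.1.mode 0 = d₂ → ENNReal.ofReal t ≤ (P q).2.time (n + 1) :=
    fun q hq => SwitchingControl.le_time_of_forall_agreeUpTo
      (fun s hs hst => (hag1 q hq s hs hst).2) hn'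
  set α' : G.C2 → G.C1 := fun q =>
    if q.2.1.mode 0 = d₂ then shift1 t n (P q) else shift1 t n p₀ with hα'
  have hα'mem : α' ∈ G.Strategy1 (p₀.2.mode n) := by
    refine ⟨fun s hs q q' hqq => ?_, fun q => ?_⟩
    · have h0 := hqq.2.1.mode_zero
      simp only [hα']
      by_cases hq : q.2.1.mode 0 = d₂
      · rw [if_pos hq, if_pos (h0 ▸ hq)]
        refine (hα.1 (t + s) (by linarith) _ _ ?_).shift1 ht.le hs ?_
        · exact hqq.concat2 ht.le hs (Eventually.of_forall fun _ => rfl)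
        · rw [← (hsw q hq n le_rfl).1]
          exact hn.le
      · rw [if_neg hq, if_neg (h0 ▸ hq)]
        exact agree1_refl s _
    · simp only [hα']
      split_ifs with hq
      · exact (hsw q hq n le_rfl).2.symm
      · rfl
  set z := G.preState x p₀ q₀ (G.state x p₀ q₀) t 0
  obtain ⟨q, hq, hJ⟩ := hG.exists_control2_J_le (d₂ := d₂) z hα'mem hε
  have hq' : q.2.1.mode 0 = d₂ := hq
  refine ⟨concat2 t (ContControl.const b) q, hq, ?_⟩
  have hv : ∀ᵐ s, s ∈ Ico 0 t →
      SameValues p₀ (P q) q₀ (concat2 t (ContControl.const b) q) s := by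
    refine ae_of_forall_lt fun s hs hst => ?_
    filter_upwards [(hag1 q hq s hs hst).ae_eq, (hag2 q hq s hs hst).ae_eq] with r h1 h2 hr
    exact ⟨(h1 hr).1, (h1 hr).2, (h2 hr).1, (h2 hr).2⟩
  have hm : ENNReal.ofReal t ≤ q₀.2.2.time 0 := by simp [hq₀, idle2, ImpulseControl.none]
  have hm' := ImpulseControl.le_delay_time_zero t q.2.2
  have hshift := isShift1_shift1 ((hsw q hq n le_rfl).1 ▸ hn.le) (hsw' q hq)
  rw [hG.J_eq_of_isShift ht.le hshift (isShift2_concat2 t _ q),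
    ← hG.preState_congr hv (by simp) hm hm', ← hG.runCost_congr hv (by simp) hm hm']
  simp only [hα', if_pos hq'] at hJ
  refine (EReal.affine_le (Real.exp_pos _).le hJ).trans ?_
  refine EReal.coe_le_coe_iff.2 (le_of_eq ?_)
  have h1 : p₀.2.partialCost G.lam G.c₁ n = (P q).2.partialCost G.lam G.c₁ n :=
    Finset.sum_congr rfl fun j hj => by
      have hj := Finset.mem_range.1 hj
      rw [(hsw q hq (j + 1) hj).1, (hsw q hq (j + 1) hj).2, (hsw q hq j hj.le).2]
  rw [h1]
  simp [SwitchingControl.partialCost, partialImpulseCost, hP]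

end Regular

namespace Regular

variable (hG : G.Regular F K L) [Nonempty U₁] [Nonempty U₂]
include hG

/-- Player 2 can answer the continuous control of player 1 by feedback until time `t` and then
secure the lower value of the game restarted at time `t`. -/
theorem exists_strategy2_restart (d₂ : D₂) (x : E) {η : U₁ → U₂} (hη : Measurable η) {t ε : ℝ}
    (ht : 0 ≤ t) (hε : 0 < ε) :
    ∃ β ∈ G.Strategy2 d₂, ∀ p : G.C1, (∀ s < t, (β p).1.1 s = η (p.1.1 s)) ∧
      ENNReal.ofReal t ≤ (β p).2.1.time 1 ∧ ENNReal.ofReal t ≤ (β p).2.2.time 0 ∧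
      G.J x p (β p) ≤ ((G.runCost x p (β p) t - p.2.partialCost G.lam G.c₁ (p.2.idx t)
        + Real.exp (-G.lam * t) * (G.lowerVal (p.2.val t) d₂
          (G.preState x p (β p) (G.state x p (β p)) t 0) + ε) : ℝ) : EReal) := by
  -- One near-optimal strategy is fixed for each restart mode and state. No measurability in z is
  -- needed, since each p leads to a single restart point.
  choose σ hσ hσJ using fun (d₁ : D₁) (z : E) => hG.exists_strategy2_J_le d₁ d₂ z hε
  set q₀ : G.C2 := G.idle2 (Classical.arbitrary U₂) d₂
  set W : G.C1 → G.C2 → G.C2 := fun p q => concat2 t (p.1.map η hη) q with hW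
  -- The restart state is computed with the dummy continuation q₀, because the true continuation is
  -- chosen from this state. The two coincide, as they involve the same play before t.
  set z : G.C1 → E := fun p => G.preState x p (W p q₀) (G.state x p (W p q₀)) t 0
  set β : G.C1 → G.C2 := fun p => W p (σ (p.2.val t) (z p) (shift1 t (p.2.idx t) p)) with hβ
  have hWlt : ∀ p q q', q.2.1.mode 0 = q'.2.1.mode 0 → ∀ s ∈ Ico 0 t,
      (W p q).1.1 s = (W p q').1.1 s ∧ (W p q).2.1.val s = (W p q').2.1.val s := by
    intro p q q' hm s hs
    have hlt := (ENNReal.ofReal_lt_ofReal_iff (hs.1.trans_lt hs.2)).2 hs.2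
    refine ⟨?_, ?_⟩
    · simp only [hW, concat2]
      rw [ContControl.concat_of_lt _ _ hs.2, ContControl.concat_of_lt _ _ hs.2]
    · simp only [hW, concat2]
      rw [SwitchingControl.val_of_lt (hlt.trans_le (SwitchingControl.le_delay_time_one t _)),
        SwitchingControl.val_of_lt (hlt.trans_le (SwitchingControl.le_delay_time_one t _))]
      exact hm
  have hmode : ∀ p, (β p).2.1.mode 0 = d₂ := fun p => (hσ _ _).2 _
  refine ⟨β, ⟨fun s hs p p' hp => ?_, hmode⟩, fun p => ⟨fun s hs => ?_, ?_, ?_, ?_⟩⟩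
  · rcases lt_or_ge s t with hst | hst
    · exact Agree2.concat2_of_lt hs hst hst (hp.1.map hη) ((hmode p).trans (hmode p').symm)
    · obtain ⟨r, rfl⟩ := exists_add_of_le hst
      have hr : 0 ≤ r := by linarith
      have hpt := hp.mono hst
      have hz : z p = z p' := by
        refine hG.preState_congr (m := 0) ?_ (by simp)
          (ImpulseControl.le_delay_time_zero t _) (ImpulseControl.le_delay_time_zero t _)
        filter_upwards [hpt.ae_eq, ContControl.agreeUpTo_iff.1 (hpt.1.map hη)] with s h1 h2 hs
        refine ⟨(h1 ⟨hs.1, hs.2.le⟩).1, (h1 ⟨hs.1, hs.2.le⟩).2, ?_, ?_⟩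
        · simp only [hW, concat2]
          rw [ContControl.concat_of_lt _ _ hs.2, ContControl.concat_of_lt _ _ hs.2]
          exact h2 ⟨hs.1, hs.2.le⟩
        · rfl
      have hidx := hp.2.idx_eq hst
      have hval := hp.2.val_eq hst
      refine Agree2.concat2 ht hr (hp.1.map hη) ?_
      rw [← hz, ← hidx, ← hval]
      exact (hσ _ _).1 r hr _ _ (hp.shift1 ht hr (p.2.time_idx_le t))
  · simp only [hβ, hW, concat2]
    rw [ContControl.concat_of_lt _ _ hs]
    rfl
  · exact SwitchingControl.le_delay_time_one t _
  · exact ImpulseControl.le_delay_time_zero t _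
  · have hz : G.preState x p (β p) (G.state x p (β p)) t 0 = z p := by
      refine hG.preState_congr (m := 0) (Eventually.of_forall fun s hs => ?_) (by simp)
          (ImpulseControl.le_delay_time_zero t _) (ImpulseControl.le_delay_time_zero t _)
      have := hWlt p (σ (p.2.val t) (z p) (shift1 t (p.2.idx t) p)) q₀
        ((hσ _ _).2 _) s hs
      exact ⟨rfl, rfl, this.1, this.2⟩
    rw [hG.J_eq_of_isShift ht (isShift1_shift1 (p.2.time_idx_le t) (p.2.lt_time_idx_succ t).le)
      (isShift2_concat2 t _ _), hz]
    refine (EReal.affine_le (Real.exp_pos _).le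
      (hσJ (p.2.val t) (z p) (shift1 t (p.2.idx t) p) rfl)).trans ?_
    refine EReal.coe_le_coe_iff.2 (le_of_eq ?_)
    simp [SwitchingControl.partialCost, partialImpulseCost]
    rfl

/-- Player 1 can answer the continuous control of player 2 by feedback until the stopping time
`θ` and then secure the upper value of the game restarted at time `θ`. -/
theorem exists_strategy1_restart (d₁ : D₁) (x : E) {η : U₂ → U₁} (hη : Measurable η)
    {θ : G.C2 → ℝ} {ε : ℝ} (hθ : ∀ q, 0 ≤ θ q)
    (hθ_local : ∀ s q q', G.Agree2 s q q' → θ q ≤ s → θ q' = θ q) (hε : 0 < ε) :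
    ∃ α ∈ G.Strategy1 d₁, ∀ q : G.C2, (∀ s < θ q, (α q).1.1 s = η (q.1.1 s)) ∧
      (α q).2.mode 0 = d₁ ∧ ENNReal.ofReal (θ q) ≤ (α q).2.time 1 ∧
      ((G.runCost x (α q) q (θ q) + (q.2.1.partialCost G.lam G.c₂ (q.2.1.idx (θ q))
        + G.partialImpulseCost q.2.2 (q.2.2.count (θ q)))
        + Real.exp (-G.lam * θ q) * (G.upperVal d₁ (q.2.1.val (θ q))
          (G.preState x (α q) q (G.state x (α q) q) (θ q) (q.2.2.count (θ q))) - ε) : ℝ) : EReal)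
        ≤ G.J x (α q) q := by
  choose σ hσ hσJ using fun (d₂ : D₂) (z : E) => hG.exists_strategy1_le_J d₁ d₂ z hε
  set p₀ : G.C1 := G.idle1 (Classical.arbitrary U₁) d₁
  set W : G.C2 → G.C1 → G.C1 := fun q p => concat1 (θ q) (q.1.map η hη) p with hW
  set m : G.C2 → ℕ := fun q => q.2.2.count (θ q)
  -- Impulses made exactly at θ are included in the count and hence in the restart state:
  -- nonanticipation lets player 1 react to what happens at time θ itself.
  set z : G.C2 → E := fun q => G.preState x (W q p₀) q (G.state x (W q p₀) q) (θ q) (m q)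
  set τ : G.C2 → G.C2 := fun q => shift2 (θ q) (q.2.1.idx (θ q)) (m q) q
  set α : G.C2 → G.C1 := fun q => W q (σ (q.2.1.val (θ q)) (z q) (τ q)) with hα
  have hWlt : ∀ q p p', p.2.mode 0 = p'.2.mode 0 → ∀ s ∈ Ico 0 (θ q),
      (W q p).1.1 s = (W q p').1.1 s ∧ (W q p).2.val s = (W q p').2.val s := by
    intro q p p' hm s hs
    have hlt := (ENNReal.ofReal_lt_ofReal_iff (hs.1.trans_lt hs.2)).2 hs.2
    refine ⟨?_, ?_⟩
    · simp only [hW, concat1]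
      rw [ContControl.concat_of_lt _ _ hs.2, ContControl.concat_of_lt _ _ hs.2]
    · simp only [hW, concat1]
      rw [SwitchingControl.val_of_lt (hlt.trans_le (SwitchingControl.le_delay_time_one _ _)),
        SwitchingControl.val_of_lt (hlt.trans_le (SwitchingControl.le_delay_time_one _ _))]
      exact hm
  have hmode : ∀ q, (α q).2.mode 0 = d₁ := fun q => (hσ _ _).2 _
  refine ⟨α, ⟨fun s hs q q' hq => ?_, hmode⟩, fun q => ⟨fun s hs => ?_, hmode q, ?_, ?_⟩⟩
  · rcases lt_or_ge s (θ q) with hst | hst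
    -- If q' had stopped by time s, locality of θ would force q to have stopped as well. So both are
    -- still in the feedback phase.
    · have hst' : s < θ q' := by
        by_contra h
        have := hθ_local s q' q hq.symm (not_lt.1 h)
        rw [this] at hst
        exact h hst
      exact Agree1.concat1_of_lt hs hst hst' (hq.1.map hη) ((hmode q).trans (hmode q').symm)
    · have hθq := hθ_local s q q' hq hst
      obtain ⟨r, hr⟩ := exists_add_of_le hst
      subst hr
      have hr : 0 ≤ r := by linarith
      have hqt := hq.mono hst
      have hidx := hq.2.1.idx_eq hst
      have hval := hq.2.1.val_eq hst
      have hcount : m q = m q' := by simp only [m, hθq, hq.2.2.count_eq hst]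
      have hz : z q = z q' := by
        simp only [z]
        rw [hθq, ← hcount]
        refine hG.preState_congr ?_ (fun j hj => hqt.2.2 j (.inl
          (q.2.2.time_le_of_lt_count hj))) (q.2.2.lt_time_count _).le ?_
        · filter_upwards [hqt.ae_eq, ContControl.agreeUpTo_iff.1 (hqt.1.map hη)] with s h1 h2 hs
          refine ⟨?_, ?_, (h1 ⟨hs.1, hs.2.le⟩).1, (h1 ⟨hs.1, hs.2.le⟩).2⟩
          · simp only [hW, concat1]
            rw [ContControl.concat_of_lt _ _ hs.2, ContControl.concat_of_lt _ _ (hθq ▸ hs.2)]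
            exact h2 ⟨hs.1, hs.2.le⟩
          · simp only [hW, concat1, hθq]
        · rw [hcount, ← hθq]
          exact (q'.2.2.lt_time_count _).le
      have hτ : G.Agree2 r (τ q) (τ q') := by
        simp only [τ]
        rw [hθq, ← hcount, ← hidx]
        exact hq.shift2 (hθ q) hr (q.2.1.time_idx_le _)
      simp only [hα, hW]
      rw [← hz, hθq, ← hval]
      exact Agree1.concat1 (hθ q) hr (hq.1.map hη) ((hσ _ _).1 r hr _ _ hτ)
  · simp only [hα, hW, concat1]
    rw [ContControl.concat_of_lt _ _ hs]
    rfl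
  · exact SwitchingControl.le_delay_time_one _ _
  · have hz : G.preState x (α q) q (G.state x (α q) q) (θ q) (m q) = z q := by
      refine hG.preState_congr (Eventually.of_forall fun s hs => ?_) (fun _ _ => ⟨rfl, rfl⟩)
          (q.2.2.lt_time_count _).le (q.2.2.lt_time_count _).le
      have := hWlt q (σ (q.2.1.val (θ q)) (z q) (τ q)) p₀ ((hσ _ _).2 _) s hs
      exact ⟨this.1, this.2, rfl, rfl⟩
    rw [hG.J_eq_of_isShift (hθ q) (isShift1_concat1 (θ q) _ _)
      (isShift2_shift2 (q.2.1.time_idx_le _) (q.2.1.lt_time_idx_succ _).le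
        (fun j hj => q.2.2.time_le_of_lt_count hj) (q.2.2.lt_time_count _).le), hz]
    refine le_trans ?_ (EReal.le_affine (Real.exp_pos _).le
      (hσJ (q.2.1.val (θ q)) (z q) (τ q) rfl))
    refine EReal.coe_le_coe_iff.2 (le_of_eq ?_)
    simp [SwitchingControl.partialCost]
    rfl

end Regular

end HybridGame

/-! ### Hamiltonians and feedback -/

/-- Choose the first point of a dense sequence at which g exceeds c. Each condition is open in u, so
the selected index is measurable; accepting near-optimal answers avoids a measurable selection
theorem. -/
theorem exists_measurable_feedback {U V : Type*} [TopologicalSpace U] [MeasurableSpace U]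
    [OpensMeasurableSpace U] [TopologicalSpace V] [TopologicalSpace.SeparableSpace V] [Nonempty V]
    [MeasurableSpace V] {g : U → V → ℝ} (hg : Continuous fun p : U × V => g p.1 p.2) {c : ℝ}
    (h : ∀ u, ∃ v, c < g u v) : ∃ η : U → V, Measurable η ∧ ∀ u, c < g u (η u) := by
  classical
  have h' : ∀ u, ∃ n, c < g u (TopologicalSpace.denseSeq V n) := by
    intro u
    have ho : IsOpen {v | c < g u v} :=
      isOpen_lt continuous_const (hg.comp (Continuous.prodMk_right u))
    exact (TopologicalSpace.denseRange_denseSeq V).exists_mem_open ho (h u)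
  refine ⟨fun u => TopologicalSpace.denseSeq V (Nat.find (h' u)), ?_, fun u => Nat.find_spec (h' u)⟩
  refine (measurable_from_nat (f := TopologicalSpace.denseSeq V)).comp
    (measurable_find h' fun k => ?_)
  exact (isOpen_lt continuous_const (hg.comp (Continuous.prodMk_left _))).measurableSet

namespace HybridGame

variable {E U₁ U₂ D₁ D₂ : Type*} [NormedAddCommGroup E] [InnerProductSpace ℝ E] [CompleteSpace E]
  [MetricSpace U₁] [CompactSpace U₁] [MeasurableSpace U₁] [BorelSpace U₁]
  [MetricSpace U₂] [CompactSpace U₂] [MeasurableSpace U₂] [BorelSpace U₂]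
  {G : HybridGame E U₁ U₂ D₁ D₂} {F K L : ℝ}

variable (G) in
/-- The function under the minimum and maximum in the Hamiltonians. -/
def ham (d₁ : D₁) (d₂ : D₂) (x p : E) (u₁ : U₁) (u₂ : U₂) : ℝ :=
  inner ℝ (-p) (G.f x u₁ d₁ u₂ d₂) - G.k x u₁ d₁ u₂ d₂

theorem Hplus_eq (d₁ : D₁) (d₂ : D₂) (x p : E) :
    G.Hplus d₁ d₂ x p = ⨅ u₁, ⨆ u₂, G.ham d₁ d₂ x p u₁ u₂ := rfl

theorem Hminus_eq (d₁ : D₁) (d₂ : D₂) (x p : E) :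
    G.Hminus d₁ d₂ x p = ⨆ u₂, ⨅ u₁, G.ham d₁ d₂ x p u₁ u₂ := rfl

namespace Regular

variable (hG : G.Regular F K L)
include hG

theorem abs_ham_le (d₁ : D₁) (d₂ : D₂) (x p : E) (u₁ : U₁) (u₂ : U₂) :
    |G.ham d₁ d₂ x p u₁ u₂| ≤ ‖p‖ * F + K := by
  refine (abs_sub _ _).trans (add_le_add ((abs_real_inner_le_norm _ _).trans ?_) ?_)
  · rw [norm_neg]
    exact mul_le_mul_of_nonneg_left (hG.norm_f_le _ _ _ _ _) (norm_nonneg _)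
  · rw [abs_of_nonneg (hG.k_nonneg _ _ _ _ _)]
    exact hG.k_le _ _ _ _ _

theorem abs_ham_sub_le (d₁ : D₁) (d₂ : D₂) (x y p : E) (u₁ : U₁) (u₂ : U₂) :
    |G.ham d₁ d₂ y p u₁ u₂ - G.ham d₁ d₂ x p u₁ u₂| ≤ (‖p‖ + 1) * L * ‖y - x‖ := by
  have h : G.ham d₁ d₂ y p u₁ u₂ - G.ham d₁ d₂ x p u₁ u₂
      = inner ℝ (-p) (G.f y u₁ d₁ u₂ d₂ - G.f x u₁ d₁ u₂ d₂)
        - (G.k y u₁ d₁ u₂ d₂ - G.k x u₁ d₁ u₂ d₂) := by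
    rw [ham, ham, inner_sub_right]; ring
  rw [h]
  have h1 := (abs_real_inner_le_norm (-p) (G.f y u₁ d₁ u₂ d₂ - G.f x u₁ d₁ u₂ d₂)).trans
    (mul_le_mul_of_nonneg_left (hG.lipschitz_f y x u₁ d₁ u₂ d₂) (norm_nonneg _))
  rw [norm_neg] at h1
  have h2 := hG.lipschitz_k y x u₁ d₁ u₂ d₂
  refine (abs_sub _ _).trans ((add_le_add h1 h2).trans_eq ?_)
  ring

theorem continuous_ham (d₁ : D₁) (d₂ : D₂) (x p : E) :
    Continuous fun u : U₁ × U₂ => G.ham d₁ d₂ x p u.1 u.2 := by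
  have hc : Continuous fun u : U₁ × U₂ => (x, u.1, u.2) := by fun_prop
  exact (continuous_const.inner ((hG.continuous_f d₁ d₂).comp hc)).sub
    ((hG.continuous_k d₁ d₂).comp hc)

theorem bddAbove_ham₂ (d₁ : D₁) (d₂ : D₂) (x p : E) (u₁ : U₁) :
    BddAbove (range fun u₂ => G.ham d₁ d₂ x p u₁ u₂) :=
  ⟨‖p‖ * F + K, by rintro _ ⟨u₂, rfl⟩; exact (abs_le.1 (hG.abs_ham_le d₁ d₂ x p u₁ u₂)).2⟩

theorem bddBelow_ham₁ (d₁ : D₁) (d₂ : D₂) (x p : E) (u₂ : U₂) :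
    BddBelow (range fun u₁ => G.ham d₁ d₂ x p u₁ u₂) :=
  ⟨-(‖p‖ * F + K), by rintro _ ⟨u₁, rfl⟩; exact (abs_le.1 (hG.abs_ham_le d₁ d₂ x p u₁ u₂)).1⟩

variable [Nonempty U₁] [Nonempty U₂]

/-- In H₊ the maximum over u₂ is taken after u₁ is known, which is exactly the information of a
player 2 who answers by a strategy. -/
theorem exists_feedback₂ (d₁ : D₁) (d₂ : D₂) (x p : E) {ε : ℝ} (hε : 0 < ε) :
    ∃ η : U₁ → U₂, Measurable η ∧
      ∀ u₁, G.Hplus d₁ d₂ x p - ε ≤ G.ham d₁ d₂ x p u₁ (η u₁) := by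
  obtain ⟨η, hη, h⟩ := exists_measurable_feedback (hG.continuous_ham d₁ d₂ x p)
    (c := G.Hplus d₁ d₂ x p - ε) fun u₁ => by
      refine exists_lt_of_lt_ciSup (lt_of_lt_of_le (sub_lt_self _ hε) ?_)
      rw [Hplus_eq]
      refine ciInf_le ⟨-(‖p‖ * F + K), ?_⟩ u₁
      rintro _ ⟨u₁, rfl⟩
      exact (abs_le.1 (hG.abs_ham_le d₁ d₂ x p u₁ (Classical.arbitrary U₂))).1.trans
        (le_ciSup (hG.bddAbove_ham₂ d₁ d₂ x p u₁) _)
  exact ⟨η, hη, fun u₁ => (h u₁).le⟩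

theorem exists_feedback₁ (d₁ : D₁) (d₂ : D₂) (x p : E) {ε : ℝ} (hε : 0 < ε) :
    ∃ η : U₂ → U₁, Measurable η ∧
      ∀ u₂, G.ham d₁ d₂ x p (η u₂) u₂ ≤ G.Hminus d₁ d₂ x p + ε := by
  obtain ⟨η, hη, h⟩ := exists_measurable_feedback
    (g := fun u₂ u₁ => -G.ham d₁ d₂ x p u₁ u₂)
    ((hG.continuous_ham d₁ d₂ x p).neg.comp continuous_swap)
    (c := -(G.Hminus d₁ d₂ x p + ε)) fun u₂ => by
      obtain ⟨u₁, h⟩ : ∃ u₁, G.ham d₁ d₂ x p u₁ u₂ < G.Hminus d₁ d₂ x p + ε := by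
        refine exists_lt_of_ciInf_lt (lt_of_le_of_lt ?_ (lt_add_of_pos_right _ hε))
        rw [Hminus_eq]
        refine le_ciSup (f := fun u₂ => ⨅ u₁, G.ham d₁ d₂ x p u₁ u₂) ⟨‖p‖ * F + K, ?_⟩ u₂
        rintro _ ⟨u₂, rfl⟩
        exact (ciInf_le (hG.bddBelow_ham₁ d₁ d₂ x p u₂) (Classical.arbitrary U₁)).trans
          (abs_le.1 (hG.abs_ham_le d₁ d₂ x p _ u₂)).2
      exact ⟨u₁, neg_lt_neg h⟩
  exact ⟨η, hη, fun u₂ => (neg_lt_neg_iff.1 (h u₂)).le⟩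

/-- The outer optimum does not depend on the opponent's control, so a constant control nearly
attains it. -/
theorem exists_control₁_ham_le (d₁ : D₁) (d₂ : D₂) (x p : E) {ε : ℝ} (hε : 0 < ε) :
    ∃ u₁, ∀ u₂, G.ham d₁ d₂ x p u₁ u₂ ≤ G.Hplus d₁ d₂ x p + ε := by
  obtain ⟨u₁, h⟩ := exists_lt_of_ciInf_lt
    (f := fun u₁ => ⨆ u₂, G.ham d₁ d₂ x p u₁ u₂) (a := G.Hplus d₁ d₂ x p + ε)
    (lt_add_of_pos_right _ hε)
  exact ⟨u₁, fun u₂ => (le_ciSup (hG.bddAbove_ham₂ d₁ d₂ x p u₁) u₂).trans h.le⟩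

theorem exists_control₂_le_ham (d₁ : D₁) (d₂ : D₂) (x p : E) {ε : ℝ} (hε : 0 < ε) :
    ∃ u₂, ∀ u₁, G.Hminus d₁ d₂ x p - ε ≤ G.ham d₁ d₂ x p u₁ u₂ := by
  obtain ⟨u₂, h⟩ := exists_lt_of_lt_ciSup
    (f := fun u₂ => ⨅ u₁, G.ham d₁ d₂ x p u₁ u₂) (b := G.Hminus d₁ d₂ x p - ε)
    (sub_lt_self _ hε)
  exact ⟨u₂, fun u₁ => h.le.trans (ciInf_le (hG.bddBelow_ham₁ d₁ d₂ x p u₂) u₁)⟩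

/-! ### Rate of change of the value while nobody intervenes -/

omit [Nonempty U₁] [Nonempty U₂]

theorem state_eq_preState {x : E} {p : G.C1} {q : G.C2} {t s : ℝ}
    (hq : ENNReal.ofReal t ≤ q.2.2.time 0) (hs : s ∈ Ico 0 t) :
    G.state x p q s = G.preState x p q (G.state x p q) s 0 := by
  rw [(G.isMildSolution_iff.1 (hG.isMildSolution_state x p q)).2 s hs.1, preState,
    G.impulseSum_eq_sum (m := 0) (((ENNReal.ofReal_lt_ofReal_iff
      (hs.1.trans_lt hs.2)).2 hs.2).trans_le hq)]
  simp

omit [CompleteSpace E] in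
theorem norm_preState_sub_le {x : E} {p : G.C1} {q : G.C2} {y : ℝ → E} {t : ℝ} (ht : 0 ≤ t) :
    ‖G.preState x p q y t 0 - x‖ ≤ ‖G.semigroup.S t x - x‖ + F * t := by
  rw [preState, Finset.range_zero, Finset.sum_empty, add_zero, G.semigroup.evol_of_nonneg ht,
    add_sub_right_comm]
  exact (norm_add_le _ _).trans (add_le_add le_rfl
    (G.semigroup.norm_integral_evol_le ht fun _ _ => hG.norm_f_le _ _ _ _ _))

omit [CompleteSpace E] in
theorem eventually_preState_near (x : E) {ρ : ℝ} (hρ : 0 < ρ) : ∃ t₀ > 0, ∀ t, 0 ≤ t → t ≤ t₀ →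
    ∀ (p : G.C1) (q : G.C2) (y : ℝ → E), ‖G.preState x p q y t 0 - x‖ ≤ ρ := by
  obtain ⟨t₁, ht₁, h⟩ := G.semigroup.eventually_norm_S_sub_le x (half_pos hρ)
  have hF := hG.F_nonneg
  refine ⟨min t₁ (ρ / (2 * (F + 1))), by positivity, fun t ht htt p q y => ?_⟩
  refine (hG.norm_preState_sub_le ht).trans ?_
  have h1 := h t ht (htt.trans (min_le_left _ _))
  have h2 := htt.trans (min_le_right _ _)
  rw [le_div_iff₀ (by positivity)] at h2
  linarith

/-- Before any intervention the state stays near x uniformly in the controls, since f is bounded. By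
the Lipschitz conditions the Hamiltonian may then be frozen at x. -/
theorem exists_abs_ham_sub_le (x p : E) {ε : ℝ} (hε : 0 < ε) : ∃ t₀ > 0, ∀ t, t ≤ t₀ →
    ∀ (c₁ : G.C1) (c₂ : G.C2), ENNReal.ofReal t ≤ c₁.2.time 1 → ENNReal.ofReal t ≤ c₂.2.1.time 1 →
      ENNReal.ofReal t ≤ c₂.2.2.time 0 → ∀ s ∈ Ico 0 t,
      |(-inner ℝ p (G.drift c₁ c₂ (G.state x c₁ c₂) s) - G.rate c₁ c₂ (G.state x c₁ c₂) s)
        - G.ham (c₁.2.mode 0) (c₂.2.1.mode 0) x p (c₁.1.1 s) (c₂.1.1 s)| ≤ ε := by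
  have hL := hG.L_pos
  obtain ⟨t₀, ht₀, h⟩ := hG.eventually_preState_near x (ρ := ε / ((‖p‖ + 1) * L)) (by positivity)
  refine ⟨t₀, ht₀, fun t ht c₁ c₂ h1 h2 h3 s hs => ?_⟩
  have hlt := (ENNReal.ofReal_lt_ofReal_iff (hs.1.trans_lt hs.2)).2 hs.2
  have hnear := h s hs.1 (hs.2.le.trans ht) c₁ c₂ (G.state x c₁ c₂)
  rw [← hG.state_eq_preState h3 hs, le_div_iff₀ (by positivity)] at hnear
  rw [drift, rate, SwitchingControl.val_of_lt (hlt.trans_le h1),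
    SwitchingControl.val_of_lt (hlt.trans_le h2), ← inner_neg_left]
  refine (hG.abs_ham_sub_le _ _ x _ p _ _).trans ?_
  linarith

variable {φ ψ : E → ℝ} {x : E} {Lψ : ℝ≥0}

/-- If player 2 keeps the Hamiltonian large, the value decreases at a linear rate while nobody
intervenes. -/
theorem exists_runCost_add_le {V : E → ℝ} (hφ : ContDiff ℝ 1 φ) (hψ : LipschitzWith Lψ ψ)
    (hmax : IsLocalMax (fun z => V z - (φ z + ψ z)) x) {a H ε : ℝ} (hε : 0 < ε)
    (ha : ∀ᶠ δ in 𝓝[>] (0 : ℝ), a * δ ≤ (φ x + ψ x)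
      - (φ (G.semigroup.S δ x) + ψ (G.semigroup.S δ x)))
    (hpos : 4 * ε ≤ G.lam * V x + a + H - F * Lψ) :
    ∃ t₀ > 0, ∀ t, 0 < t → t ≤ t₀ → ∀ (p : G.C1) (q : G.C2), ENNReal.ofReal t ≤ p.2.time 1 →
      ENNReal.ofReal t ≤ q.2.1.time 1 → ENNReal.ofReal t ≤ q.2.2.time 0 →
      (∀ s ∈ Ico 0 t, H - ε / 2 ≤
        G.ham (p.2.mode 0) (q.2.1.mode 0) x (gradient φ x) (p.1.1 s) (q.1.1 s)) →
      G.runCost x p q t + Real.exp (-G.lam * t) * V (G.preState x p q (G.state x p q) t 0)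
        ≤ V x - ε * t := by
  obtain ⟨t₁, ht₁, h₁⟩ := G.semigroup.running_add_terminal_le hφ hψ hmax G.lam_pos hG.F_nonneg
    hG.K_nonneg hε ha hpos
  obtain ⟨t₂, ht₂, h₂⟩ := hG.exists_abs_ham_sub_le x (gradient φ x) (half_pos hε)
  refine ⟨min t₁ t₂, lt_min ht₁ ht₂, fun t ht htt p q hp hq hξ hH => ?_⟩
  have hym := (hG.isMildSolution_state x p q).1.mono_set
    (fun s (hs : s ∈ Ioc 0 t) => mem_Ici.2 hs.1.le)
  have := h₁ t ht (htt.trans (min_le_left _ _)) (G.drift p q (G.state x p q))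
    (G.rate p q (G.state x p q)) (hG.aestronglyMeasurable_drift hym p q)
    (hG.aestronglyMeasurable_rate hym p q) (fun _ _ => hG.norm_f_le _ _ _ _ _)
    (fun _ _ => hG.abs_rate_le _ _ _ _) ?_
  · rw [preState, Finset.range_zero, Finset.sum_empty, add_zero, G.semigroup.evol_of_nonneg ht.le]
    exact this
  · rw [ae_restrict_iff' measurableSet_Ioc]
    filter_upwards [Measure.ae_ne volume t] with s hst hs
    have hs' : s ∈ Ico 0 t := ⟨hs.1.le, lt_of_le_of_ne hs.2 hst⟩
    linarith [hH s hs', (abs_le.1 (h₂ t (htt.trans (min_le_right _ _)) p q hp hq hξ s hs')).1]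

/-- If player 1 keeps the Hamiltonian small, the value increases at a linear rate while nobody
intervenes. -/
theorem exists_le_runCost_add {V : E → ℝ} (hφ : ContDiff ℝ 1 φ) (hψ : LipschitzWith Lψ ψ)
    (hmin : IsLocalMin (fun z => V z - (φ z + ψ z)) x) {a H ε : ℝ} (hε : 0 < ε)
    (ha : ∀ᶠ δ in 𝓝[>] (0 : ℝ), (φ x + ψ x)
      - (φ (G.semigroup.S δ x) + ψ (G.semigroup.S δ x)) ≤ a * δ)
    (hneg : G.lam * V x + a + H + F * Lψ ≤ -(4 * ε)) :
    ∃ t₀ > 0, ∀ t, 0 < t → t ≤ t₀ → ∀ (p : G.C1) (q : G.C2), ENNReal.ofReal t ≤ p.2.time 1 →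
      ENNReal.ofReal t ≤ q.2.1.time 1 → ENNReal.ofReal t ≤ q.2.2.time 0 →
      (∀ s ∈ Ico 0 t,
        G.ham (p.2.mode 0) (q.2.1.mode 0) x (gradient φ x) (p.1.1 s) (q.1.1 s) ≤ H + ε / 2) →
      V x + ε * t ≤
        G.runCost x p q t + Real.exp (-G.lam * t) * V (G.preState x p q (G.state x p q) t 0) := by
  have hgrad : gradient (-φ) x = -gradient φ x := by
    rw [gradient, gradient, fderiv_neg, map_neg]
  -- A local minimum becomes a maximum after changing all signs, including that of the running cost;
  -- the estimate used allows running costs of either sign.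
  obtain ⟨t₁, ht₁, h₁⟩ := G.semigroup.running_add_terminal_le (V := -V) (φ := -φ) (ψ := -ψ)
    (a := -a) (H := -H) hφ.neg hψ.neg
    (by
      refine Filter.Eventually.mono hmin fun z hz => ?_
      simp only [Pi.neg_apply]
      linarith) G.lam_pos hG.F_nonneg hG.K_nonneg hε
    (by
      filter_upwards [ha] with δ hδ
      simp only [Pi.neg_apply]
      linarith) (by simp only [Pi.neg_apply]; linarith)
  obtain ⟨t₂, ht₂, h₂⟩ := hG.exists_abs_ham_sub_le x (gradient φ x) (half_pos hε)
  refine ⟨min t₁ t₂, lt_min ht₁ ht₂, fun t ht htt p q hp hq hξ hH => ?_⟩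
  have hym := (hG.isMildSolution_state x p q).1.mono_set
    (fun s (hs : s ∈ Ioc 0 t) => mem_Ici.2 hs.1.le)
  have := h₁ t ht (htt.trans (min_le_left _ _)) (G.drift p q (G.state x p q))
    (fun s => -G.rate p q (G.state x p q) s) (hG.aestronglyMeasurable_drift hym p q)
    (hG.aestronglyMeasurable_rate hym p q).neg (fun _ _ => hG.norm_f_le _ _ _ _ _)
    (fun _ _ => by rw [abs_neg]; exact hG.abs_rate_le _ _ _ _) ?_
  · rw [preState, Finset.range_zero, Finset.sum_empty, add_zero, G.semigroup.evol_of_nonneg ht.le]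
    simp only [mul_neg, integral_neg, Pi.neg_apply] at this
    rw [runCost]
    linarith
  · rw [ae_restrict_iff' measurableSet_Ioc]
    filter_upwards [Measure.ae_ne volume t] with s hst hs
    have hs' : s ∈ Ico 0 t := ⟨hs.1.le, lt_of_le_of_ne hs.2 hst⟩
    rw [hgrad, inner_neg_left]
    linarith [hH s hs', (abs_le.1 (h₂ t (htt.trans (min_le_right _ _)) p q hp hq hξ s hs')).2]

end Regular

/-! ### Chains of interventions within a short time -/

theorem _root_.SwitchingControl.exp_mul_sum_le_partialCost {D : Type*} {lam : ℝ} (hlam : 0 ≤ lam)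
    {c : D → D → ℝ} (hc : ∀ d d', 0 ≤ c d d') (d : SwitchingControl D) {t : ℝ} (ht : 0 ≤ t) {n : ℕ}
    (hn : d.time n ≤ ENNReal.ofReal t) :
    Real.exp (-lam * t) * ∑ j ∈ Finset.range n, c (d.mode j) (d.mode (j + 1))
      ≤ d.partialCost lam c n := by
  rw [Finset.mul_sum]
  refine Finset.sum_le_sum fun j hj => mul_le_mul_of_nonneg_right ?_ (hc _ _)
  have := toReal_le_of_le_ofReal ht ((d.time_mono (Finset.mem_range.1 hj)).trans hn)
  have := mul_le_mul_of_nonneg_left this hlam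
  exact Real.exp_le_exp.2 (by linarith)

/-- Interventions made by time t are discounted at least as weakly as the terminal value at t, so
their undiscounted costs can be put under the common factor of the latter. -/
theorem exp_mul_sum_le_partialImpulseCost (hl : ∀ ξ, 0 ≤ G.l ξ) (ξ : ImpulseControl G.K) {t : ℝ}
    (ht : 0 ≤ t) {m : ℕ} (hm : ∀ j < m, ξ.time j ≤ ENNReal.ofReal t) :
    Real.exp (-G.lam * t) * ∑ j ∈ Finset.range m, G.l (ξ.vec j) ≤ G.partialImpulseCost ξ m := by
  rw [Finset.mul_sum]
  refine Finset.sum_le_sum fun j hj => mul_le_mul_of_nonneg_right ?_ (hl _)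
  have := toReal_le_of_le_ofReal ht (hm j (Finset.mem_range.1 hj))
  have := mul_le_mul_of_nonneg_left this G.lam_pos.le
  exact Real.exp_le_exp.2 (by linarith)

theorem _root_.SwitchingControl.mode_ne_of_time_le {D : Type*} (d : SwitchingControl D) {t : ℝ}
    {n : ℕ} (hn : d.time n ≤ ENNReal.ofReal t) {j : ℕ} (hj : j < n) : d.mode j ≠ d.mode (j + 1) :=
  d.mode_ne j (((d.time_mono hj).trans hn).trans_lt ENNReal.ofReal_lt_top)

namespace ObeysObstacles

variable {V : D₁ → D₂ → E → ℝ} (hV : G.ObeysObstacles V)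
include hV

/-- The obstacle inequality telescopes along a chain of switches, so no number of switches gains
anything. -/
theorem sub_sum_switch₁_le (d : ℕ → D₁) (d₂ : D₂) (x : E) {n : ℕ}
    (hd : ∀ j < n, d j ≠ d (j + 1)) :
    V (d n) d₂ x - ∑ j ∈ Finset.range n, G.c₁ (d j) (d (j + 1)) ≤ V (d 0) d₂ x := by
  induction n with
  | zero => simp
  | succ n ih =>
    have h1 := ih fun j hj => hd j (by omega)
    have h2 := hV.ge_switch₁ _ d₂ x _ (hd n (by omega))
    rw [Finset.sum_range_succ]
    linarith

theorem le_add_sum_switch₂ (d₁ : D₁) (d : ℕ → D₂) (x : E) {n : ℕ}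
    (hd : ∀ j < n, d j ≠ d (j + 1)) :
    V d₁ (d 0) x ≤ V d₁ (d n) x + ∑ j ∈ Finset.range n, G.c₂ (d j) (d (j + 1)) := by
  induction n with
  | zero => simp
  | succ n ih =>
    have h1 := ih fun j hj => hd j (by omega)
    have h2 := hV.le_switch₂ d₁ _ x _ (hd n (by omega))
    rw [Finset.sum_range_succ]
    linarith

theorem le_add_sum_impulse (d₁ : D₁) (d₂ : D₂) (x : E) (ξ : ℕ → G.K) (m : ℕ) :
    V d₁ d₂ x ≤ V d₁ d₂ (x + ∑ j ∈ Finset.range m, (ξ j : E))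
      + ∑ j ∈ Finset.range m, G.l (ξ j) := by
  induction m with
  | zero => simp
  | succ m ih =>
    have h := hV.le_impulse d₁ d₂ (x + ∑ j ∈ Finset.range m, (ξ j : E)) (ξ m)
    rw [Finset.sum_range_succ, Finset.sum_range_succ, ← add_assoc x]
    linarith

/-- The first switch loses δ and the later ones cannot win it back. -/
theorem sub_sum_switch₁_le_of_gap {d₁ : D₁} {d₂ : D₂} {x : E} {δ : ℝ}
    (h : ∀ d', d₁ ≠ d' → V d' d₂ x - G.c₁ d₁ d' ≤ V d₁ d₂ x - δ) (d : ℕ → D₁) (hd₀ : d 0 = d₁)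
    {n : ℕ} (hn : 0 < n) (hd : ∀ j < n, d j ≠ d (j + 1)) :
    V (d n) d₂ x - ∑ j ∈ Finset.range n, G.c₁ (d j) (d (j + 1)) ≤ V d₁ d₂ x - δ := by
  obtain ⟨n, rfl⟩ : ∃ k, n = k + 1 := ⟨n - 1, by omega⟩
  have h1 := hV.sub_sum_switch₁_le (fun j => d (j + 1)) d₂ x (n := n)
    fun j hj => hd (j + 1) (by omega)
  have h2 := h (d 1) (hd₀ ▸ hd 0 hn)
  rw [Finset.sum_range_succ', hd₀]
  simp only [zero_add] at h1 ⊢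
  linarith

/-- The gap is taken from the first impulse if there is one, otherwise from the first switch; all
other interventions obey the weak obstacle inequalities. Treating impulses before switches is
harmless, because switching costs do not depend on the state. -/
theorem add_le_of_gap {d₁ : D₁} {d₂ : D₂} {x : E} {δ : ℝ}
    (h : ∀ d', d₂ ≠ d' → V d₁ d₂ x + δ ≤ V d₁ d' x + G.c₂ d₂ d')
    (h' : ∀ ξ : G.K, V d₁ d₂ x + δ ≤ V d₁ d₂ (x + ξ) + G.l ξ) (d : ℕ → D₂) (hd₀ : d 0 = d₂)
    (ξ : ℕ → G.K) {n m : ℕ} (hnm : 0 < n ∨ 0 < m) (hd : ∀ j < n, d j ≠ d (j + 1)) :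
    V d₁ d₂ x + δ ≤ V d₁ (d n) (x + ∑ j ∈ Finset.range m, (ξ j : E))
      + ∑ j ∈ Finset.range n, G.c₂ (d j) (d (j + 1)) + ∑ j ∈ Finset.range m, G.l (ξ j) := by
  rcases Nat.eq_zero_or_pos m with rfl | hm
  · obtain ⟨n, rfl⟩ : ∃ k, n = k + 1 := ⟨n - 1, by omega⟩
    have h1 := hV.le_add_sum_switch₂ d₁ (fun j => d (j + 1)) x (n := n)
      fun j hj => hd (j + 1) (by omega)
    have h2 := h (d 1) (hd₀ ▸ hd 0 (by omega))
    rw [Finset.sum_range_succ', hd₀]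
    simp only [zero_add, Finset.range_zero, Finset.sum_empty, add_zero] at h1 ⊢
    linarith
  · obtain ⟨m, rfl⟩ : ∃ k, m = k + 1 := ⟨m - 1, by omega⟩
    have h1 := hV.le_add_sum_impulse d₁ d₂ (x + ξ 0) (fun j => ξ (j + 1)) m
    have h2 := hV.le_add_sum_switch₂ d₁ d (x + ∑ j ∈ Finset.range (m + 1), (ξ j : E)) hd
    rw [hd₀] at h2
    have h3 := h' (ξ 0)
    rw [Finset.sum_range_succ' (fun j => G.l (ξ j))]
    rw [add_assoc, add_comm (ξ 0 : E), ← Finset.sum_range_succ' (fun j => (ξ j : E))] at h1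
    linarith

theorem continuous (d₁ : D₁) (d₂ : D₂) : Continuous (V d₁ d₂) := by
  rw [Metric.continuous_iff]
  intro x ε hε
  obtain ⟨δ, hδ, h⟩ := hV.modulus (ε / 2) (half_pos hε)
  refine ⟨δ, hδ, fun y hy => ?_⟩
  rw [dist_eq_norm] at hy
  rw [Real.dist_eq, abs_lt]
  have h1 := h d₁ d₂ y x hy.le
  have h2 := h d₁ d₂ x y (by rw [norm_sub_rev]; exact hy.le)
  constructor <;> linarith

end ObeysObstacles

namespace Regular

variable (hG : G.Regular F K L)
include hG

variable {V : D₁ → D₂ → E → ℝ} {φ ψ : E → ℝ} {Lψ : ℝ≥0} {d₁ : D₁} {d₂ : D₂} {x : E} {a H ε δ : ℝ}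

/-- Without switches of player 1 the linear rate gives a gain of εt. With switches, at whatever
times before t, the final state is still near x, so their net effect is that of the same chain made
at x, which loses δ up to small errors. -/
theorem exists_runCost_sub_partialCost_add_le (hV : G.ObeysObstacles V) (hφ : ContDiff ℝ 1 φ)
    (hψ : LipschitzWith Lψ ψ)
    (hmax : IsLocalMax (fun z => V d₁ d₂ z - (φ z + ψ z)) x) (hε : 0 < ε)
    (ha : ∀ᶠ δ in 𝓝[>] (0 : ℝ), a * δ ≤ (φ x + ψ x)
      - (φ (G.semigroup.S δ x) + ψ (G.semigroup.S δ x)))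
    (hpos : 4 * ε ≤ G.lam * V d₁ d₂ x + a + H - F * Lψ) (hδ : 0 < δ)
    (hgap : ∀ d', d₁ ≠ d' → V d' d₂ x - G.c₁ d₁ d' ≤ V d₁ d₂ x - δ) :
    ∃ t > 0, ∃ γ > 0, ∀ (p : G.C1) (q : G.C2) (n : ℕ), p.2.mode 0 = d₁ → q.2.1.mode 0 = d₂ →
      p.2.time n ≤ ENNReal.ofReal t → ENNReal.ofReal t ≤ p.2.time (n + 1) →
      ENNReal.ofReal t ≤ q.2.1.time 1 → ENNReal.ofReal t ≤ q.2.2.time 0 →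
      (∀ s ∈ Ico 0 t, H - ε / 2 ≤ G.ham d₁ d₂ x (gradient φ x) (p.1.1 s) (q.1.1 s)) →
      G.runCost x p q t - p.2.partialCost G.lam G.c₁ n + Real.exp (-G.lam * t) *
        (V (p.2.mode n) d₂ (G.preState x p q (G.state x p q) t 0) + γ) ≤ V d₁ d₂ x - γ := by
  obtain ⟨t₁, ht₁, h₁⟩ := hG.exists_runCost_add_le hφ hψ hmax hε ha hpos
  obtain ⟨ρ, hρ, hmod⟩ := hV.modulus (δ / 8) (by positivity)
  obtain ⟨t₂, ht₂, h₂⟩ := hG.eventually_preState_near x hρ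
  have hK := hG.K_nonneg
  have hlam := G.lam_pos
  -- This t makes the running cost at most δ/8 and the discount factor at least 1/2. The gap then
  -- leaves δ/2, from which running cost, modulus of continuity and γ each take at most δ/8.
  set t := min (min t₁ t₂) (min (δ / (8 * (K + 1))) (1 / (2 * G.lam))) with ht_def
  have ht : 0 < t := by positivity
  have htt₁ : t ≤ t₁ := (min_le_left _ _).trans (min_le_left _ _)
  have htt₂ : t ≤ t₂ := (min_le_left _ _).trans (min_le_right _ _)
  have htK : t * (8 * (K + 1)) ≤ δ :=
    (le_div_iff₀ (by positivity)).1 ((min_le_right _ _).trans (min_le_left _ _))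
  have htlam : t * (2 * G.lam) ≤ 1 :=
    (le_div_iff₀ (by positivity)).1 ((min_le_right _ _).trans (min_le_right _ _))
  have he1 := exp_neg_mul_le_one hlam.le ht.le
  have he2 := abs_le.1 (abs_exp_neg_mul_sub_one_le hlam.le ht.le)
  have he0 := Real.exp_pos (-G.lam * t)
  set e := Real.exp (-G.lam * t)
  refine ⟨t, ht, min (ε * t / 2) (δ / 8), by positivity, ?_⟩
  intro p q n hp hq hn hn' hq1 hq2 hham
  set γ := min (ε * t / 2) (δ / 8) with hγ_def
  have hγ : 0 < γ := by positivity
  have hγ1 : γ ≤ ε * t / 2 := min_le_left _ _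
  have hγ2 : γ ≤ δ / 8 := min_le_right _ _
  have heγ : e * γ ≤ γ := mul_le_of_le_one_left hγ.le he1
  rcases Nat.eq_zero_or_pos n with rfl | hpos
  · have := h₁ t ht htt₁ p q hn' hq1 hq2 (by rw [hp, hq]; exact hham)
    rw [hp, SwitchingControl.partialCost, Finset.sum_range_zero, mul_add]
    linarith
  · have hc := p.2.exp_mul_sum_le_partialCost hlam.le hG.c₁_nonneg ht.le hn
    have hS := hV.sub_sum_switch₁_le_of_gap hgap p.2.mode hp hpos
      fun j hj => p.2.mode_ne_of_time_le hn hj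
    have hm := hmod (p.2.mode n) d₂ _ x (h₂ t ht.le htt₂ p q (G.state x p q))
    have hr := hG.runCost_le x p q ht.le
    have hVx := hV.nonneg d₁ d₂ x
    set S := ∑ j ∈ Finset.range n, G.c₁ (p.2.mode j) (p.2.mode (j + 1))
    have h3 := mul_le_mul_of_nonneg_left (add_le_add hm hS) he0.le
    have h4 : e * V d₁ d₂ x ≤ V d₁ d₂ x := mul_le_of_le_one_left hVx he1
    have h5 : 1 / 2 * δ ≤ e * δ := mul_le_mul_of_nonneg_right (by linarith) hδ.le
    have h6 : e * (δ / 8) ≤ δ / 8 := mul_le_of_le_one_left (by positivity) he1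
    rw [mul_add]
    nlinarith

/-- Every nonempty batch of interventions of player 2 overpays by δ. Impulses may carry the state
arbitrarily far, so the modulus of continuity must be uniform on all of E. -/
theorem exists_le_cost_add (hV : G.ObeysObstacles V) (hδ : 0 < δ)
    (h : ∀ d', d₂ ≠ d' → V d₁ d₂ x + δ ≤ V d₁ d' x + G.c₂ d₂ d')
    (h' : ∀ ξ : G.K, V d₁ d₂ x + δ ≤ V d₁ d₂ (x + ξ) + G.l ξ) :
    ∃ t₁ > 0, ∃ ρ > 0, ∀ θ, 0 ≤ θ → θ ≤ t₁ → ∀ (d : SwitchingControl D₂) (ξ : ImpulseControl G.K)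
      (n m : ℕ) (w : E), d.mode 0 = d₂ → d.time n ≤ ENNReal.ofReal θ →
      (∀ j < m, ξ.time j ≤ ENNReal.ofReal θ) → 0 < n ∨ 0 < m →
      ‖w - (x + ∑ j ∈ Finset.range m, (ξ.vec j : E))‖ ≤ ρ →
      V d₁ d₂ x + δ / 4 ≤ d.partialCost G.lam G.c₂ n + G.partialImpulseCost ξ m +
        Real.exp (-G.lam * θ) * (V d₁ (d.mode n) w - δ / 4) := by
  obtain ⟨ρ, hρ, hmod⟩ := hV.modulus (δ / 4) (by positivity)
  have hlam := G.lam_pos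
  have hVx := hV.nonneg d₁ d₂ x
  -- This bound makes discounting V(x) + δ cost at most δ/4; modulus and restart error take another
  -- δ/4 each.
  refine ⟨δ / (4 * (G.lam * (V d₁ d₂ x + δ))), by positivity, ρ, hρ, ?_⟩
  intro θ hθ hθ₁ d ξ n m w hd hn hm hnm hw
  rw [le_div_iff₀ (by positivity)] at hθ₁
  have hgap := hV.add_le_of_gap h h' d.mode hd ξ.vec hnm fun j hj => d.mode_ne_of_time_le hn hj
  have hw' := hmod d₁ (d.mode n) (x + ∑ j ∈ Finset.range m, (ξ.vec j : E)) w
    (by rwa [norm_sub_rev])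
  have h1 := d.exp_mul_sum_le_partialCost hlam.le hG.c₂_nonneg hθ hn
  have h2 := exp_mul_sum_le_partialImpulseCost hG.l_nonneg ξ hθ hm
  have he1 := exp_neg_mul_le_one hlam.le hθ
  have he2 := (abs_le.1 (abs_exp_neg_mul_sub_one_le hlam.le hθ)).1
  have he0 := Real.exp_pos (-G.lam * θ)
  set e := Real.exp (-G.lam * θ)
  have h3 := mul_le_mul_of_nonneg_left (hgap.trans
    (add_le_add_left (add_le_add_left hw' _) _)) he0.le
  have h4 := mul_le_mul_of_nonneg_right he2 (show 0 ≤ V d₁ d₂ x + δ by linarith)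
  have h5 : e * (δ / 4) ≤ δ / 4 := mul_le_of_le_one_left (by positivity) he1
  nlinarith

/-- The two alternatives for player 2, with common t and γ: wait until t, or intervene by some time
θ ≤ t. The tolerance ρ allows a restart slightly after the impulses, when the semigroup has already
moved them. -/
theorem exists_le_value_bounds (hV : G.ObeysObstacles V) (hφ : ContDiff ℝ 1 φ)
    (hψ : LipschitzWith Lψ ψ)
    (hmin : IsLocalMin (fun z => V d₁ d₂ z - (φ z + ψ z)) x) (hε : 0 < ε)
    (ha : ∀ᶠ δ in 𝓝[>] (0 : ℝ), (φ x + ψ x)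
      - (φ (G.semigroup.S δ x) + ψ (G.semigroup.S δ x)) ≤ a * δ)
    (hneg : G.lam * V d₁ d₂ x + a + H + F * Lψ ≤ -(4 * ε)) (hδ : 0 < δ)
    (h : ∀ d', d₂ ≠ d' → V d₁ d₂ x + δ ≤ V d₁ d' x + G.c₂ d₂ d')
    (h' : ∀ ξ : G.K, V d₁ d₂ x + δ ≤ V d₁ d₂ (x + ξ) + G.l ξ) :
    ∃ t > 0, ∃ γ > 0,
      (∀ (p : G.C1) (q : G.C2), p.2.mode 0 = d₁ → q.2.1.mode 0 = d₂ →
        ENNReal.ofReal t ≤ p.2.time 1 → ENNReal.ofReal t ≤ q.2.1.time 1 →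
        ENNReal.ofReal t ≤ q.2.2.time 0 →
        (∀ s ∈ Ico 0 t, G.ham d₁ d₂ x (gradient φ x) (p.1.1 s) (q.1.1 s) ≤ H + ε / 2) →
        V d₁ d₂ x + γ ≤ G.runCost x p q t + Real.exp (-G.lam * t) *
          (V d₁ d₂ (G.preState x p q (G.state x p q) t 0) - γ)) ∧
      ∃ ρ > 0, ∀ (p : G.C1) (q : G.C2) (θ : ℝ) (n m : ℕ) (w : E), 0 ≤ θ → θ ≤ t →
        q.2.1.mode 0 = d₂ → q.2.1.time n ≤ ENNReal.ofReal θ →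
        (∀ j < m, q.2.2.time j ≤ ENNReal.ofReal θ) → 0 < n ∨ 0 < m →
        ‖w - (G.preState x p q (G.state x p q) θ 0
          + ∑ j ∈ Finset.range m, (q.2.2.vec j : E))‖ ≤ ρ →
        V d₁ d₂ x + γ ≤ G.runCost x p q θ + (q.2.1.partialCost G.lam G.c₂ n
          + G.partialImpulseCost q.2.2 m) + Real.exp (-G.lam * θ) *
            (V d₁ (q.2.1.mode n) w - γ) := by
  obtain ⟨t₁, ht₁, h₁⟩ := hG.exists_le_runCost_add hφ hψ hmin hε ha hneg
  obtain ⟨t₂, ht₂, ρ, hρ, h₂⟩ := hG.exists_le_cost_add hV hδ h h'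
  obtain ⟨t₃, ht₃, h₃⟩ := hG.eventually_preState_near x (half_pos hρ)
  have hlam := G.lam_pos
  set t := min t₁ (min t₂ t₃)
  have ht : 0 < t := by positivity
  set γ := min (ε * t / 2) (δ / 4)
  have hγ : 0 < γ := by positivity
  have hγ1 : γ ≤ ε * t / 2 := min_le_left _ _
  have hγ2 : γ ≤ δ / 4 := min_le_right _ _
  refine ⟨t, ht, γ, hγ, ?_, ρ / 2, half_pos hρ, ?_⟩
  · intro p q hp hq hp1 hq1 hq2 hham
    have := h₁ t ht (min_le_left _ _) p q hp1 hq1 hq2 (by rw [hp, hq]; exact hham)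
    have he : Real.exp (-G.lam * t) * γ ≤ γ :=
      mul_le_of_le_one_left hγ.le (exp_neg_mul_le_one hlam.le ht.le)
    rw [mul_sub]
    linarith
  · intro p q θ n m w hθ hθt hq hn hm hnm hw
    have hnear := h₃ θ hθ (hθt.trans ((min_le_right _ _).trans (min_le_right _ _))) p q
      (G.state x p q)
    have := h₂ θ hθ (hθt.trans ((min_le_right _ _).trans (min_le_left _ _))) q.2.1 q.2.2 n m w hq
      hn hm hnm (by
        refine (norm_sub_le_norm_sub_add_norm_sub _ _ _).trans ((add_le_add hw ?_).trans_eq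
          (add_halves ρ))
        rwa [add_sub_add_right_eq_sub])
    have hr := hG.runCost_nonneg x p q θ
    have he : Real.exp (-G.lam * θ) * γ ≤ Real.exp (-G.lam * θ) * (δ / 4) :=
      mul_le_mul_of_nonneg_left hγ2 (Real.exp_pos _).le
    rw [mul_sub] at this ⊢
    linarith

end Regular

/-! ### The first intervention of player 2 -/

theorem _root_.SwitchingControl.exists_time_lt_le {D : Type*} (d : SwitchingControl D) {t : ℝ}
    (ht : 0 < t) : ∃ n, d.time n < ENNReal.ofReal t ∧ ENNReal.ofReal t ≤ d.time (n + 1) := by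
  classical
  have hex : ∃ j, ENNReal.ofReal t ≤ d.time j :=
    ((d.time_tendsto.eventually (lt_mem_nhds (ENNReal.ofReal_lt_top (r := t)))).exists).imp
      fun _ h => h.le
  have h0 : Nat.find hex ≠ 0 := by
    intro h
    have := Nat.find_spec hex
    rw [h, d.time_zero] at this
    exact absurd (ENNReal.ofReal_pos.2 ht) (not_lt.2 this)
  obtain ⟨n, hn⟩ := Nat.exists_eq_succ_of_ne_zero h0
  refine ⟨n, not_le.1 (Nat.find_min hex (by omega)), ?_⟩
  rw [← Nat.succ_eq_add_one, ← hn]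
  exact Nat.find_spec hex

variable (G) in
/-- The time of the first intervention of player 2, stopped at `t`. -/
def firstIntervention (t : ℝ) (q : G.C2) : ℝ :=
  (min (ENNReal.ofReal t) (min (q.2.1.time 1) (q.2.2.time 0))).toReal

theorem ofReal_firstIntervention (t : ℝ) (q : G.C2) : ENNReal.ofReal (G.firstIntervention t q)
    = min (ENNReal.ofReal t) (min (q.2.1.time 1) (q.2.2.time 0)) :=
  ENNReal.ofReal_toReal (ne_top_of_le_ne_top ENNReal.ofReal_ne_top (min_le_left _ _))

theorem firstIntervention_nonneg (t : ℝ) (q : G.C2) : 0 ≤ G.firstIntervention t q :=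
  ENNReal.toReal_nonneg

theorem firstIntervention_le {t : ℝ} (ht : 0 ≤ t) (q : G.C2) : G.firstIntervention t q ≤ t :=
  toReal_le_of_le_ofReal ht (min_le_left _ _)

theorem ofReal_firstIntervention_le_time_zero (t : ℝ) (q : G.C2) :
    ENNReal.ofReal (G.firstIntervention t q) ≤ q.2.2.time 0 := by
  rw [ofReal_firstIntervention]
  exact (min_le_right _ _).trans (min_le_right _ _)

/-- The impulses counted by then are thus simultaneous: at that time the semigroup has not yet acted
on any of them. -/
theorem time_eq_firstIntervention {t : ℝ} {q : G.C2} {j : ℕ}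
    (hj : j < q.2.2.count (G.firstIntervention t q)) :
    q.2.2.time j = ENNReal.ofReal (G.firstIntervention t q) :=
  le_antisymm (q.2.2.time_le_of_lt_count hj)
    ((ofReal_firstIntervention_le_time_zero t q).trans (q.2.2.time_mono (Nat.zero_le _)))

/-- The stopping time property: whether the first intervention has occurred by time s is visible
from the control on the closed interval up to s. -/
theorem firstIntervention_eq_of_agree2 {s t : ℝ} {q q' : G.C2} (h : G.Agree2 s q q')
    (hs : G.firstIntervention t q ≤ s) : G.firstIntervention t q' = G.firstIntervention t q := by
  have hle := ENNReal.ofReal_le_ofReal hs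
  rw [ofReal_firstIntervention] at hle
  rw [firstIntervention, firstIntervention]
  congr 1
  set r := ENNReal.ofReal s
  have h1 : q.2.1.time 1 ≤ r ∨ q'.2.1.time 1 ≤ r → q.2.1.time 1 = q'.2.1.time 1 :=
    fun h' => (h.2.1 1 h').1
  have h2 : q.2.2.time 0 ≤ r ∨ q'.2.2.time 0 ≤ r → q.2.2.time 0 = q'.2.2.time 0 :=
    fun h' => (h.2.2 0 h').1
  -- Agreement says nothing about times beyond s, so the times are compared after truncation at r;
  -- truncating the overall minimum there changes nothing, as it is at most r.
  have key : ∀ a b : ℝ≥0∞, (a ≤ r ∨ b ≤ r → a = b) → min a r = min b r := by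
    intro a b hab
    by_cases h' : a ≤ r ∨ b ≤ r
    · rw [hab h']
    · push Not at h'
      rw [min_eq_right h'.1.le, min_eq_right h'.2.le]
  have hle' : min (ENNReal.ofReal t) (min (q'.2.1.time 1) (q'.2.2.time 0)) ≤ r := by
    simp only [min_le_iff] at hle ⊢
    rcases hle with h' | h' | h'
    · exact .inl h'
    · exact .inr (.inl (h1 (.inl h') ▸ h'))
    · exact .inr (.inr (h2 (.inl h') ▸ h'))
  rw [← min_eq_left hle, ← min_eq_left hle']
  have hd : ∀ a b : ℝ≥0∞, min (min a b) r = min (min a r) (min b r) :=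
    fun a b => inf_inf_distrib_right a b r
  simp only [hd, key _ _ h1, key _ _ h2]

/-! ### The four differential inequalities off the obstacles -/

namespace Regular

variable (hG : G.Regular F K L)
include hG

variable {φ ψ : E → ℝ} {Lψ : ℝ≥0} {d₁ : D₁} {d₂ : D₂} {x : E} {a ε δ : ℝ}
variable [Nonempty U₁] [Nonempty U₂]

/-- If the inequality failed, player 2 could answer u₁ by the feedback of H₊ until t and then
restart almost optimally. This strategy would guarantee at most the value minus γ. -/
theorem lowerVal_differential_le (hφ : ContDiff ℝ 1 φ) (hψ : LipschitzWith Lψ ψ)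
    (hmax : IsLocalMax (fun z => G.lowerVal d₁ d₂ z - (φ z + ψ z)) x)
    (ha : ∀ᶠ δ in 𝓝[>] (0 : ℝ), a * δ ≤ (φ x + ψ x)
      - (φ (G.semigroup.S δ x) + ψ (G.semigroup.S δ x))) (hδ : 0 < δ)
    (hgap : ∀ d', d₁ ≠ d' → G.lowerVal d' d₂ x - G.c₁ d₁ d' ≤ G.lowerVal d₁ d₂ x - δ) :
    G.lam * G.lowerVal d₁ d₂ x + a + G.Hplus d₁ d₂ x (gradient φ x) - F * Lψ ≤ 0 := by
  by_contra! hpos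
  set ε := (G.lam * G.lowerVal d₁ d₂ x + a + G.Hplus d₁ d₂ x (gradient φ x) - F * Lψ) / 4
    with hε_def
  have hε : 0 < ε := by positivity
  obtain ⟨t, ht, γ, hγ, h⟩ := hG.exists_runCost_sub_partialCost_add_le hG.obeysObstacles_lowerVal
    (H := G.Hplus d₁ d₂ x (gradient φ x)) hφ hψ hmax hε ha (by linarith) hδ hgap
  obtain ⟨η, hη, hham⟩ := hG.exists_feedback₂ d₁ d₂ x (gradient φ x) (half_pos hε)
  obtain ⟨β, hβ, hβ'⟩ := hG.exists_strategy2_restart d₂ x hη ht.le hγ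
  have := hG.lowerVal_le (d₁ := d₁) (x := x) (r := G.lowerVal d₁ d₂ x - γ) hβ fun p hp => by
    obtain ⟨h1, h2, h3, h4⟩ := hβ' p
    refine h4.trans (EReal.coe_le_coe_iff.2 ?_)
    exact h p (β p) (p.2.idx t) hp (hβ.2 p) (p.2.time_idx_le t) (p.2.lt_time_idx_succ t).le h2 h3
      fun s hs => by rw [h1 s hs.2]; exact hham _
  linarith

/-- Against any α player 2 plays a constant control near the outer maximum of H₋ until t. Only the
switches of player 1 strictly before t are counted, as those at t may depend on the restart. -/
theorem upperVal_differential_le (hφ : ContDiff ℝ 1 φ) (hψ : LipschitzWith Lψ ψ)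
    (hmax : IsLocalMax (fun z => G.upperVal d₁ d₂ z - (φ z + ψ z)) x)
    (ha : ∀ᶠ δ in 𝓝[>] (0 : ℝ), a * δ ≤ (φ x + ψ x)
      - (φ (G.semigroup.S δ x) + ψ (G.semigroup.S δ x))) (hδ : 0 < δ)
    (hgap : ∀ d', d₁ ≠ d' → G.upperVal d' d₂ x - G.c₁ d₁ d' ≤ G.upperVal d₁ d₂ x - δ) :
    G.lam * G.upperVal d₁ d₂ x + a + G.Hminus d₁ d₂ x (gradient φ x) - F * Lψ ≤ 0 := by
  by_contra! hpos
  set ε := (G.lam * G.upperVal d₁ d₂ x + a + G.Hminus d₁ d₂ x (gradient φ x) - F * Lψ) / 4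
    with hε_def
  have hε : 0 < ε := by positivity
  obtain ⟨t, ht, γ, hγ, h⟩ := hG.exists_runCost_sub_partialCost_add_le hG.obeysObstacles_upperVal
    (H := G.Hminus d₁ d₂ x (gradient φ x)) hφ hψ hmax hε ha (by linarith) hδ hgap
  obtain ⟨b, hham⟩ := hG.exists_control₂_le_ham d₁ d₂ x (gradient φ x) (half_pos hε)
  have := hG.upperVal_le (d₁ := d₁) (d₂ := d₂) (x := x) (r := G.upperVal d₁ d₂ x - γ) fun α hα => by
    obtain ⟨n, hn, hn'⟩ := (α (G.idle2 b d₂)).2.exists_time_lt_le ht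
    obtain ⟨q, hq, hJ⟩ := hG.exists_control2_restart x hα b ht hγ rfl rfl hn hn'
    refine ⟨q, hq, hJ.trans (EReal.coe_le_coe_iff.2 ?_)⟩
    exact h _ _ n (hα.2 _) rfl hn.le hn' (by simp [idle2, SwitchingControl.const])
      (by simp [idle2, ImpulseControl.none]) fun s _ => hham _
  linarith

/-- Player 1 uses the feedback of H₋ until player 2 first intervenes, or until t, and then restarts.
An early intervention overpays because of the gaps at the two obstacles. -/
theorem upperVal_differential_ge (hφ : ContDiff ℝ 1 φ) (hψ : LipschitzWith Lψ ψ)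
    (hmin : IsLocalMin (fun z => G.upperVal d₁ d₂ z - (φ z + ψ z)) x)
    (ha : ∀ᶠ δ in 𝓝[>] (0 : ℝ), (φ x + ψ x)
      - (φ (G.semigroup.S δ x) + ψ (G.semigroup.S δ x)) ≤ a * δ) (hδ : 0 < δ)
    (h : ∀ d', d₂ ≠ d' → G.upperVal d₁ d₂ x + δ ≤ G.upperVal d₁ d' x + G.c₂ d₂ d')
    (h' : ∀ ξ : G.K, G.upperVal d₁ d₂ x + δ ≤ G.upperVal d₁ d₂ (x + ξ) + G.l ξ) :
    0 ≤ G.lam * G.upperVal d₁ d₂ x + a + G.Hminus d₁ d₂ x (gradient φ x) + F * Lψ := by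
  by_contra! hneg
  set ε := -(G.lam * G.upperVal d₁ d₂ x + a + G.Hminus d₁ d₂ x (gradient φ x) + F * Lψ) / 4
    with hε_def
  have hε : 0 < ε := by linarith
  obtain ⟨t, ht, γ, hγ, hA, ρ, hρ, hB⟩ := hG.exists_le_value_bounds hG.obeysObstacles_upperVal
    (H := G.Hminus d₁ d₂ x (gradient φ x)) hφ hψ hmin hε ha (by linarith) hδ h h'
  obtain ⟨η, hη, hham⟩ := hG.exists_feedback₁ d₁ d₂ x (gradient φ x) (half_pos hε)
  obtain ⟨α, hα, hα'⟩ := hG.exists_strategy1_restart d₁ x hη (θ := G.firstIntervention t)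
    (firstIntervention_nonneg t) (fun s q q' => firstIntervention_eq_of_agree2) hγ
  have := hG.le_upperVal (d₂ := d₂) (x := x) (r := G.upperVal d₁ d₂ x + γ) hα fun q hq => by
    obtain ⟨h1, h2, h3, h4⟩ := hα' q
    refine le_trans (EReal.coe_le_coe_iff.2 ?_) h4
    set θ := G.firstIntervention t q
    have hθ : 0 ≤ θ := firstIntervention_nonneg t q
    by_cases hnm : 0 < q.2.1.idx θ ∨ 0 < q.2.2.count θ
    · refine hB (α q) q θ _ _ _ hθ (firstIntervention_le ht.le q) hq (q.2.1.time_idx_le θ)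
        (fun j hj => q.2.2.time_le_of_lt_count hj) hnm ?_
      have : G.preState x (α q) q (G.state x (α q) q) θ (q.2.2.count θ)
          = G.preState x (α q) q (G.state x (α q) q) θ 0
            + ∑ j ∈ Finset.range (q.2.2.count θ), (q.2.2.vec j : E) := by
        rw [preState, preState, Finset.range_zero, Finset.sum_empty, add_zero]
        congr 1
        refine Finset.sum_congr rfl fun j hj => ?_
        rw [time_eq_firstIntervention (Finset.mem_range.1 hj), ENNReal.toReal_ofReal hθ, sub_self,
          G.semigroup.evol_zero]
        rfl
      rw [this, sub_self, norm_zero]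
      exact hρ.le
    · push Not at hnm
      obtain ⟨hn, hm⟩ := hnm
      have hn := Nat.le_zero.1 hn
      have hm := Nat.le_zero.1 hm
      have ht1 := q.2.1.lt_time_idx_succ θ
      have ht2 := q.2.2.lt_time_count θ
      rw [hn, zero_add] at ht1
      rw [hm] at ht2
      -- With no intervention up to and including θ, the minimum defining θ can only be t.
      have hθt : ENNReal.ofReal θ = ENNReal.ofReal t := by
        have := G.ofReal_firstIntervention t q
        rcases min_choice (ENNReal.ofReal t) (min (q.2.1.time 1) (q.2.2.time 0)) with h5 | h5
        · rw [this, h5]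
        · rw [h5] at this
          exact absurd (lt_min ht1 ht2) (not_lt.2 this.ge)
      have hθt' : θ = t := by
        rw [← ENNReal.toReal_ofReal hθ, hθt, ENNReal.toReal_ofReal ht.le]
      rw [hθt'] at h1 h3 ht1 ht2 hn hm ⊢
      have := hA (α q) q h2 hq h3 ht1.le ht2.le fun s hs => by rw [h1 s hs.2]; exact hham _
      rw [SwitchingControl.val_eq_mode_idx, hn, hm, show q.2.1.mode 0 = d₂ from hq]
      simpa [SwitchingControl.partialCost, partialImpulseCost] using this
  linarith

/-- Against any β player 1 plays a constant control near the outer minimum of H₊, watches the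
response to it, and restarts at t or just after the first intervention of player 2. -/
theorem lowerVal_differential_ge (hφ : ContDiff ℝ 1 φ) (hψ : LipschitzWith Lψ ψ)
    (hmin : IsLocalMin (fun z => G.lowerVal d₁ d₂ z - (φ z + ψ z)) x)
    (ha : ∀ᶠ δ in 𝓝[>] (0 : ℝ), (φ x + ψ x)
      - (φ (G.semigroup.S δ x) + ψ (G.semigroup.S δ x)) ≤ a * δ) (hδ : 0 < δ)
    (h : ∀ d', d₂ ≠ d' → G.lowerVal d₁ d₂ x + δ ≤ G.lowerVal d₁ d' x + G.c₂ d₂ d')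
    (h' : ∀ ξ : G.K, G.lowerVal d₁ d₂ x + δ ≤ G.lowerVal d₁ d₂ (x + ξ) + G.l ξ) :
    0 ≤ G.lam * G.lowerVal d₁ d₂ x + a + G.Hplus d₁ d₂ x (gradient φ x) + F * Lψ := by
  by_contra! hneg
  set ε := -(G.lam * G.lowerVal d₁ d₂ x + a + G.Hplus d₁ d₂ x (gradient φ x) + F * Lψ) / 4
    with hε_def
  have hε : 0 < ε := by linarith
  obtain ⟨t, ht, γ, hγ, hA, ρ, hρ, hB⟩ := hG.exists_le_value_bounds hG.obeysObstacles_lowerVal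
    (H := G.Hplus d₁ d₂ x (gradient φ x)) hφ hψ hmin hε ha (by linarith) hδ h h'
  obtain ⟨b, hham⟩ := hG.exists_control₁_ham_le d₁ d₂ x (gradient φ x) (half_pos hε)
  have := hG.le_lowerVal (d₁ := d₁) (d₂ := d₂) (x := x) (r := G.lowerVal d₁ d₂ x + γ) fun β hβ => by
    set p₀ : G.C1 := G.idle1 b d₁ with hp₀
    set q := β p₀ with hq₀
    have hq : q.2.1.mode 0 = d₂ := hβ.2 _
    by_cases hnot : ENNReal.ofReal t ≤ q.2.1.time 1 ∧ ENNReal.ofReal t ≤ q.2.2.time 0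
    · obtain ⟨p, hp, hJ⟩ := hG.exists_control1_restart x hβ b ht hγ hp₀ hq₀ (n := 0) (m := 0)
        (by rw [q.2.1.time_zero]; exact ENNReal.ofReal_pos.2 ht) hnot.1 (by simp) hnot.2
      refine ⟨p, hp, le_trans (EReal.coe_le_coe_iff.2 ?_) hJ⟩
      have := hA p₀ q rfl hq (by simp [hp₀, idle1, SwitchingControl.const]) hnot.1 hnot.2
        fun s _ => hham _
      rw [hq]
      simpa [SwitchingControl.partialCost, partialImpulseCost] using this
    · set θ := G.firstIntervention t q with hθ_def
      have hθ : 0 ≤ θ := firstIntervention_nonneg t q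
      set n := q.2.1.idx θ with hn
      set m := q.2.2.count θ with hm
      have ht1 := q.2.1.lt_time_idx_succ θ
      have ht2 := q.2.2.lt_time_count θ
      have hθ_eq := G.ofReal_firstIntervention t q
      rw [← hθ_def] at hθ_eq
      have hlt : min (q.2.1.time 1) (q.2.2.time 0) < ENNReal.ofReal t := by
        rw [min_lt_iff]; simpa [not_and_or, or_iff_not_imp_left] using hnot
      rw [min_eq_right hlt.le] at hθ_eq
      have hθt : ENNReal.ofReal θ < ENNReal.ofReal t := hθ_eq ▸ hlt
      have hnm : 0 < n ∨ 0 < m := by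
        by_contra! hnm
        rw [← hn, Nat.le_zero.1 hnm.1] at ht1
        rw [← hm, Nat.le_zero.1 hnm.2] at ht2
        exact absurd (lt_min ht1 ht2) (not_lt.2 hθ_eq.ge)
      obtain ⟨r, hr, hnear⟩ := G.semigroup.eventually_norm_S_sub_le
        (∑ j ∈ Finset.range m, (q.2.2.vec j : E)) hρ
      -- A restart at θ itself could alter the response of β at θ, so player 1 waits until s > θ.
      -- This s is so close to θ that no further intervention precedes it and that S(s - θ) moves
      -- the sum of the impulses by at most ρ.
      obtain ⟨s, hs, hst, hsr, hs1, hs2⟩ : ∃ s, θ < s ∧ s ≤ t ∧ s ≤ θ + r ∧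
          ENNReal.ofReal s ≤ q.2.1.time (n + 1) ∧ ENNReal.ofReal s ≤ q.2.2.time m := by
        set B := min (min (ENNReal.ofReal t) (ENNReal.ofReal (θ + r)))
          (min (q.2.1.time (n + 1)) (q.2.2.time m))
        have hB : B ≠ ⊤ := ne_top_of_le_ne_top ENNReal.ofReal_ne_top
          ((min_le_left _ _).trans (min_le_left _ _))
        have hθB : ENNReal.ofReal θ < B := lt_min (lt_min hθt
          ((ENNReal.ofReal_lt_ofReal_iff (by linarith)).2 (by linarith))) (lt_min ht1 ht2)
        refine ⟨B.toReal, (ENNReal.ofReal_lt_iff_lt_toReal hθ hB).1 hθB,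
          toReal_le_of_le_ofReal ht.le ((min_le_left _ _).trans (min_le_left _ _)),
          toReal_le_of_le_ofReal (by linarith) ((min_le_left _ _).trans (min_le_right _ _)), ?_⟩
        rw [ENNReal.ofReal_toReal hB]
        exact ⟨(min_le_right _ _).trans (min_le_left _ _),
          (min_le_right _ _).trans (min_le_right _ _)⟩
      have hs0 : 0 < s := hθ.trans_lt hs
      have hθs : ENNReal.ofReal θ < ENNReal.ofReal s := (ENNReal.ofReal_lt_ofReal_iff hs0).2 hs
      have hns : q.2.1.time n < ENNReal.ofReal s := (q.2.1.time_idx_le θ).trans_lt hθs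
      have hms : ∀ j < m, q.2.2.time j < ENNReal.ofReal s :=
        fun j hj => (q.2.2.time_le_of_lt_count hj).trans_lt hθs
      obtain ⟨p, hp, hJ⟩ := hG.exists_control1_restart x hβ b hs0 hγ hp₀ hq₀ hns hs1 hms hs2
      refine ⟨p, hp, le_trans (EReal.coe_le_coe_iff.2 ?_) hJ⟩
      refine hB p₀ q s n m _ hs0.le hst hq hns.le (fun j hj => (hms j hj).le) hnm ?_
      have : G.preState x p₀ q (G.state x p₀ q) s m = G.preState x p₀ q (G.state x p₀ q) s 0
          + G.semigroup.S (s - θ) (∑ j ∈ Finset.range m, (q.2.2.vec j : E)) := by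
        rw [preState, preState, Finset.range_zero, Finset.sum_empty, add_zero, map_sum]
        congr 1
        refine Finset.sum_congr rfl fun j hj => ?_
        rw [time_eq_firstIntervention (Finset.mem_range.1 hj), ENNReal.toReal_ofReal hθ,
          G.semigroup.evol_of_nonneg (by linarith)]
      rw [this, add_sub_add_left_eq_sub]
      exact hnear _ (by linarith) (by linarith)
  linarith

end Regular

end HybridGame

/-! ### From differential inequalities to the two quasivariational systems -/

theorem EReal.exists_real_lt_of_affine_pos {r s : ℝ} {a : EReal}
    (h : 0 < (r : EReal) + a + (s : EReal)) : ∃ b : ℝ, (b : EReal) < a ∧ 0 < r + b + s := by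
  induction a with
  | bot => simp at h
  | top => exact ⟨1 - r - s, EReal.coe_lt_top _, by linarith⟩
  | coe a =>
    have h : 0 < r + a + s := by exact_mod_cast h
    exact ⟨a - (r + a + s) / 2, EReal.coe_lt_coe_iff.2 (by linarith), by linarith⟩

/-- The generator term may be infinite. The differential estimates only need a real number on the
proper side of it for which the inequality is still violated. -/
theorem EReal.exists_real_gt_of_affine_neg {r s : ℝ} {a : EReal}
    (h : (r : EReal) + a + (s : EReal) < 0) : ∃ b : ℝ, a < (b : EReal) ∧ r + b + s < 0 := by
  induction a with
  | top => simp at h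
  | bot => exact ⟨-1 - r - s, EReal.bot_lt_coe _, by linarith⟩
  | coe a =>
    have h : r + a + s < 0 := by exact_mod_cast h
    exact ⟨a - (r + a + s) / 2, EReal.coe_lt_coe_iff.2 (by linarith), by linarith⟩

theorem EReal.coe_sub_nonneg {v : ℝ} {m : EReal} : 0 ≤ (v : EReal) - m ↔ m ≤ (v : EReal) :=
  EReal.sub_nonneg (.inl (EReal.coe_ne_top v)) (.inl (EReal.coe_ne_bot v))

namespace HybridGame

variable {E U₁ U₂ D₁ D₂ : Type*} [NormedAddCommGroup E] [InnerProductSpace ℝ E] [CompleteSpace E]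
  [MetricSpace U₁] [CompactSpace U₁] [MeasurableSpace U₁] [BorelSpace U₁]
  [MetricSpace U₂] [CompactSpace U₂] [MeasurableSpace U₂] [BorelSpace U₂]
  {G : HybridGame E U₁ U₂ D₁ D₂} {F K L : ℝ}

/-- Of the joint limit in δ and y only the points y = x are used. -/
theorem eventually_of_lt_DAminus {Φ : E → ℝ} {x : E} {a : ℝ} (h : (a : EReal) < G.DAminus Φ x) :
    ∀ᶠ δ in 𝓝[>] (0 : ℝ), a * δ ≤ Φ x - Φ (G.semigroup.S δ x) := by
  have h := (Filter.eventually_lt_of_lt_liminf h).curry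
  filter_upwards [h, self_mem_nhdsWithin] with δ hδ hpos
  exact ((lt_div_iff₀ hpos).1 (EReal.coe_lt_coe_iff.1 hδ.self_of_nhds)).le

theorem eventually_of_DAplus_lt {Φ : E → ℝ} {x : E} {a : ℝ} (h : G.DAplus Φ x < (a : EReal)) :
    ∀ᶠ δ in 𝓝[>] (0 : ℝ), Φ x - Φ (G.semigroup.S δ x) ≤ a * δ := by
  have h := (Filter.eventually_lt_of_limsup_lt h).curry
  filter_upwards [h, self_mem_nhdsWithin] with δ hδ hpos
  exact ((div_lt_iff₀ hpos).1 (EReal.coe_lt_coe_iff.1 hδ.self_of_nhds)).le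

/-- A real number strictly between the obstacle and the value yields one gap δ for all target modes,
including the case of a single mode, where the obstacle is -∞. -/
theorem exists_gap_of_Mplus_lt {V : D₁ → D₂ → E → ℝ} {d₁ : D₁} {d₂ : D₂} {x : E}
    (h : G.Mplus V d₁ d₂ x < V d₁ d₂ x) :
    ∃ δ > 0, ∀ d', d₁ ≠ d' → V d' d₂ x - G.c₁ d₁ d' ≤ V d₁ d₂ x - δ := by
  obtain ⟨r, hr, hrV⟩ := EReal.lt_iff_exists_real_btwn.1 h
  refine ⟨V d₁ d₂ x - r, sub_pos.2 (EReal.coe_lt_coe_iff.1 hrV), fun d' hd => ?_⟩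
  rw [sub_sub_cancel]
  exact EReal.coe_le_coe_iff.1 ((le_iSup₂ (f := fun d' (_ : d' ≠ d₁) =>
    ((V d' d₂ x - G.c₁ d₁ d' : ℝ) : EReal)) d' hd.symm).trans hr.le)

theorem exists_gap_of_lt_Mminus {V : D₁ → D₂ → E → ℝ} {d₁ : D₁} {d₂ : D₂} {x : E}
    (h : (V d₁ d₂ x : EReal) < G.Mminus V d₁ d₂ x) :
    ∃ δ > 0, ∀ d', d₂ ≠ d' → V d₁ d₂ x + δ ≤ V d₁ d' x + G.c₂ d₂ d' := by
  obtain ⟨r, hVr, hr⟩ := EReal.lt_iff_exists_real_btwn.1 h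
  refine ⟨r - V d₁ d₂ x, sub_pos.2 (EReal.coe_lt_coe_iff.1 hVr), fun d' hd => ?_⟩
  rw [add_sub_cancel]
  exact EReal.coe_le_coe_iff.1 (hr.le.trans (iInf₂_le (f := fun d' (_ : d' ≠ d₂) =>
    ((V d₁ d' x + G.c₂ d₂ d' : ℝ) : EReal)) d' hd.symm))

theorem exists_gap_of_lt_N {v : E → ℝ} {x : E} (h : (v x : EReal) < G.N v x) :
    ∃ δ > 0, ∀ ξ : G.K, v x + δ ≤ v (x + ξ) + G.l ξ := by
  obtain ⟨r, hVr, hr⟩ := EReal.lt_iff_exists_real_btwn.1 h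
  refine ⟨r - v x, sub_pos.2 (EReal.coe_lt_coe_iff.1 hVr), fun ξ => ?_⟩
  rw [add_sub_cancel]
  exact EReal.coe_le_coe_iff.1 (hr.le.trans (iInf_le _ ξ))

namespace ObeysObstacles

variable {V : D₁ → D₂ → E → ℝ} (hV : G.ObeysObstacles V)
include hV

theorem Mplus_le (d₁ : D₁) (d₂ : D₂) (x : E) : G.Mplus V d₁ d₂ x ≤ V d₁ d₂ x :=
  iSup₂_le fun d' hd => EReal.coe_le_coe_iff.2 (hV.ge_switch₁ d₁ d₂ x d' hd.symm)

theorem le_Mminus (d₁ : D₁) (d₂ : D₂) (x : E) : (V d₁ d₂ x : EReal) ≤ G.Mminus V d₁ d₂ x :=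
  le_iInf₂ fun d' hd => EReal.coe_le_coe_iff.2 (hV.le_switch₂ d₁ d₂ x d' hd.symm)

theorem le_N (d₁ : D₁) (d₂ : D₂) (x : E) : (V d₁ d₂ x : EReal) ≤ G.N (V d₁ d₂) x :=
  le_iInf fun ξ => EReal.coe_le_coe_iff.2 (hV.le_impulse d₁ d₂ x ξ)

/-- The outer minimum is nonpositive at once on the obstacle M₊; off it, the terms with M₋ and N are
nonpositive anyway, so only the differential term matters. -/
theorem sqvi1_nonpos {d₁ : D₁} {d₂ : D₂} {x : E} {P : EReal}
    (h : G.Mplus V d₁ d₂ x < V d₁ d₂ x → P ≤ 0) : G.sqvi1 V d₁ d₂ x P ≤ 0 := by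
  rcases (hV.Mplus_le d₁ d₂ x).lt_or_eq with hlt | heq
  · exact min_le_of_left_le (max_le (h hlt) (max_le (EReal.sub_nonpos.2 (hV.le_Mminus d₁ d₂ x))
      (EReal.sub_nonpos.2 (hV.le_N d₁ d₂ x))))
  · exact min_le_of_right_le (EReal.sub_nonpos.2 heq.ge)

theorem sqvi2_nonpos {d₁ : D₁} {d₂ : D₂} {x : E} {P : EReal}
    (h : G.Mplus V d₁ d₂ x < V d₁ d₂ x → P ≤ 0) : G.sqvi2 V d₁ d₂ x P ≤ 0 := by
  refine max_le ?_ (max_le (EReal.sub_nonpos.2 (hV.le_Mminus d₁ d₂ x))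
    (EReal.sub_nonpos.2 (hV.le_N d₁ d₂ x)))
  rcases (hV.Mplus_le d₁ d₂ x).lt_or_eq with hlt | heq
  · exact min_le_of_left_le (h hlt)
  · exact min_le_of_right_le (EReal.sub_nonpos.2 heq.ge)

/-- Contact with M₋ or N makes the inner maximum nonnegative, and the term with M₊ is always
nonnegative. So the differential term matters only off both obstacles of player 2. -/
theorem sqvi1_nonneg {d₁ : D₁} {d₂ : D₂} {x : E} {P : EReal}
    (h : (V d₁ d₂ x : EReal) < G.Mminus V d₁ d₂ x → (V d₁ d₂ x : EReal) < G.N (V d₁ d₂) x → 0 ≤ P) :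
    0 ≤ G.sqvi1 V d₁ d₂ x P := by
  refine le_min ?_ (EReal.coe_sub_nonneg.2 (hV.Mplus_le d₁ d₂ x))
  rcases (hV.le_Mminus d₁ d₂ x).lt_or_eq with hM | hM
  · rcases (hV.le_N d₁ d₂ x).lt_or_eq with hN | hN
    · exact le_max_of_le_left (h hM hN)
    · exact le_max_of_le_right (le_max_of_le_right (EReal.coe_sub_nonneg.2 hN.ge))
  · exact le_max_of_le_right (le_max_of_le_left (EReal.coe_sub_nonneg.2 hM.ge))

theorem sqvi2_nonneg {d₁ : D₁} {d₂ : D₂} {x : E} {P : EReal}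
    (h : (V d₁ d₂ x : EReal) < G.Mminus V d₁ d₂ x → (V d₁ d₂ x : EReal) < G.N (V d₁ d₂) x → 0 ≤ P) :
    0 ≤ G.sqvi2 V d₁ d₂ x P := by
  rcases (hV.le_Mminus d₁ d₂ x).lt_or_eq with hM | hM
  · rcases (hV.le_N d₁ d₂ x).lt_or_eq with hN | hN
    · exact le_max_of_le_left (le_min (h hM hN) (EReal.coe_sub_nonneg.2 (hV.Mplus_le d₁ d₂ x)))
    · exact le_max_of_le_right (le_max_of_le_right (EReal.coe_sub_nonneg.2 hN.ge))
  · exact le_max_of_le_right (le_max_of_le_left (EReal.coe_sub_nonneg.2 hM.ge))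

/-- Functions that obey the obstacle constraints solve both systems as soon as the differential
inequalities hold off the obstacles. -/
theorem isApproxViscositySolution (hF : 0 ≤ F) {H : D₁ → D₂ → E → E → ℝ}
    (hsub : ∀ (φ ψ : E → ℝ) (L : ℝ≥0) (d₁ : D₁) (d₂ : D₂) (x : E) (a δ : ℝ), ContDiff ℝ 1 φ →
      LipschitzWith L ψ → IsLocalMax (fun z => V d₁ d₂ z - (φ z + ψ z)) x →
      (∀ᶠ δ in 𝓝[>] (0 : ℝ), a * δ ≤ (φ x + ψ x)
        - (φ (G.semigroup.S δ x) + ψ (G.semigroup.S δ x))) → 0 < δ →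
      (∀ d', d₁ ≠ d' → V d' d₂ x - G.c₁ d₁ d' ≤ V d₁ d₂ x - δ) →
      G.lam * V d₁ d₂ x + a + H d₁ d₂ x (gradient φ x) - F * L ≤ 0)
    (hsuper : ∀ (φ ψ : E → ℝ) (L : ℝ≥0) (d₁ : D₁) (d₂ : D₂) (x : E) (a δ : ℝ), ContDiff ℝ 1 φ →
      LipschitzWith L ψ → IsLocalMin (fun z => V d₁ d₂ z - (φ z + ψ z)) x →
      (∀ᶠ δ in 𝓝[>] (0 : ℝ), (φ x + ψ x)
        - (φ (G.semigroup.S δ x) + ψ (G.semigroup.S δ x)) ≤ a * δ) → 0 < δ →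
      (∀ d', d₂ ≠ d' → V d₁ d₂ x + δ ≤ V d₁ d' x + G.c₂ d₂ d') →
      (∀ ξ : G.K, V d₁ d₂ x + δ ≤ V d₁ d₂ (x + ξ) + G.l ξ) →
      0 ≤ G.lam * V d₁ d₂ x + a + H d₁ d₂ x (gradient φ x) + F * L) :
    G.IsApproxViscositySolution H V := by
  have sub : ∀ (φ ψ : E → ℝ) (L : ℝ≥0), ContDiff ℝ 1 φ → LipschitzWith L ψ →
      ∀ (d₁ : D₁) (d₂ : D₂) (x : E), IsLocalMax (fun z => V d₁ d₂ z - (φ z + ψ z)) x →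
      G.Mplus V d₁ d₂ x < V d₁ d₂ x →
      G.pdeTerm H V d₁ d₂ x φ (G.DAminus (fun z => φ z + ψ z) x) (-((F + 1) * L)) ≤ 0 := by
    intro φ ψ L hφ hψ d₁ d₂ x hmax hM
    by_contra! hpos
    obtain ⟨a, ha, h⟩ := EReal.exists_real_lt_of_affine_pos hpos
    obtain ⟨δ, hδ, hgap⟩ := exists_gap_of_Mplus_lt hM
    have := hsub φ ψ L d₁ d₂ x a δ hφ hψ hmax (eventually_of_lt_DAminus ha) hδ hgap
    linarith [L.coe_nonneg]
  have super : ∀ (φ ψ : E → ℝ) (L : ℝ≥0), ContDiff ℝ 1 φ → LipschitzWith L ψ →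
      ∀ (d₁ : D₁) (d₂ : D₂) (x : E), IsLocalMin (fun z => V d₁ d₂ z - (φ z + ψ z)) x →
      (V d₁ d₂ x : EReal) < G.Mminus V d₁ d₂ x → (V d₁ d₂ x : EReal) < G.N (V d₁ d₂) x →
      0 ≤ G.pdeTerm H V d₁ d₂ x φ (G.DAplus (fun z => φ z + ψ z) x) ((F + 1) * L) := by
    intro φ ψ L hφ hψ d₁ d₂ x hmin hM hN
    by_contra! hneg
    obtain ⟨a, ha, h⟩ := EReal.exists_real_gt_of_affine_neg hneg
    obtain ⟨δ, hδ, hgap⟩ := exists_gap_of_lt_Mminus hM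
    obtain ⟨δ', hδ', hgap'⟩ := exists_gap_of_lt_N hN
    have := hsuper φ ψ L d₁ d₂ x a (min δ δ') hφ hψ hmin (eventually_of_DAplus_lt ha)
      (lt_min hδ hδ')
      (fun d' hd => (add_le_add_right (min_le_left _ _) _).trans (hgap d' hd))
      (fun ξ => (add_le_add_right (min_le_right _ _) _).trans (hgap' ξ))
    linarith [L.coe_nonneg]
  -- The bound F on f would do as error constant, for every radius; 1 is added because a positive
  -- constant is required and F may be 0.
  have hF' : 0 < F + 1 := by linarith
  exact
    ⟨⟨⟨hV.continuous, fun _ _ => ⟨F + 1, hF', fun φ ψ L hφ hψ d₁ d₂ x _ hmax =>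
        hV.sqvi1_nonpos (sub φ ψ L hφ hψ d₁ d₂ x hmax)⟩⟩,
      ⟨hV.continuous, fun _ _ => ⟨F + 1, hF', fun φ ψ L hφ hψ d₁ d₂ x _ hmin =>
        hV.sqvi1_nonneg (super φ ψ L hφ hψ d₁ d₂ x hmin)⟩⟩⟩,
     ⟨⟨hV.continuous, fun _ _ => ⟨F + 1, hF', fun φ ψ L hφ hψ d₁ d₂ x _ hmax =>
        hV.sqvi2_nonpos (sub φ ψ L hφ hψ d₁ d₂ x hmax)⟩⟩,
      ⟨hV.continuous, fun _ _ => ⟨F + 1, hF', fun φ ψ L hφ hψ d₁ d₂ x _ hmin =>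
        hV.sqvi2_nonneg (super φ ψ L hφ hψ d₁ d₂ x hmin)⟩⟩⟩⟩

end ObeysObstacles

end HybridGame

end

theorem theorem2p7 {E U₁ U₂ D₁ D₂ : Type*}
    [NormedAddCommGroup E] [InnerProductSpace ℝ E] [CompleteSpace E]
    [TopologicalSpace.SeparableSpace E]
    [MetricSpace U₁] [CompactSpace U₁] [Nonempty U₁] [MeasurableSpace U₁] [BorelSpace U₁]
    [MetricSpace U₂] [CompactSpace U₂] [Nonempty U₂] [MeasurableSpace U₂] [BorelSpace U₂]
    [Finite D₁] [Finite D₂]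
    (G : HybridGame E U₁ U₂ D₁ D₂) (hA1 : G.A1) (hA2 : G.A2) :
    (∃ V : D₁ → D₂ → E → ℝ,
      (∀ d₁ d₂ x, G.lowerValue d₁ d₂ x = (V d₁ d₂ x : EReal)) ∧
      G.IsApproxViscositySolution G.Hplus V) ∧
    (∃ V : D₁ → D₂ → E → ℝ,
      (∀ d₁ d₂ x, G.upperValue d₁ d₂ x = (V d₁ d₂ x : EReal)) ∧
      G.IsApproxViscositySolution G.Hminus V) := by
  obtain ⟨F, K, L, hG⟩ := HybridGame.exists_regular hA1 hA2
  exact ⟨⟨G.lowerVal, fun d₁ d₂ x => (hG.coe_lowerVal d₁ d₂ x).symm,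
      hG.obeysObstacles_lowerVal.isApproxViscositySolution hG.F_nonneg
        (fun _ _ _ _ _ _ _ _ hφ hψ => hG.lowerVal_differential_le hφ hψ)
        (fun _ _ _ _ _ _ _ _ hφ hψ => hG.lowerVal_differential_ge hφ hψ)⟩,
    ⟨G.upperVal, fun d₁ d₂ x => (hG.coe_upperVal d₁ d₂ x).symm,
      hG.obeysObstacles_upperVal.isApproxViscositySolution hG.F_nonneg
        (fun _ _ _ _ _ _ _ _ hφ hψ => hG.upperVal_differential_le hφ hψ)
        (fun _ _ _ _ _ _ _ _ hφ hψ => hG.upperVal_differential_ge hφ hψ)⟩⟩
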